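/- All spaces are real, and an operator is a bounded linear map. A lattice homomorphism is a linear map that preserves $\vee$ and $\wedge$ (continuity is not required of it). For a Banach space $E$, $\mathrm{FBL}[E]$ is the free Banach lattice generated by $E$, i.e. the closed sublattice generated by the evaluations $\delta_x(x^*)=x^*(x)$, $x\in E$, in the lattice of positively homogeneous $f:E^*\to\mathbb R$ of finite norm $\|f\|=\sup\{\sum_{i=1}^n|f(x_i^*)| : n\in\mathbb N,\ x_i^*\in E^*,\ \sup_{\|x\|\le1}\sum_{i=1}^n|x_i^*(x)|\le1\}$. A quasi-Banach lattice $X$ is $p$-convex if $\|(\sum_k|x_k|^p)^{1/p}\|\le C(\sum_k\|x_k\|^p)^{1/p}$ for all finite families in $X$; the least such $C$ is $M^{(p)}(X)$. It is a $p$-Banach lattice if $\|x+y\|^p\le\|x\|^p+\|y\|^p$. For $0<p\le1$, $E$ is $p$-natural if it embeds linearly and isometrically in a $p$-convex $p$-Banach lattice $X$ with $M^{(p)}(X)=1$; $p_E=\sup\{p\in(0,1):E\text{ is }p\text{-natural}\}$. For $0<p\le 1$ and a $p$-natural $E$, $\mathrm{FpBL}^{(p)}[E]$ is the free $p$-convex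 $p$-Banach lattice generated by $E$: a $p$-convex $p$-Banach lattice with $M^{(p)}=1$ and a linear isometric embedding $\delta$ of $E$ into it such that every operator $T$ from $E$ to a $p$-convex $p$-Banach lattice $X$ has a unique extension to a lattice homomorphism $\widehat T$ with $\widehat T\delta=T$ and $\|\widehat T\|\le M^{(p)}(X)\|T\|$. Equip $L_{1,\infty}(\mathbb R)$ with the quasi-norm $\|f\|_{1,\infty}=\sup_{s>0}s\,|\{|f|>s\}|$. **Theorem.** For $f\in L_1(\mathbb R)$ the principal value $Hf(x)=\mathrm{p.v.}\int_{\mathbb R}\frac{f(t)}{x-t}\,dt$ exists for almost every $x$, and $H:L_1(\mathbb R)\to L_{1,\infty}(\mathbb R)$ is a bounded linear operator (a multiple of the Hilbert transform). The target $L_{1,\infty}(\mathbb R)$ is a $\frac12$-Banach lattice and is $p$-convex for every $0<p<1$. Moreover: 1. There is no lattice homomorphism $\widehat H:\mathrm{FBL}[L_1(\mathbb R)]\to L_{1,\infty}(\mathbb R)$ with $\widehat H\delta_f=Hf$ for all $f\in L_1(\mathbb R)$. 2. $\big\|\sum_{k=0}^{n-1}\big|H(1_{[k/n,(k+1)/n]})\big|\big\|_{1,\infty}\to\infty$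 as $n\to\infty$. 3. $L_1(\mathbb R)$ has trivial Rademacher type, and there is no constant $C>0$ such that, for all $0<p\le1$, every operator $T$ from $L_1(\mathbb R)$ to a $p$-convex $p$-Banach lattice $X$ has a unique extension to a lattice homomorphism $\widehat T:\mathrm{FBL}[L_1(\mathbb R)]\to X$ with $\|\widehat T\|\le C\,M^{(p)}(X)\,\|T\|$. So the hypothesis of non-trivial type cannot be dropped from the theorem which asserts this property for every Banach space of non-trivial type. 4. $E=L_1(\mathbb R)$ is $p_E$-natural with $p_E=1$, but the automatic extension property, which holds for $\mathrm{FpBL}^{(r)}[E]$ with $r<p_E$, fails for the index $r=p_E$ (where the free lattice is $\mathrm{FBL}[E]$): for each fixed $0<q<1$ there is no $C>0$ such that every operator $T$ from $L_1(\mathbb R)$ to a $q$-convex quasi-Banach lattice $X$ has a unique extension to a lattice homomorphism $\widehat T:\mathrm{FBL}[L_1(\mathbb R)]\to X$ with $\|\widehat T\|\le C\,M^{(q)}(X)\,\|T\|$. Also, for each $0<p<1$, $\mathrm{FpBL}^{(p)}[L_1(\mathbb R)]$ is not lattice isomorphic to the free $1$-convex Banach lattice $\mathrm{FpBL}^{(1)}[L_1(\mathbb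 R)]$, that is, to the free Banach lattice generated by $L_1(\mathbb R)$. -/

import Mathlib

open MeasureTheory Filter Topology
open scoped ENNReal

namespace QBL

section Lattices

variable {E F X Y : Type} [AddCommGroup E] [Module ℝ E] [AddCommGroup F] [Module ℝ F] [Lattice F]
  [AddCommGroup X] [Module ℝ X] [Lattice X] [AddCommGroup Y] [Module ℝ Y] [Lattice Y]

/-- `N` is a complete quasi-norm on the real vector space `E`, so `(E, N)` is a
quasi-Banach space. -/
structure IsQuasiBanach (N : E → ℝ) : Prop where
  nonneg : ∀ x, 0 ≤ N x
  eq_zero : ∀ x, N x = 0 → x = 0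
  smul : ∀ (c : ℝ) (x : E), N (c • x) = |c| * N x
  add_le : ∃ D : ℝ, 1 ≤ D ∧ ∀ x y, N (x + y) ≤ D * (N x + N y)
  complete : ∀ u : ℕ → E,
    (∀ ε : ℝ, 0 < ε → ∃ n₀ : ℕ, ∀ m n : ℕ, n₀ ≤ m → n₀ ≤ n → N (u m - u n) < ε) →
    ∃ x, Tendsto (fun n => N (u n - x)) atTop (𝓝 0)

/-- `(X, N)` is a quasi-Banach lattice. -/
structure IsQuasiBanachLattice (N : X → ℝ) : Prop extends IsQuasiBanach N where
  add_mono : ∀ x y z : X, x ≤ y → x + z ≤ y + z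
  smul_mono : ∀ (c : ℝ) (x y : X), 0 ≤ c → x ≤ y → c • x ≤ c • y
  solid : ∀ x y : X, |x| ≤ |y| → N x ≤ N y

/-- `(X, N)` is a `p`-Banach lattice: a quasi-Banach lattice whose quasi-norm is a `p`-norm. -/
structure IsPBanachLattice (p : ℝ) (N : X → ℝ) : Prop extends IsQuasiBanachLattice N where
  p_add_le : ∀ x y : X, N (x + y) ^ p ≤ N x ^ p + N y ^ p

/-- For `0 < p ≤ 1`: `z` is the element `(∑ |x k| ^ p) ^ (1 / p)` of the lattice.
The function `t ↦ (∑ (t k) ^ p) ^ (1 / p)` is concave, continuous and positively homogeneous on the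
positive orthant, hence it is the infimum of its linear majorants `t ↦ ∑ a k * t k`; since the
Yudin-Krivine calculus is a lattice homomorphism, the element it assigns to this function is the
greatest lower bound of the corresponding elements `∑ a k • |x k|`. -/
def IsPSum (p : ℝ) {n : ℕ} (x : Fin n → X) (z : X) : Prop :=
  IsGLB {w : X | ∃ a : Fin n → ℝ,
    (∀ t : Fin n → ℝ, (∀ k, 0 ≤ t k) → (∑ k, t k ^ p) ^ (1 / p) ≤ ∑ k, a k * t k) ∧
    w = ∑ k, a k • |x k|} z

/-- `C` is an admissible constant in the inequality defining (lattice) `p`-convexity,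
for `0 < p ≤ 1`. -/
def PConvexWith (p : ℝ) (N : X → ℝ) (C : ℝ) : Prop :=
  0 < C ∧ ∀ (n : ℕ) (x : Fin n → X) (z : X), IsPSum p x z →
    N z ≤ C * (∑ k, N (x k) ^ p) ^ (1 / p)

/-- Lattice `p`-convexity, for `0 < p ≤ 1`. -/
def IsPConvex (p : ℝ) (N : X → ℝ) : Prop := ∃ C, PConvexWith p N C

/-- The `p`-convexity constant. -/
noncomputable def convexityConst (p : ℝ) (N : X → ℝ) : ℝ := sInf {C | PConvexWith p N C}

/-- A linear map that preserves the lattice operations. No continuity is imposed. -/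
def IsLatticeHom (T : X →ₗ[ℝ] Y) : Prop :=
  (∀ x y, T (x ⊔ y) = T x ⊔ T y) ∧ ∀ x y, T (x ⊓ y) = T x ⊓ T y

/-- A bounded linear map, called an operator. -/
def IsOperator (NE : E → ℝ) {G : Type} [AddCommGroup G] [Module ℝ G] (NG : G → ℝ)
    (T : E →ₗ[ℝ] G) : Prop :=
  ∃ C, ∀ e, NG (T e) ≤ C * NE e

/-- The norm of an operator. -/
noncomputable def opNorm (NE : E → ℝ) {G : Type} [AddCommGroup G] [Module ℝ G] (NG : G → ℝ)
    (T : E →ₗ[ℝ] G) : ℝ :=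
  sInf {C | 0 ≤ C ∧ ∀ e, NG (T e) ≤ C * NE e}

/-- There is a unique lattice homomorphism `S : F → X` with `S ∘ δ = T` and `‖S‖ ≤ c`. -/
def ExtendsUniquely (δ : E →ₗ[ℝ] F) (NF : F → ℝ) (NX : X → ℝ) (T : E →ₗ[ℝ] X) (c : ℝ) : Prop :=
  ∃! S : F →ₗ[ℝ] X, IsLatticeHom S ∧ (∀ e, S (δ e) = T e) ∧ ∀ f, NX (S f) ≤ c * NF f

/-- `(F, NF)` with `δ` is the free `p`-convex `p`-Banach lattice generated by `(E, NE)`. For `p = 1`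
this is the free Banach lattice generated by a Banach space. -/
structure IsFreePConvex (p : ℝ) (NE : E → ℝ) (NF : F → ℝ) (δ : E →ₗ[ℝ] F) : Prop where
  lattice : IsPBanachLattice p NF
  convex : IsPConvex p NF
  const_eq_one : convexityConst p NF = 1
  isometry : ∀ e, NF (δ e) = NE e
  universal : ∀ (X : Type) [AddCommGroup X] [Module ℝ X] [Lattice X] (NX : X → ℝ),
    IsPBanachLattice p NX → IsPConvex p NX → ∀ T : E →ₗ[ℝ] X, IsOperator NE NX T →
      ExtendsUniquely δ NF NX T (convexityConst p NX * opNorm NE NX T)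

/-- `(E, NE)` is `p`-natural: it embeds linearly and isometrically in a `p`-convex `p`-Banach
lattice with `p`-convexity constant one. -/
def IsPNatural (p : ℝ) (NE : E → ℝ) : Prop :=
  ∃ (X : Type) (_ : AddCommGroup X) (_ : Module ℝ X) (_ : Lattice X) (NX : X → ℝ)
    (J : E →ₗ[ℝ] X), IsPBanachLattice p NX ∧ IsPConvex p NX ∧ convexityConst p NX = 1 ∧
      ∀ e, NX (J e) = NE e

/-- The number `p_E`. -/
noncomputable def naturalIndex (NE : E → ℝ) : ℝ :=
  sSup {p : ℝ | 0 < p ∧ p < 1 ∧ IsPNatural p NE}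

end Lattices

section FreeBanachLattice

variable (E : Type) [NormedAddCommGroup E] [NormedSpace ℝ E]

/-- The free Banach lattice norm, with values in `[0, ∞]`, of a function on the dual of `E`: the
supremum of `∑ |f (x_i^*)|` over finite families of functionals with
`∑ |x_i^* x| ≤ 1` for all `x` in the unit ball. -/
noncomputable def fblENorm (f : StrongDual ℝ E → ℝ) : ℝ≥0∞ :=
  ⨆ (n : ℕ) (φ : Fin n → StrongDual ℝ E) (_ : ∀ x : E, ‖x‖ ≤ 1 → ∑ i, |φ i x| ≤ 1),
    ∑ i, ENNReal.ofReal |f (φ i)|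

/-- The vector sublattice of `StrongDual ℝ E → ℝ` generated by the evaluations `δ_x`. -/
inductive InLat : (StrongDual ℝ E → ℝ) → Prop
  | delta (x : E) : InLat (fun φ => φ x)
  | add {f g : StrongDual ℝ E → ℝ} : InLat f → InLat g → InLat (f + g)
  | smul (c : ℝ) {f : StrongDual ℝ E → ℝ} : InLat f → InLat (c • f)
  | sup {f g : StrongDual ℝ E → ℝ} : InLat f → InLat g → InLat (f ⊔ g)

variable {E}

theorem fblENorm_le_add {f g h : StrongDual ℝ E → ℝ} (H : ∀ φ, |f φ| ≤ |g φ| + |h φ|) :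
    fblENorm E f ≤ fblENorm E g + fblENorm E h := by
  refine iSup_le fun n => iSup_le fun φ => iSup_le fun hφ => ?_
  calc ∑ i, ENNReal.ofReal |f (φ i)|
      ≤ ∑ i, (ENNReal.ofReal |g (φ i)| + ENNReal.ofReal |h (φ i)|) := by
        refine Finset.sum_le_sum fun i _ => ?_
        rw [← ENNReal.ofReal_add (abs_nonneg _) (abs_nonneg _)]
        exact ENNReal.ofReal_le_ofReal (H _)
    _ = ∑ i, ENNReal.ofReal |g (φ i)| + ∑ i, ENNReal.ofReal |h (φ i)| := Finset.sum_add_distrib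
    _ ≤ _ := by
        refine add_le_add ?_ ?_
        · exact le_iSup_of_le n (le_iSup_of_le φ (le_iSup_of_le hφ le_rfl))
        · exact le_iSup_of_le n (le_iSup_of_le φ (le_iSup_of_le hφ le_rfl))

theorem fblENorm_smul_le (c : ℝ) (f : StrongDual ℝ E → ℝ) :
    fblENorm E (c • f) ≤ ENNReal.ofReal |c| * fblENorm E f := by
  refine iSup_le fun n => iSup_le fun φ => iSup_le fun hφ => ?_
  have : ∑ i, ENNReal.ofReal |(c • f) (φ i)|
      = ENNReal.ofReal |c| * ∑ i, ENNReal.ofReal |f (φ i)| := by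
    rw [Finset.mul_sum]
    refine Finset.sum_congr rfl fun i _ => ?_
    rw [Pi.smul_apply, smul_eq_mul, abs_mul, ENNReal.ofReal_mul (abs_nonneg _)]
  rw [this]
  gcongr
  exact le_iSup_of_le n (le_iSup_of_le φ (le_iSup_of_le hφ le_rfl))

variable (E)

/-- Membership in the free Banach lattice: positively homogeneous functions on the dual that
are limits, in the free Banach lattice norm, of elements of the vector lattice generated by the
evaluations. -/
def InFBL (f : StrongDual ℝ E → ℝ) : Prop :=
  (∀ (c : ℝ) (φ : StrongDual ℝ E), 0 ≤ c → f (c • φ) = c * f φ) ∧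
    ∀ ε : ℝ≥0∞, 0 < ε → ∃ g, InLat E g ∧ fblENorm E (f - g) < ε

variable {E}

theorem InLat.posHom {f : StrongDual ℝ E → ℝ} (hf : InLat E f) (c : ℝ) (φ : StrongDual ℝ E)
    (hc : 0 ≤ c) : f (c • φ) = c * f φ := by
  induction hf with
  | delta x => simp
  | add _ _ h1 h2 => simp [h1, h2, mul_add]
  | smul d _ h => simp [h]; ring
  | sup _ _ h1 h2 => simp [h1, h2, mul_max_of_nonneg _ _ hc]

theorem fblENorm_zero : fblENorm E 0 = 0 := by
  simp [fblENorm]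

theorem InLat.inFBL {f : StrongDual ℝ E → ℝ} (hf : InLat E f) : InFBL E f :=
  ⟨hf.posHom, fun ε hε => ⟨f, hf, by rw [sub_self, fblENorm_zero]; exact hε⟩⟩

theorem InFBL.add {f g : StrongDual ℝ E → ℝ} (hf : InFBL E f) (hg : InFBL E g) :
    InFBL E (f + g) := by
  refine ⟨fun c φ hc => by simp [hf.1 c φ hc, hg.1 c φ hc, mul_add], fun ε hε => ?_⟩
  have hε2 : 0 < ε / 2 := ENNReal.half_pos hε.ne'
  obtain ⟨f', hf', h1⟩ := hf.2 _ hε2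
  obtain ⟨g', hg', h2⟩ := hg.2 _ hε2
  refine ⟨f' + g', hf'.add hg', ?_⟩
  calc fblENorm E (f + g - (f' + g')) ≤ fblENorm E (f - f') + fblENorm E (g - g') := by
        refine fblENorm_le_add fun φ => ?_
        have : (f + g - (f' + g')) φ = (f - f') φ + (g - g') φ := by simp; ring
        rw [this]; exact abs_add_le _ _
    _ < ε / 2 + ε / 2 := ENNReal.add_lt_add h1 h2
    _ = ε := ENNReal.add_halves ε

theorem InFBL.smul (c : ℝ) {f : StrongDual ℝ E → ℝ} (hf : InFBL E f) : InFBL E (c • f) := by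
  refine ⟨fun d φ hd => by simp [hf.1 d φ hd]; ring, fun ε hε => ?_⟩
  have hpos : 0 < ε / (ENNReal.ofReal |c| + 1) :=
    ENNReal.div_pos hε.ne' (by simp)
  obtain ⟨g, hg, h⟩ := hf.2 _ hpos
  refine ⟨c • g, hg.smul c, ?_⟩
  rw [← smul_sub]
  by_cases hc : c = 0
  · subst hc
    rw [zero_smul, fblENorm_zero]; exact hε
  have hc' : ENNReal.ofReal |c| ≠ 0 := by simpa using hc
  calc fblENorm E (c • (f - g)) ≤ ENNReal.ofReal |c| * fblENorm E (f - g) := fblENorm_smul_le _ _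
    _ < ENNReal.ofReal |c| * (ε / (ENNReal.ofReal |c| + 1)) :=
        ENNReal.mul_lt_mul_right hc' ENNReal.ofReal_ne_top h
    _ ≤ (ENNReal.ofReal |c| + 1) * (ε / (ENNReal.ofReal |c| + 1)) := by
        gcongr; exact le_self_add
    _ ≤ ε := ENNReal.mul_div_le

theorem InFBL.sup {f g : StrongDual ℝ E → ℝ} (hf : InFBL E f) (hg : InFBL E g) :
    InFBL E (f ⊔ g) := by
  refine ⟨fun c φ hc => by simp [hf.1 c φ hc, hg.1 c φ hc, mul_max_of_nonneg _ _ hc],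
    fun ε hε => ?_⟩
  have hε2 : 0 < ε / 2 := ENNReal.half_pos hε.ne'
  obtain ⟨f', hf', h1⟩ := hf.2 _ hε2
  obtain ⟨g', hg', h2⟩ := hg.2 _ hε2
  refine ⟨f' ⊔ g', hf'.sup hg', ?_⟩
  calc fblENorm E (f ⊔ g - f' ⊔ g') ≤ fblENorm E (f - f') + fblENorm E (g - g') := by
        refine fblENorm_le_add fun φ => ?_
        refine (abs_max_sub_max_le_max _ _ _ _).trans ?_
        exact max_le_add_of_nonneg (abs_nonneg _) (abs_nonneg _)
    _ < ε / 2 + ε / 2 := ENNReal.add_lt_add h1 h2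
    _ = ε := ENNReal.add_halves ε

theorem InFBL.inf {f g : StrongDual ℝ E → ℝ} (hf : InFBL E f) (hg : InFBL E g) :
    InFBL E (f ⊓ g) := by
  have h := ((hf.smul (-1)).sup (hg.smul (-1))).smul (-1)
  have e : (-1 : ℝ) • (((-1 : ℝ) • f) ⊔ ((-1 : ℝ) • g)) = f ⊓ g := by
    funext φ
    simp [max_neg_neg]
  rwa [e] at h

variable (E)

/-- The free Banach lattice `FBL[E]` generated by the Banach space `E`: the closed
sublattice generated by the evaluations, inside the lattice of positively homogeneous functions
of finite free Banach lattice norm. -/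
def FBL : Submodule ℝ (StrongDual ℝ E → ℝ) where
  carrier := {f | InFBL E f}
  add_mem' := InFBL.add
  zero_mem' := by
    have h := (InLat.smul (0 : ℝ) (InLat.delta (0 : E))).inFBL
    rwa [zero_smul] at h
  smul_mem' := fun c _ hf => hf.smul c

/-- The lattice operations of `FBL[E]` are the pointwise ones. -/
noncomputable instance : Lattice (FBL E) :=
  Subtype.lattice (fun _ _ hf hg => InFBL.sup hf hg) (fun _ _ hf hg => InFBL.inf hf hg)

/-- The norm of `FBL[E]`. -/
noncomputable def fblNorm (f : FBL E) : ℝ := (fblENorm E f).toReal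

/-- The canonical embedding of `E` in `FBL[E]`. -/
def fblDelta : E →ₗ[ℝ] FBL E where
  toFun x := ⟨fun φ => φ x, (InLat.delta x).inFBL⟩
  map_add' x y := by ext φ; simp
  map_smul' c x := by ext φ; simp

/-- `E` has Rademacher type `p`. -/
def HasType (p : ℝ) : Prop :=
  ∃ C : ℝ, 0 < C ∧ ∀ (n : ℕ) (x : Fin n → E),
    ((∑ ε : Fin n → Bool, ‖∑ i, (if ε i then (1 : ℝ) else -1) • x i‖ ^ p) / 2 ^ n) ^ (1 / p)
      ≤ C * (∑ i, ‖x i‖ ^ p) ^ (1 / p)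

/-- `E` has non-trivial type: it has type `p` for some `p > 1`. -/
def HasNontrivialType : Prop := ∃ p : ℝ, 1 < p ∧ p ≤ 2 ∧ HasType E p

/-- The automatic extension property of `FBL[E]` for all `p ∈ (0, 1]` at once, with a constant that
depends only on `E`: every operator `T` from `E` to a `p`-convex `p`-Banach lattice `X` has a unique
extension to a lattice homomorphism `FBL[E] → X` of norm at most `C * M^{(p)}(X) * ‖T‖`. -/
def AutoExtension : Prop :=
  ∃ C : ℝ, 0 < C ∧ ∀ p : ℝ, 0 < p → p ≤ 1 →
    ∀ (X : Type) [AddCommGroup X] [Module ℝ X] [Lattice X] (NX : X → ℝ),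
      IsPBanachLattice p NX → IsPConvex p NX →
      ∀ T : E →ₗ[ℝ] X, IsOperator (fun e : E => ‖e‖) NX T →
        ExtendsUniquely (fblDelta E) (fblNorm E) NX T
          (C * convexityConst p NX * opNorm (fun e : E => ‖e‖) NX T)

/-- The automatic extension property of `FBL[E]` for operators into `q`-convex quasi-Banach
lattices, for one fixed `q`. -/
def AutoExtensionAt (q : ℝ) : Prop :=
  ∃ C : ℝ, 0 < C ∧
    ∀ (X : Type) [AddCommGroup X] [Module ℝ X] [Lattice X] (NX : X → ℝ),
      IsQuasiBanachLattice NX → IsPConvex q NX →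
      ∀ T : E →ₗ[ℝ] X, IsOperator (fun e : E => ‖e‖) NX T →
        ExtendsUniquely (fblDelta E) (fblNorm E) NX T
          (C * convexityConst q NX * opNorm (fun e : E => ‖e‖) NX T)

end FreeBanachLattice

section WeakL1

/-- The quasi-norm `sup_{s > 0} s * |{|f| > s}|` of `L_{1,∞}(ℝ)`, with values in `[0, ∞]`. -/
noncomputable def weakENorm (f : ℝ →ₘ[volume] ℝ) : ℝ≥0∞ :=
  ⨆ (s : ℝ) (_ : 0 < s), ENNReal.ofReal s * volume {x | s < |f x|}

theorem weakENorm_le {f g : ℝ →ₘ[volume] ℝ} {c : ℝ} (hc : 0 < c)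
    (H : ∀ᵐ x, |f x| ≤ c * |g x|) : weakENorm f ≤ ENNReal.ofReal c * weakENorm g := by
  refine iSup_le fun s => iSup_le fun hs => ?_
  have h1 : volume {x | s < |f x|} ≤ volume {x | s / c < |g x|} := by
    refine measure_mono_ae ?_
    filter_upwards [H] with x hx hxs
    have hxs' : s < |f x| := hxs
    change s / c < |g x|
    rw [div_lt_iff₀ hc]
    linarith
  calc ENNReal.ofReal s * volume {x | s < |f x|}
      ≤ ENNReal.ofReal s * volume {x | s / c < |g x|} := by gcongr
    _ = ENNReal.ofReal c * (ENNReal.ofReal (s / c) * volume {x | s / c < |g x|}) := by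
        rw [← mul_assoc, ← ENNReal.ofReal_mul hc.le, mul_div_cancel₀ _ hc.ne']
    _ ≤ _ := by
        gcongr
        exact le_iSup₂_of_le (s / c) (div_pos hs hc) le_rfl

theorem weakENorm_le_add {f g h : ℝ →ₘ[volume] ℝ} (H : ∀ᵐ x, |f x| ≤ |g x| + |h x|) :
    weakENorm f ≤ 2 * weakENorm g + 2 * weakENorm h := by
  refine iSup_le fun s => iSup_le fun hs => ?_
  have h1 : volume {x | s < |f x|} ≤
      volume {x | s / 2 < |g x|} + volume {x | s / 2 < |h x|} := by
    refine le_trans (measure_mono_ae ?_) (measure_union_le _ _)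
    filter_upwards [H] with x hx hxs
    have hxs' : s < |f x| := hxs
    by_cases hg : s / 2 < |g x|
    · exact Or.inl hg
    · refine Or.inr ?_
      change s / 2 < |h x|
      linarith
  have e : ENNReal.ofReal s = 2 * ENNReal.ofReal (s / 2) := by
    rw [← ENNReal.ofReal_ofNat 2, ← ENNReal.ofReal_mul (by norm_num)]
    congr 1
    ring
  calc ENNReal.ofReal s * volume {x | s < |f x|}
      ≤ ENNReal.ofReal s * (volume {x | s / 2 < |g x|} + volume {x | s / 2 < |h x|}) := by gcongr
    _ = 2 * (ENNReal.ofReal (s / 2) * volume {x | s / 2 < |g x|})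
        + 2 * (ENNReal.ofReal (s / 2) * volume {x | s / 2 < |h x|}) := by
        rw [e]; ring
    _ ≤ _ := by
        gcongr
        · exact le_iSup₂_of_le (s / 2) (half_pos hs) le_rfl
        · exact le_iSup₂_of_le (s / 2) (half_pos hs) le_rfl

theorem weakENorm_lt_top_of_add {f g h : ℝ →ₘ[volume] ℝ} (hg : weakENorm g < ⊤)
    (hh : weakENorm h < ⊤) (H : ∀ᵐ x, |f x| ≤ |g x| + |h x|) : weakENorm f < ⊤ :=
  lt_of_le_of_lt (weakENorm_le_add H)
    (ENNReal.add_lt_top.2 ⟨ENNReal.mul_lt_top (by simp) hg, ENNReal.mul_lt_top (by simp) hh⟩)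

/-- The space `L_{1,∞}(ℝ)` of (classes of) measurable functions with finite weak quasi-norm. -/
noncomputable def WeakL1 : Submodule ℝ (ℝ →ₘ[volume] ℝ) where
  carrier := {f | weakENorm f < ⊤}
  add_mem' := by
    intro f g hf hg
    refine weakENorm_lt_top_of_add hf hg ?_
    filter_upwards [AEEqFun.coeFn_add f g] with x hx
    rw [hx]
    exact abs_add_le _ _
  zero_mem' := by
    have h : weakENorm (0 : ℝ →ₘ[volume] ℝ) ≤ 0 := by
      refine iSup_le fun s => iSup_le fun hs => ?_
      have : volume {x | s < |(0 : ℝ →ₘ[volume] ℝ) x|} ≤ volume (∅ : Set ℝ) := by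
        refine measure_mono_ae ?_
        filter_upwards [AEEqFun.coeFn_zero (α := ℝ) (β := ℝ) (μ := volume)] with x hx hxs
        have hxs' : s < |(0 : ℝ →ₘ[volume] ℝ) x| := hxs
        rw [hx] at hxs'
        simp at hxs'
        linarith
      simp at this
      simp [this]
    exact lt_of_le_of_lt h (by simp)
  smul_mem' := by
    intro c f hf
    have hc : 0 < |c| + 1 := by positivity
    refine lt_of_le_of_lt (weakENorm_le hc ?_) (ENNReal.mul_lt_top ENNReal.ofReal_lt_top hf)
    filter_upwards [AEEqFun.coeFn_smul c f] with x hx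
    rw [hx, Pi.smul_apply, smul_eq_mul, abs_mul]
    nlinarith [abs_nonneg (f x)]

/-- The order and the lattice operations of `L_{1,∞}(ℝ)` are the almost-everywhere ones. -/
noncomputable instance : Lattice WeakL1 :=
  Subtype.lattice
    (fun f g hf hg => by
      refine weakENorm_lt_top_of_add hf hg ?_
      filter_upwards [AEEqFun.coeFn_sup f g] with x hx
      rw [hx]
      exact abs_max_le_max_abs_abs.trans (max_le_add_of_nonneg (abs_nonneg _) (abs_nonneg _)))
    (fun f g hf hg => by
      refine weakENorm_lt_top_of_add hf hg ?_
      filter_upwards [AEEqFun.coeFn_inf f g] with x hx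
      rw [hx]
      exact abs_min_le_max_abs_abs.trans (max_le_add_of_nonneg (abs_nonneg _) (abs_nonneg _)))

/-- The quasi-norm of `L_{1,∞}(ℝ)`. -/
noncomputable def weakNorm (f : WeakL1) : ℝ := (weakENorm f).toReal

/-- The Banach space `L_1(ℝ)`. -/
abbrev L1 : Type := Lp ℝ 1 (volume : Measure ℝ)

/-- `y` is the value at `x` of the Hilbert transform of `f`, that is, the principal value of
`∫ f t / (x - t) dt`. -/
def IsHilbertValue (f : ℝ → ℝ) (x y : ℝ) : Prop :=
  Tendsto (fun ε : ℝ => ∫ t in {t : ℝ | ε < |x - t|}, f t / (x - t)) (𝓝[>] 0) (𝓝 y)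

/-- The class in `L_1(ℝ)` of the characteristic function of `[a, b]`. -/
noncomputable def indicatorL1 (a b : ℝ) : L1 :=
  indicatorConstLp 1 (measurableSet_Icc (a := a) (b := b)) measure_Icc_lt_top.ne (1 : ℝ)

end WeakL1

end QBL

namespace QBL

/-! A lattice homomorphism from a Banach lattice to a quasi-Banach lattice is automatically
continuous and commutes with absolute values. If `S` is one and `S ∘ δ = T` with `δ` bounded, then
`∑ |T x_k| = S (∑ |δ x_k|)`, and the triangle inequality in the Banach lattice bounds the quasi-norm
of this sum by a constant times `∑ ‖x_k‖` (`exists_sum_abs_le`). The Hilbert transform violates this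
bound. The `n` indicators of `[k/n, (k+1)/n]` have total norm one, but at a point `x` of `(1/2, 1)`
the transforms of those lying to the left of `x` are positive and telescope to at least `log (n/2)`
(`log_le_sum_abs_hilbertTransform`). So `H` cannot factor as a lattice homomorphism after an
operator into any Banach lattice (`not_factor_hilbertTransform`). This single obstruction gives the
failure of both extension properties for `FBL[L_1]`, and it separates the free `p`-convex lattices
for `p < 1` from the one for `p = 1`.

It remains to show that `H` is an operator into a target to which those properties apply. The weak
type inequality comes from Boole's theorem: for a positive discrete measure, the set where its
Hilbert transform exceeds `s` consists of intervals starting at the poles, and Vieta's formula gives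
their total length as mass over `s`. A Vitali covering argument, using that the transform decreases
between poles, upgrades this to the maximal truncated transform (`volume_maximal_cauchySum_lt_le`).
Discretising a density transfers it to `L_1` (`volume_maximal_truncHilbert_le`), and approximation
by Lipschitz functions then gives the principal value almost everywhere.

On the target side, splitting a level in the optimal proportion makes the square root of the weak
quasi-norm subadditive. For `0 < p < 1`, Kolmogorov's inequality shows that the weak quasi-norm is
equivalent to a supremum of normalised local `L_p` norms, `locNorm p`, which is a `p`-norm with
`p`-convexity constant at most one. The order-theoretic definition of `p`-sums is handled by the
fact that `(∑ t_k ^ p) ^ (1 / p)` is the infimum of its tangent planes.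

Finally, `L_1` is itself a Banach lattice, hence `p`-natural for every `p` in `(0, 1]`, and signed
sums of disjoint indicators show that its type is trivial. -/

/-! ### Boole's theorem for positive discrete measures. -/

/-- The Hilbert transform of the discrete measure `∑ a ∈ A, c a • δ_a`. -/
noncomputable def cauchySum (A : Finset ℝ) (c : ℝ → ℝ) (x : ℝ) : ℝ := ∑ a ∈ A, c a / (x - a)

theorem measurable_cauchySum (A : Finset ℝ) (c : ℝ → ℝ) : Measurable (cauchySum A c) := by
  unfold cauchySum
  fun_prop

theorem cauchySum_anti {A : Finset ℝ} {c : ℝ → ℝ} (hc : ∀ a ∈ A, 0 < c a) {x y : ℝ} (hxy : x ≤ y)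
    (h : ∀ a ∈ A, a ∉ Set.Icc x y) : cauchySum A c y ≤ cauchySum A c x := by
  refine Finset.sum_le_sum fun a ha => ?_
  have hca := hc a ha
  rcases lt_or_ge a x with h1 | h1
  · exact div_le_div_of_nonneg_left hca.le (by linarith) (by linarith)
  · have h2 : y < a := by
      by_contra! h2
      exact h a ha ⟨h1, h2⟩
    have e1 : c a / (y - a) = -(c a / (a - y)) := by rw [← neg_sub a y, div_neg]
    have e2 : c a / (x - a) = -(c a / (a - x)) := by rw [← neg_sub a x, div_neg]
    rw [e1, e2]
    exact neg_le_neg (div_le_div_of_nonneg_left hca.le (by linarith) (by linarith))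

theorem continuousOn_cauchySum {A : Finset ℝ} {c : ℝ → ℝ} {K : Set ℝ} (h : ∀ a ∈ A, a ∉ K) :
    ContinuousOn (cauchySum A c) K := by
  unfold cauchySum
  refine continuousOn_finsetSum _ fun a ha => ?_
  refine ContinuousOn.div continuousOn_const (by fun_prop) fun x hx h0 => h a ha ?_
  rwa [← sub_eq_zero.1 h0]

/-- To the right of each pole, and before the next one, a level is attained. -/
theorem exists_cauchySum_eq {A : Finset ℝ} {c : ℝ → ℝ} (hc : ∀ a ∈ A, 0 < c a) {s : ℝ} (hs : 0 < s)
    {a : ℝ} (ha : a ∈ A) :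
    ∃ r, a < r ∧ (∀ b ∈ A, a < b → r < b) ∧ cauchySum A c r = s := by
  classical
  have hca := hc a ha
  by_cases hB : (A.filter (a < ·)).Nonempty
  · set b := (A.filter (a < ·)).min' hB with hb
    have hbm := Finset.min'_mem _ hB
    rw [← hb, Finset.mem_filter] at hbm
    obtain ⟨hbA, hab⟩ := hbm
    have hnext : ∀ d ∈ A, a < d → b ≤ d := fun d hd had =>
      Finset.min'_le _ _ (Finset.mem_filter.2 ⟨hd, had⟩)
    have hcb := hc b hbA
    set A' := (A.erase a).erase b with hA'
    have hbe : b ∈ A.erase a := Finset.mem_erase.2 ⟨hab.ne', hbA⟩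
    have hA'K : ∀ d ∈ A', d ∉ Set.Icc a b := by
      intro d hd hdK
      simp only [hA', Finset.mem_erase] at hd
      have := hnext d hd.2.2 (lt_of_le_of_ne hdK.1 (Ne.symm hd.2.1))
      exact hd.1 (le_antisymm hdK.2 this)
    -- This is `(cauchySum A c x - s) * (x - a) * (b - x)` with its two poles cleared. It extends
    -- continuously to `[a, b]`, with a positive value at `a` and a negative one at `b`.
    let G : ℝ → ℝ := fun x => c a * (b - x) - c b * (x - a)
      + (cauchySum A' c x - s) * ((x - a) * (b - x))
    have hG : ContinuousOn G (Set.Icc a b) := by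
      have := continuousOn_cauchySum (c := c) hA'K
      fun_prop
    have hiv := intermediate_value_Icc' hab.le hG
    have h0 : (0 : ℝ) ∈ Set.Icc (G b) (G a) := by
      simp only [G, sub_self, mul_zero, zero_mul, add_zero, sub_zero, zero_sub]
      exact ⟨by nlinarith, by nlinarith⟩
    obtain ⟨r, hr, hGr⟩ := hiv h0
    have hra : a ≠ r := by
      rintro rfl
      simp only [G, sub_self, mul_zero, zero_mul, add_zero, sub_zero] at hGr
      nlinarith
    have hrb : r ≠ b := by
      intro h
      rw [h] at hGr
      simp only [G, sub_self, mul_zero, add_zero, zero_sub] at hGr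
      nlinarith
    have h1 : a < r := lt_of_le_of_ne hr.1 hra
    have h2 : r < b := lt_of_le_of_ne hr.2 hrb
    refine ⟨r, h1, fun d hd had => h2.trans_le (hnext d hd had), ?_⟩
    have e : cauchySum A c r = c a / (r - a) + (c b / (r - b) + cauchySum A' c r) := by
      unfold cauchySum
      rw [← Finset.add_sum_erase A _ ha, ← Finset.add_sum_erase (A.erase a) _ hbe]
    have h3 : r - a ≠ 0 := by linarith
    have h4 : r - b ≠ 0 := by linarith
    have hp : (r - a) * (r - b) ≠ 0 := mul_ne_zero h3 h4
    have key : (cauchySum A c r - s) * ((r - a) * (r - b)) = 0 := by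
      rw [e]
      simp only [G] at hGr
      field_simp
      linarith
    have := (mul_eq_zero.1 key).resolve_right hp
    linarith
  · have hmax : ∀ d ∈ A, d ≤ a := by
      intro d hd
      by_contra! h
      exact hB ⟨d, Finset.mem_filter.2 ⟨hd, h⟩⟩
    set m := ∑ d ∈ A, c d with hm
    have hm0 : 0 < m := Finset.sum_pos hc ⟨a, ha⟩
    -- At distance `m / s` to the right of the last pole every denominator is at least `m / s`, so
    -- the sum is at most `m / (m / s) = s`.
    set M := a + m / s with hM
    have haM : a < M := by
      have : 0 < m / s := by positivity
      linarith
    have hFM : cauchySum A c M ≤ s := by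
      have h1 : cauchySum A c M ≤ ∑ d ∈ A, c d / (M - a) := by
        refine Finset.sum_le_sum fun d hd => ?_
        exact div_le_div_of_nonneg_left (hc d hd).le (by linarith) (by linarith [hmax d hd])
      rw [← Finset.sum_div, ← hm] at h1
      have e : M - a = m / s := by rw [hM]; ring
      rw [e, div_div_cancel₀ hm0.ne'] at h1
      exact h1
    set A' := A.erase a with hA'
    have hA'K : ∀ d ∈ A', d ∉ Set.Icc a M := by
      intro d hd hdK
      simp only [hA', Finset.mem_erase] at hd
      exact hd.1 (le_antisymm (hmax d hd.2) hdK.1)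
    let G : ℝ → ℝ := fun x => c a + (cauchySum A' c x - s) * (x - a)
    have hG : ContinuousOn G (Set.Icc a M) := by
      have := continuousOn_cauchySum (c := c) hA'K
      fun_prop
    have e : ∀ r, a < r → G r = (cauchySum A c r - s) * (r - a) := by
      intro r hr
      have h3 : r - a ≠ 0 := by linarith
      have : cauchySum A c r = c a / (r - a) + cauchySum A' c r := by
        unfold cauchySum
        rw [← Finset.add_sum_erase A _ ha]
      rw [this]
      simp only [G]
      field_simp
      ring
    have h0 : (0 : ℝ) ∈ Set.Icc (G M) (G a) := by
      constructor
      · rw [e M haM]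
        nlinarith
      · simp only [G, sub_self, mul_zero, add_zero]
        exact hca.le
    obtain ⟨r, hr, hGr⟩ := intermediate_value_Icc' haM.le hG h0
    have hra : a ≠ r := by
      rintro rfl
      simp only [G, sub_self, mul_zero, add_zero] at hGr
      linarith
    have h1 : a < r := lt_of_le_of_ne hr.1 hra
    refine ⟨r, h1, fun d hd had => absurd (hmax d hd) (not_le.2 had), ?_⟩
    rw [e r h1] at hGr
    have := (mul_eq_zero.1 hGr).resolve_right (by linarith)
    linarith

open Polynomial in
/-- Vieta's formula for the solutions of `∑ c a / (x - a) = s`. -/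
theorem sum_roots_cauchySum {A : Finset ℝ} {c : ℝ → ℝ} (hc : ∀ a ∈ A, 0 < c a) {s : ℝ} (hs : 0 < s) {r : ℝ → ℝ}
    (hinj : Set.InjOn r A) (hrA : ∀ a ∈ A, r a ∉ A) (hr : ∀ a ∈ A, cauchySum A c (r a) = s) :
    ∑ a ∈ A, (r a - a) = (∑ a ∈ A, c a) / s := by
  classical
  rcases A.eq_empty_or_nonempty with rfl | hA
  · simp
  have hcard : 0 < A.card := hA.card_pos
  let P : ℝ[X] := ∏ a ∈ A, (X - C a)
  let R : ℝ[X] := ∑ a ∈ A, C (c a / s) * ∏ b ∈ A.erase a, (X - C b)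
  let V : ℝ[X] := ∏ a ∈ A, (X - C (r a))
  have hPdeg : P.degree = A.card := by
    simp only [P, degree_prod, degree_X_sub_C, Finset.sum_const, nsmul_eq_mul, mul_one]
  have hVdeg : V.degree = A.card := by
    simp only [V, degree_prod, degree_X_sub_C, Finset.sum_const, nsmul_eq_mul, mul_one]
  have hRdeg : R.degree < A.card := by
    refine lt_of_le_of_lt (degree_sum_le _ _) ?_
    rw [Finset.sup_lt_iff (by exact WithBot.bot_lt_coe _)]
    intro a ha
    rw [degree_C_mul (div_pos (hc a ha) hs).ne']
    rw [degree_prod]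
    simp only [degree_X_sub_C, Finset.sum_const, nsmul_eq_mul, mul_one]
    exact_mod_cast Finset.card_erase_lt_of_mem ha
  have hPV : (P - V).degree < A.card := by
    have h := degree_sub_lt_left (p := P) (q := V) (hPdeg.trans hVdeg.symm)
      (by rw [← degree_ne_bot, hPdeg]; exact WithBot.coe_ne_bot)
      ((monic_prod_of_monic _ _ fun a _ => monic_X_sub_C a).leadingCoeff.trans
        (monic_prod_of_monic _ _ fun a _ => monic_X_sub_C (r a)).leadingCoeff.symm)
    rwa [hPdeg] at h
  -- At a solution `x` the equation says `R x = P x`. Both `P - R` and `V` are monic of degree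
  -- `|A|`, and they agree at `|A|` distinct points. Their next coefficients then compare the sum of
  -- the solutions with the sum of the poles.
  have hQ : P - R = V := by
    refine eq_of_degree_sub_lt_of_eval_finset_eq (A.image r) ?_ ?_
    · rw [Finset.card_image_of_injOn hinj]
      have : P - R - V = (P - V) - R := by ring
      rw [this]
      exact lt_of_le_of_lt (degree_sub_le _ _) (max_lt hPV hRdeg)
    · intro x hx
      obtain ⟨a, ha, rfl⟩ := Finset.mem_image.1 hx
      have hV : V.eval (r a) = 0 := by
        simp only [V, eval_prod]
        exact Finset.prod_eq_zero ha (by simp)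
      rw [hV, eval_sub, sub_eq_zero]
      have hne : ∀ b ∈ A, r a - b ≠ 0 := fun b hb h => hrA a ha (by rwa [sub_eq_zero.1 h])
      have hRe : R.eval (r a) = ∑ b ∈ A, (c b / (r a - b) / s) * ∏ d ∈ A, (r a - d) := by
        simp only [R, eval_finsetSum, eval_mul, eval_C, eval_prod, eval_sub, eval_X]
        refine Finset.sum_congr rfl fun b hb => ?_
        rw [← Finset.mul_prod_erase A _ hb]
        field_simp [hne b hb]
      have h2 := hr a ha
      unfold cauchySum at h2
      rw [hRe, ← Finset.sum_mul, ← Finset.sum_div, h2, div_self hs.ne', one_mul]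
      simp [P, eval_prod]
  have hco : P.coeff (A.card - 1) - R.coeff (A.card - 1) = V.coeff (A.card - 1) := by
    rw [← hQ, coeff_sub]
  have h1 : P.coeff (A.card - 1) = -∑ a ∈ A, a := prod_X_sub_C_coeff_card_pred A id hcard
  have h2 : V.coeff (A.card - 1) = -∑ a ∈ A, r a := prod_X_sub_C_coeff_card_pred A r hcard
  have h3 : R.coeff (A.card - 1) = ∑ a ∈ A, c a / s := by
    simp only [R, finsetSum_coeff, coeff_C_mul]
    refine Finset.sum_congr rfl fun a ha => ?_
    have hm : (∏ b ∈ A.erase a, (X - C b)).Monic := monic_prod_of_monic _ _ fun a _ => monic_X_sub_C a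
    have hd : (∏ b ∈ A.erase a, (X - C b)).natDegree = A.card - 1 := by
      rw [natDegree_prod_of_monic _ _ fun a _ => monic_X_sub_C a]
      simp [Finset.card_erase_of_mem ha]
    rw [← hd, hm.coeff_natDegree, mul_one]
  rw [h1, h2, h3] at hco
  rw [Finset.sum_sub_distrib, Finset.sum_div]
  linarith

/-- Boole's theorem, as an inequality. -/
theorem volume_lt_cauchySum_le {A : Finset ℝ} {c : ℝ → ℝ} (hc : ∀ a ∈ A, 0 < c a) {s : ℝ}
    (hs : 0 < s) : volume {x | s < cauchySum A c x} ≤ ENNReal.ofReal ((∑ a ∈ A, c a) / s) := by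
  classical
  choose! r hr1 hr2 hr3 using fun a (ha : a ∈ A) => exists_cauchySum_eq hc hs ha
  have hmono : ∀ a ∈ A, ∀ b ∈ A, a < b → r a < r b := fun a ha b hb hab =>
    (hr2 a ha b hb hab).trans (hr1 b hb)
  have hinj : Set.InjOn r A := by
    intro a ha b hb hab
    rcases lt_trichotomy a b with h | h | h
    · exact absurd hab (hmono a ha b hb h).ne
    · exact h
    · exact absurd hab (hmono b hb a ha h).ne'
  have hrA : ∀ a ∈ A, r a ∉ A := fun a ha h => lt_irrefl _ (hr2 a ha _ h (hr1 a ha))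
  -- The sum is nonpositive to the left of all the poles. Elsewhere it decreases after the last pole
  -- `a` before `x`, so exceeding `s` at `x` forces `x < r a`.
  have hsub : {x | s < cauchySum A c x} ⊆ (⋃ a ∈ A, Set.Ioo a (r a)) ∪ A := by
    intro x hx
    have hx' : s < cauchySum A c x := hx
    by_cases hxA : x ∈ A
    · exact Or.inr hxA
    left
    have hne : (A.filter (· < x)).Nonempty := by
      by_contra h
      rw [Finset.not_nonempty_iff_eq_empty, Finset.filter_eq_empty_iff] at h
      have : cauchySum A c x ≤ 0 := Finset.sum_nonpos fun a ha =>
        div_nonpos_of_nonneg_of_nonpos (hc a ha).le (by have := not_lt.1 (h ha); linarith)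
      linarith
    set a := (A.filter (· < x)).max' hne with ha_def
    have ha := Finset.max'_mem _ hne
    rw [← ha_def, Finset.mem_filter] at ha
    have hlast : ∀ b ∈ A, b < x → b ≤ a := fun b hb hbx =>
      Finset.le_max' _ _ (Finset.mem_filter.2 ⟨hb, hbx⟩)
    refine Set.mem_iUnion₂.2 ⟨a, ha.1, ha.2, ?_⟩
    by_contra! h
    have := cauchySum_anti hc h fun b hb hbI => by
      rcases lt_or_eq_of_le hbI.2 with h1 | h1
      · have := hlast b hb h1
        linarith [hbI.1, hr1 a ha.1]
      · exact hxA (h1 ▸ hb)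
    rw [hr3 a ha.1] at this
    linarith
  calc volume {x | s < cauchySum A c x} ≤ volume ((⋃ a ∈ A, Set.Ioo a (r a)) ∪ (A : Set ℝ)) :=
        measure_mono hsub
    _ ≤ volume (⋃ a ∈ A, Set.Ioo a (r a)) + volume (A : Set ℝ) := measure_union_le _ _
    _ = volume (⋃ a ∈ A, Set.Ioo a (r a)) := by
        rw [A.finite_toSet.measure_zero, add_zero]
    _ ≤ ∑ a ∈ A, volume (Set.Ioo a (r a)) := measure_biUnion_finset_le _ _
    _ = ∑ a ∈ A, ENNReal.ofReal (r a - a) := by simp only [Real.volume_Ioo]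
    _ = ENNReal.ofReal (∑ a ∈ A, (r a - a)) := by
        rw [ENNReal.ofReal_sum_of_nonneg]
        intro a ha
        linarith [hr1 a ha]
    _ = _ := by rw [sum_roots_cauchySum hc hs hinj hrA hr3]

/-! ### The maximal truncated transform of a discrete measure. -/

theorem cauchySum_map_neg (A : Finset ℝ) (c : ℝ → ℝ) (x : ℝ) :
    cauchySum (A.map (Equiv.neg ℝ).toEmbedding) (fun a => c (-a)) (-x) = -cauchySum A c x := by
  unfold cauchySum
  rw [Finset.sum_map, ← Finset.sum_neg_distrib]
  refine Finset.sum_congr rfl fun a _ => ?_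
  simp only [Equiv.coe_toEmbedding, Equiv.neg_apply, neg_neg]
  rw [← div_neg]
  congr 1
  ring

theorem volume_neg_preimage (B : Set ℝ) : volume {x : ℝ | -x ∈ B} = volume B := by
  have := Measure.measure_preimage_neg (volume : Measure ℝ) B
  exact this

theorem volume_cauchySum_lt_neg_le {A : Finset ℝ} {c : ℝ → ℝ} (hc : ∀ a ∈ A, 0 < c a) {s : ℝ}
    (hs : 0 < s) : volume {x | cauchySum A c x < -s} ≤ ENNReal.ofReal ((∑ a ∈ A, c a) / s) := by
  have h := volume_lt_cauchySum_le (A := A.map (Equiv.neg ℝ).toEmbedding) (c := fun a => c (-a))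
    (s := s) (by simpa using fun a ha => hc (-a) ha) hs
  rw [Finset.sum_map, ← volume_neg_preimage] at h
  simp only [Set.mem_ofPred_eq, cauchySum_map_neg, Equiv.coe_toEmbedding, Equiv.neg_apply,
    neg_neg] at h
  refine le_trans (measure_mono fun x hx => ?_) h
  have : cauchySum A c x < -s := hx
  change s < -cauchySum A c x
  linarith

/-- If truncation at radius `ε` exceeds `s` at `x`, then it still does so on `[x - ε, x]`, since the
poles kept are more than `ε` away. There either the full sum exceeds `s / 2` or the omitted near
part is below `-s / 2`, and Boole's theorem bounds the second set by the mass near `x`. Hence `ε` is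
at most the `ν`-measure of the ball, with `ν` of total mass at most `4 m / s`. A Vitali subfamily
with fivefold enlargement costs a factor `10`, because a ball of radius `5 ε` has length `10 ε`. -/
theorem volume_maximal_cauchySum_lt_le {A : Finset ℝ} {c : ℝ → ℝ} (hc : ∀ a ∈ A, 0 < c a) {s : ℝ}
    (hs : 0 < s) :
    volume {x | ∃ ε > 0, s < cauchySum (A.filter (fun a => ε < |x - a|)) c x} ≤
      40 * ENNReal.ofReal ((∑ a ∈ A, c a) / s) := by
  classical
  set E := {x | ∃ ε > 0, s < cauchySum (A.filter (fun a => ε < |x - a|)) c x} with hE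
  set m := ∑ a ∈ A, c a with hm
  have hm0 : 0 ≤ m := Finset.sum_nonneg fun a ha => (hc a ha).le
  have hEx : ∀ x ∈ E, ∃ ε > 0, s < cauchySum (A.filter (fun a => ε < |x - a|)) c x := fun x hx => hx
  choose! ε hε0 hε using hEx
  -- The covering lemma needs bounded radii; the truncated kernel is at most `1 / ε`, so `s < m /
  -- ε`.
  have hbd : ∀ x ∈ E, ε x ≤ m / s := by
    intro x hx
    have h0 := hε0 x hx
    have h1 : cauchySum (A.filter (fun a => ε x < |x - a|)) c x ≤ m / ε x := by
      rw [hm, Finset.sum_div]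
      refine le_trans (Finset.sum_le_sum (g := fun a => c a / ε x) fun a ha => ?_)
        (Finset.sum_le_sum_of_subset_of_nonneg (Finset.filter_subset _ _) fun a ha _ =>
          div_nonneg (hc a ha).le h0.le)
      rw [Finset.mem_filter] at ha
      have hca := hc a ha.1
      calc c a / (x - a) ≤ |c a / (x - a)| := le_abs_self _
        _ = c a / |x - a| := by rw [abs_div, abs_of_pos hca]
        _ ≤ c a / ε x := div_le_div_of_nonneg_left hca.le h0 ha.2.le
    have h2 := (hε x hx).trans_le h1
    rw [lt_div_iff₀ h0] at h2
    rw [le_div_iff₀ hs]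
    linarith
  obtain ⟨u, huE, hdisj, hcov⟩ := Vitali.exists_disjoint_subfamily_covering_enlargement_closedBall
    E id ε (m / s) hbd 5 (by norm_num)
  simp only [id] at hdisj hcov
  have hucount : u.Countable := hdisj.countable_of_nonempty_interior fun x hx => by
    refine ⟨x, ?_⟩
    exact Metric.ball_subset_interior_closedBall (Metric.mem_ball_self (hε0 x (huE hx)))
  set U := {x | s / 2 < cauchySum A c x} with hU
  have hUm : MeasurableSet U := measurableSet_lt measurable_const (measurable_cauchySum A c)
  set ν : Measure ℝ := volume.restrict U
    + ∑ a ∈ A, ENNReal.ofReal (c a / (s / 2)) • Measure.dirac a with hν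
  have hball : ∀ x ∈ u, ENNReal.ofReal (ε x) ≤ ν (Metric.closedBall x (ε x)) := by
    intro x hxu
    have hx := huE hxu
    have h0 := hε0 x hx
    set A1 := A.filter (fun a => ε x < |x - a|) with hA1
    set A2 := A.filter (fun a => ¬ ε x < |x - a|) with hA2
    have hsplit : ∀ y, cauchySum A c y = cauchySum A1 c y + cauchySum A2 c y := fun y =>
      (Finset.sum_filter_add_sum_filter_not A _ _).symm
    have hsub : Set.Icc (x - ε x) x ⊆
        (U ∩ Metric.closedBall x (ε x)) ∪ {y | cauchySum A2 c y < -(s / 2)} := by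
      intro y hy
      have h1 : cauchySum A1 c x ≤ cauchySum A1 c y := by
        refine cauchySum_anti (fun a ha => hc a (Finset.mem_filter.1 ha).1) hy.2 fun a ha haI => ?_
        have h2 := (Finset.mem_filter.1 ha).2
        rw [abs_of_nonneg (by linarith [haI.2])] at h2
        linarith [haI.1, hy.1]
      have h3 := hε x hx
      by_cases h4 : cauchySum A2 c y < -(s / 2)
      · exact Or.inr h4
      · left
        refine ⟨?_, ?_⟩
        · change s / 2 < cauchySum A c y
          rw [hsplit]
          linarith
        · rw [Metric.mem_closedBall, Real.dist_eq, abs_le]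
          constructor <;> linarith [hy.1, hy.2]
    have hν1 : ν (Metric.closedBall x (ε x)) = volume (U ∩ Metric.closedBall x (ε x))
        + ENNReal.ofReal ((∑ a ∈ A2, c a) / (s / 2)) := by
      rw [hν, Measure.add_apply, Measure.restrict_apply Metric.isClosed_closedBall.measurableSet,
        Set.inter_comm, Measure.finsetSum_apply]
      congr 1
      rw [Finset.sum_div, ENNReal.ofReal_sum_of_nonneg, Finset.sum_filter]
      · refine Finset.sum_congr rfl fun a _ => ?_
        rw [Measure.smul_apply, Measure.dirac_apply' _ Metric.isClosed_closedBall.measurableSet,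
          smul_eq_mul]
        by_cases h : ε x < |x - a|
        · have : a ∉ Metric.closedBall x (ε x) := by
            rw [Metric.mem_closedBall, dist_comm, Real.dist_eq]
            exact not_le.2 h
          simp [this, h]
        · have : a ∈ Metric.closedBall x (ε x) := by
            rw [Metric.mem_closedBall, dist_comm, Real.dist_eq]
            exact not_lt.1 h
          simp [this, h]
      · intro a ha
        exact div_nonneg (hc a (Finset.mem_filter.1 ha).1).le (by linarith)
    calc ENNReal.ofReal (ε x) = volume (Set.Icc (x - ε x) x) := by
          rw [Real.volume_Icc]
          congr 1
          ring
      _ ≤ _ := measure_mono hsub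
      _ ≤ _ := measure_union_le _ _
      _ ≤ _ := by
          rw [hν1]
          gcongr
          exact volume_cauchySum_lt_neg_le (fun a ha => hc a (Finset.mem_filter.1 ha).1)
            (half_pos hs)
  have hνuniv : ν Set.univ ≤ 4 * ENNReal.ofReal (m / s) := by
    have e2 : m / (s / 2) = 2 * (m / s) := by field_simp
    have h1 : volume U ≤ ENNReal.ofReal (m / (s / 2)) := volume_lt_cauchySum_le hc (half_pos hs)
    have h2 : (∑ a ∈ A, ENNReal.ofReal (c a / (s / 2)) • Measure.dirac a) Set.univ
        = ENNReal.ofReal (m / (s / 2)) := by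
      rw [Measure.finsetSum_apply, hm, Finset.sum_div, ENNReal.ofReal_sum_of_nonneg]
      · refine Finset.sum_congr rfl fun a _ => ?_
        simp
      · intro a ha
        exact div_nonneg (hc a ha).le (by linarith)
    rw [hν, Measure.add_apply, h2, Measure.restrict_apply_univ]
    calc volume U + ENNReal.ofReal (m / (s / 2))
        ≤ ENNReal.ofReal (m / (s / 2)) + ENNReal.ofReal (m / (s / 2)) := by gcongr
      _ = 4 * ENNReal.ofReal (m / s) := by
          rw [e2, ENNReal.ofReal_mul (by norm_num), ENNReal.ofReal_ofNat]
          ring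
  have hcover : E ⊆ ⋃ x ∈ u, Metric.closedBall x (5 * ε x) := by
    intro x hx
    obtain ⟨b, hb, hsub⟩ := hcov x hx
    exact Set.mem_iUnion₂.2 ⟨b, hb, hsub (Metric.mem_closedBall_self (hε0 x hx).le)⟩
  calc volume E ≤ volume (⋃ x ∈ u, Metric.closedBall x (5 * ε x)) := measure_mono hcover
    _ ≤ ∑' x : u, volume (Metric.closedBall (x : ℝ) (5 * ε x)) := measure_biUnion_le _ hucount _
    _ = ∑' x : u, 10 * ENNReal.ofReal (ε x) := by
        congr 1
        funext x
        rw [Real.volume_closedBall, ← ENNReal.ofReal_ofNat 10, ← ENNReal.ofReal_mul (by norm_num)]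
        congr 1
        ring
    _ = 10 * ∑' x : u, ENNReal.ofReal (ε x) := ENNReal.tsum_mul_left
    _ ≤ 10 * ∑' x : u, ν (Metric.closedBall (x : ℝ) (ε x)) := by
        gcongr with x
        exact hball x x.2
    _ = 10 * ν (⋃ x ∈ u, Metric.closedBall x (ε x)) := by
        rw [measure_biUnion hucount hdisj fun x _ => Metric.isClosed_closedBall.measurableSet]
    _ ≤ 10 * ν Set.univ := by gcongr; exact Set.subset_univ _
    _ ≤ 10 * (4 * ENNReal.ofReal (m / s)) := by gcongr
    _ = 40 * ENNReal.ofReal (m / s) := by rw [← mul_assoc]; norm_num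

/-- Reflecting the measure about the origin changes the sign of the transform, so the lower tail
costs the same as the upper one. -/
theorem volume_maximal_abs_cauchySum_le {A : Finset ℝ} {c : ℝ → ℝ} (hc : ∀ a ∈ A, 0 < c a) {s : ℝ}
    (hs : 0 < s) :
    volume {x | ∃ ε > 0, s < |cauchySum (A.filter (fun a => ε < |x - a|)) c x|} ≤
      80 * ENNReal.ofReal ((∑ a ∈ A, c a) / s) := by
  classical
  have h1 := volume_maximal_cauchySum_lt_le hc hs
  have h2 := volume_maximal_cauchySum_lt_le (A := A.map (Equiv.neg ℝ).toEmbedding)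
    (c := fun a => c (-a)) (s := s) (by simpa using fun a ha => hc (-a) ha) hs
  rw [Finset.sum_map, ← volume_neg_preimage] at h2
  simp only [Equiv.coe_toEmbedding, Equiv.neg_apply, neg_neg] at h2
  have e : {x | ∃ ε > 0, s < |cauchySum (A.filter (fun a => ε < |x - a|)) c x|} ⊆
      {x | ∃ ε > 0, s < cauchySum (A.filter (fun a => ε < |x - a|)) c x} ∪
      {x | -x ∈ {x | ∃ ε > 0, s < cauchySum ((A.map (Equiv.neg ℝ).toEmbedding).filter
        (fun a => ε < |x - a|)) (fun a => c (-a)) x}} := by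
    rintro x ⟨ε, hε, hx⟩
    rcases lt_abs.1 hx with h | h
    · exact Or.inl ⟨ε, hε, h⟩
    · refine Or.inr ⟨ε, hε, ?_⟩
      have hf : (A.map (Equiv.neg ℝ).toEmbedding).filter (fun a => ε < |-x - a|)
          = (A.filter (fun a => ε < |x - a|)).map (Equiv.neg ℝ).toEmbedding := by
        rw [Finset.filter_map]
        congr 1
        refine Finset.filter_congr fun a _ => ?_
        simp only [Function.comp, Equiv.coe_toEmbedding, Equiv.neg_apply]
        rw [← abs_neg, neg_sub, sub_neg_eq_add, add_comm, ← sub_eq_add_neg]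
      rw [hf, cauchySum_map_neg]
      exact h
  refine (measure_mono e).trans ((measure_union_le _ _).trans ((add_le_add h1 h2).trans ?_))
  rw [← add_mul]
  norm_num

/-! ### Truncated Hilbert transforms of integrable functions. -/

/-- The truncated kernel `1 / u` for `ε < |u|`. -/
noncomputable def truncKernel (ε u : ℝ) : ℝ := if ε < |u| then u⁻¹ else 0

/-- The truncated Hilbert transform. -/
noncomputable def truncHilbert (f : ℝ → ℝ) (ε x : ℝ) : ℝ := ∫ t, f t * truncKernel ε (x - t)

theorem measurable_truncKernel (ε : ℝ) : Measurable (truncKernel ε) :=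
  Measurable.ite (measurableSet_lt measurable_const measurable_id.abs) measurable_inv
    measurable_const

theorem truncKernel_neg (ε u : ℝ) : truncKernel ε (-u) = -truncKernel ε u := by
  unfold truncKernel
  rw [abs_neg, inv_neg]
  split_ifs <;> simp

theorem abs_truncKernel_le {ε : ℝ} (hε : 0 < ε) (u : ℝ) : |truncKernel ε u| ≤ ε⁻¹ := by
  unfold truncKernel
  split_ifs with h
  · rw [abs_inv]
    exact inv_anti₀ hε h.le
  · simpa using hε.le

theorem continuousAt_truncKernel {ε u : ℝ} (hε : 0 < ε) (hu : |u| ≠ ε) :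
    ContinuousAt (truncKernel ε) u := by
  rcases lt_or_gt_of_ne hu with h | h
  · have : truncKernel ε =ᶠ[𝓝 u] fun _ => 0 := by
      filter_upwards [(isOpen_lt continuous_abs continuous_const).mem_nhds h] with v hv
      exact if_neg (not_lt.2 (le_of_lt hv))
    exact continuousAt_const.congr this.symm
  · have : truncKernel ε =ᶠ[𝓝 u] fun v => v⁻¹ := by
      filter_upwards [(isOpen_lt continuous_const continuous_abs).mem_nhds h] with v hv
      exact if_pos hv
    refine ContinuousAt.congr ?_ this.symm
    refine continuousAt_inv₀ fun h0 => ?_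
    rw [h0, abs_zero] at h
    linarith

theorem setIntegral_eq_truncHilbert (f : ℝ → ℝ) (ε x : ℝ) :
    ∫ t in {t : ℝ | ε < |x - t|}, f t / (x - t) = truncHilbert f ε x := by
  rw [← integral_indicator (measurableSet_lt measurable_const (by fun_prop)), truncHilbert]
  congr 1
  funext t
  by_cases h : ε < |x - t|
  · rw [Set.indicator_of_mem (by exact h), truncKernel, if_pos h, div_eq_mul_inv]
  · rw [Set.indicator_of_notMem (by exact h), truncKernel, if_neg h, mul_zero]

theorem isHilbertValue_iff {f : ℝ → ℝ} {x y : ℝ} :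
    IsHilbertValue f x y ↔ Tendsto (fun ε => truncHilbert f ε x) (𝓝[>] 0) (𝓝 y) := by
  unfold IsHilbertValue
  simp only [setIntegral_eq_truncHilbert]

theorem integrable_mul_truncKernel {f : ℝ → ℝ} (hf : Integrable f) {ε : ℝ} (hε : 0 < ε) (x : ℝ) :
    Integrable fun t => f t * truncKernel ε (x - t) := by
  refine hf.mul_bdd (c := ε⁻¹) ?_ (ae_of_all _ fun t => ?_)
  · exact ((measurable_truncKernel ε).comp (by fun_prop)).aestronglyMeasurable
  · exact abs_truncKernel_le hε _

theorem truncHilbert_add {f g : ℝ → ℝ} (hf : Integrable f) (hg : Integrable g) {ε : ℝ}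
    (hε : 0 < ε) (x : ℝ) :
    truncHilbert (fun t => f t + g t) ε x = truncHilbert f ε x + truncHilbert g ε x := by
  unfold truncHilbert
  rw [← integral_add (integrable_mul_truncKernel hf hε x) (integrable_mul_truncKernel hg hε x)]
  simp only [add_mul]

theorem truncHilbert_sub {f g : ℝ → ℝ} (hf : Integrable f) (hg : Integrable g) {ε : ℝ}
    (hε : 0 < ε) (x : ℝ) :
    truncHilbert (fun t => f t - g t) ε x = truncHilbert f ε x - truncHilbert g ε x := by
  unfold truncHilbert
  rw [← integral_sub (integrable_mul_truncKernel hf hε x) (integrable_mul_truncKernel hg hε x)]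
  simp only [sub_mul]

theorem truncHilbert_const_mul (c : ℝ) (f : ℝ → ℝ) (ε x : ℝ) :
    truncHilbert (fun t => c * f t) ε x = c * truncHilbert f ε x := by
  unfold truncHilbert
  rw [← integral_const_mul]
  simp only [mul_assoc]

theorem truncHilbert_congr {f g : ℝ → ℝ} (h : f =ᵐ[volume] g) (ε x : ℝ) :
    truncHilbert f ε x = truncHilbert g ε x := by
  refine integral_congr_ae ?_
  filter_upwards [h] with t ht
  rw [ht]

theorem stronglyMeasurable_truncHilbert {f : ℝ → ℝ} (hf : StronglyMeasurable f) (ε : ℝ) :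
    StronglyMeasurable (truncHilbert f ε) := by
  have h : StronglyMeasurable fun z : ℝ × ℝ => f z.2 * truncKernel ε (z.1 - z.2) :=
    (hf.comp_measurable measurable_snd).mul
      ((measurable_truncKernel ε).comp (measurable_fst.sub measurable_snd)).stronglyMeasurable
  exact h.integral_prod_right'

/-- The integral of a simple function against a density is the corresponding finite sum. -/
theorem integral_mul_comp_simpleFunc {f : ℝ → ℝ} (hf : Integrable f) (σ : SimpleFunc ℝ ℝ)
    (k : ℝ → ℝ) :
    ∫ t, f t * k (σ t) = ∑ a ∈ σ.range, (∫ t in σ ⁻¹' {a}, f t) * k a := by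
  have e : ∀ t, f t * k (σ t) = ∑ a ∈ σ.range, (σ ⁻¹' {a}).indicator f t * k a := by
    intro t
    rw [Finset.sum_eq_single_of_mem (σ t) (σ.mem_range_self t)]
    · rw [Set.indicator_of_mem (by simp)]
    · intro b _ hb
      rw [Set.indicator_of_notMem (by simpa using hb.symm), zero_mul]
  simp only [e]
  rw [integral_finsetSum _ fun a _ => (hf.indicator (σ.measurableSet_preimage _)).mul_const _]
  refine Finset.sum_congr rfl fun a _ => ?_
  rw [integral_mul_const, integral_indicator (σ.measurableSet_preimage _)]

theorem volume_le_of_eventually_mem {E : Set ℝ} {F : ℕ → Set ℝ} {C : ℝ≥0∞}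
    (h : ∀ x ∈ E, ∀ᶠ n in atTop, x ∈ F n) (hF : ∀ n, volume (F n) ≤ C) : volume E ≤ C := by
  have hsub : E ⊆ ⋃ N, ⋂ n ≥ N, F n := by
    intro x hx
    obtain ⟨N, hN⟩ := eventually_atTop.1 (h x hx)
    exact Set.mem_iUnion.2 ⟨N, Set.mem_iInter₂.2 hN⟩
  have hmono : Monotone fun N => ⋂ n ≥ N, F n := fun a b hab =>
    Set.biInter_subset_biInter_left fun n hn => le_trans hab hn
  refine (measure_mono hsub).trans ?_
  rw [hmono.measure_iUnion]
  exact iSup_le fun N => (measure_mono (Set.biInter_subset_of_mem (le_refl N))).trans (hF N)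

/-- Pushing `f dt` forward under simple functions `σ n → id` gives discrete measures of the same
mass. Their truncated transforms converge to that of `f` for each fixed `ε` and `x`, so every bad
point for `f` is eventually a bad point for the discretisations, uniformly controlled in measure. -/
theorem volume_maximal_truncHilbert_le_of_nonneg {f : ℝ → ℝ} (hf : Integrable f)
    (hf0 : ∀ t, 0 ≤ f t) {s : ℝ} (hs : 0 < s) :
    volume {x | ∃ ε > 0, s < |truncHilbert f ε x|} ≤ 80 * ENNReal.ofReal ((∫ t, f t) / s) := by
  classical
  let σ : ℕ → SimpleFunc ℝ ℝ := SimpleFunc.approxOn id measurable_id Set.univ 0 (Set.mem_univ _)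
  have hσ : ∀ t, Tendsto (fun n => σ n t) atTop (𝓝 t) := fun t =>
    SimpleFunc.tendsto_approxOn measurable_id (Set.mem_univ _) (by simp)
  let c : ℕ → ℝ → ℝ := fun n a => ∫ t in (σ n) ⁻¹' {a}, f t
  have hc0 : ∀ n a, 0 ≤ c n a := fun n a => integral_nonneg fun t => hf0 t
  let A : ℕ → Finset ℝ := fun n => (σ n).range.filter fun a => 0 < c n a
  have hrepr : ∀ (n : ℕ) (k : ℝ → ℝ), ∑ a ∈ A n, c n a * k a = ∫ t, f t * k (σ n t) := by
    intro n k
    rw [integral_mul_comp_simpleFunc hf, Finset.sum_filter_of_ne]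
    intro a _ h
    exact lt_of_le_of_ne (hc0 n a) fun h0 => h (by rw [← h0, zero_mul])
  have hmass : ∀ n, ∑ a ∈ A n, c n a = ∫ t, f t := by
    intro n
    simpa using hrepr n fun _ => 1
  refine volume_le_of_eventually_mem
    (F := fun n => {x | ∃ ε > 0, s < |cauchySum ((A n).filter (fun a => ε < |x - a|)) (c n) x|})
    ?_ ?_
  · rintro x ⟨ε, hε, hx⟩
    have e : ∀ n, cauchySum ((A n).filter (fun a => ε < |x - a|)) (c n) x
        = ∫ t, f t * truncKernel ε (x - σ n t) := by
      intro n
      rw [← hrepr n fun a => truncKernel ε (x - a)]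
      unfold cauchySum
      rw [Finset.sum_filter]
      refine Finset.sum_congr rfl fun a _ => ?_
      unfold truncKernel
      split_ifs
      · rw [div_eq_mul_inv]
      · rw [mul_zero]
    have hlim : Tendsto (fun n => cauchySum ((A n).filter (fun a => ε < |x - a|)) (c n) x) atTop
        (𝓝 (truncHilbert f ε x)) := by
      simp only [e]
      refine tendsto_integral_of_dominated_convergence (fun t => |f t| * ε⁻¹) (fun n => ?_)
        (hf.abs.mul_const _) (fun n => ae_of_all _ fun t => ?_) ?_
      · exact hf.aestronglyMeasurable.mul ((measurable_truncKernel ε).comp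
          (measurable_const.sub (σ n).measurable)).aestronglyMeasurable
      · rw [Real.norm_eq_abs, abs_mul]
        gcongr
        exact abs_truncKernel_le hε _
      -- The truncated kernel may be discontinuous only where `|x - t| = ε`, which is two points.
      · have hnull : ∀ᵐ t : ℝ, t ∉ ({x - ε, x + ε} : Set ℝ) :=
          (Set.Finite.measure_zero (by simp) _ : volume ({x - ε, x + ε} : Set ℝ) = 0) |>
            measure_eq_zero_iff_ae_notMem.1
        filter_upwards [hnull] with t ht
        have hne : |x - t| ≠ ε := by
          intro h
          simp only [Set.mem_insert_iff, Set.mem_singleton_iff, not_or] at ht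
          rcases abs_cases (x - t) with ⟨h1, _⟩ | ⟨h1, _⟩
          · exact ht.1 (by linarith)
          · exact ht.2 (by linarith)
        exact ((continuousAt_truncKernel hε hne).tendsto.comp
          (tendsto_const_nhds.sub (hσ t))).const_mul _
    filter_upwards [hlim.abs.eventually_const_lt hx] with n hn
    exact ⟨ε, hε, hn⟩
  · intro n
    have := volume_maximal_abs_cauchySum_le (A := A n) (c := c n)
      (fun a ha => (Finset.mem_filter.1 ha).2) hs
    rwa [hmass] at this

/-- The weak type `(1, 1)` inequality for the maximal Hilbert transform. -/
theorem volume_maximal_truncHilbert_le {f : ℝ → ℝ} (hf : Integrable f) {s : ℝ} (hs : 0 < s) :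
    volume {x | ∃ ε > 0, s < |truncHilbert f ε x|} ≤ 160 * ENNReal.ofReal ((∫ t, |f t|) / s) := by
  have hp := hf.pos_part
  have hn := hf.neg_part
  have h1 := volume_maximal_truncHilbert_le_of_nonneg hp (fun t => le_max_right _ _) (half_pos hs)
  have h2 := volume_maximal_truncHilbert_le_of_nonneg hn (fun t => le_max_right _ _) (half_pos hs)
  have e : {x | ∃ ε > 0, s < |truncHilbert f ε x|} ⊆
      {x | ∃ ε > 0, s / 2 < |truncHilbert (fun t => max (f t) 0) ε x|} ∪
      {x | ∃ ε > 0, s / 2 < |truncHilbert (fun t => max (-f t) 0) ε x|} := by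
    rintro x ⟨ε, hε, hx⟩
    have e : truncHilbert f ε x
        = truncHilbert (fun t => max (f t) 0) ε x - truncHilbert (fun t => max (-f t) 0) ε x := by
      rw [← truncHilbert_sub hp hn hε]
      congr 1
      funext t
      rcases le_total 0 (f t) with h | h
      · rw [max_eq_left h, max_eq_right (by linarith), sub_zero]
      · rw [max_eq_right h, max_eq_left (by linarith)]
        ring
    rw [e] at hx
    by_cases h : s / 2 < |truncHilbert (fun t => max (f t) 0) ε x|
    · exact Or.inl ⟨ε, hε, h⟩
    · refine Or.inr ⟨ε, hε, ?_⟩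
      have := abs_sub (truncHilbert (fun t => max (f t) 0) ε x)
        (truncHilbert (fun t => max (-f t) 0) ε x)
      linarith
  have i1 : ∀ g : ℝ → ℝ, 0 ≤ ∫ t, max (g t) 0 := fun g => integral_nonneg fun t => le_max_right _ _
  refine (measure_mono e).trans ((measure_union_le _ _).trans ((add_le_add h1 h2).trans ?_))
  rw [← mul_add, ← ENNReal.ofReal_add (div_nonneg (i1 f) (by linarith))
    (div_nonneg (i1 fun t => -f t) (by linarith)),
    ← add_div, ← integral_add hp hn]
  have e2 : ∫ t, (max (f t) 0 + max (-f t) 0) = ∫ t, |f t| := by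
    congr 1
    funext t
    rcases le_total 0 (f t) with h | h
    · rw [max_eq_left h, max_eq_right (by linarith), add_zero, abs_of_nonneg h]
    · rw [max_eq_right h, max_eq_left (by linarith), zero_add, abs_of_nonpos h]
  have e3 : (∫ t, |f t|) / (s / 2) = 2 * ((∫ t, |f t|) / s) := by field_simp
  rw [e2, e3, ENNReal.ofReal_mul (by norm_num), ENNReal.ofReal_ofNat, ← mul_assoc]
  norm_num

/-! ### Almost everywhere existence of the principal value. -/

/-- The difference of the two kernels is odd about `x` and so has integral zero, which allows `g t`
to be replaced by `g t - g x`. The Lipschitz bound cancels the singularity: the integrand is at most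
`L` on an interval of length `2 ε'`. -/
theorem abs_truncHilbert_sub_le {g : ℝ → ℝ} (hg : Integrable g) {L : NNReal}
    (hL : LipschitzWith L g) {ε ε' : ℝ} (hε : 0 < ε) (hεε' : ε ≤ ε') (x : ℝ) :
    |truncHilbert g ε x - truncHilbert g ε' x| ≤ L * (2 * ε') := by
  have hε' : 0 < ε' := hε.trans_le hεε'
  set κ : ℝ → ℝ := fun t => truncKernel ε (x - t) - truncKernel ε' (x - t) with hκ
  have hκ0 : ∀ t, t ∉ Metric.closedBall x ε' → κ t = 0 := by
    intro t ht
    rw [Metric.mem_closedBall, dist_comm, Real.dist_eq, not_le] at ht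
    simp only [hκ, truncKernel, if_pos ht, if_pos (hεε'.trans_lt ht), sub_self]
  have hκm : Measurable κ := ((measurable_truncKernel ε).comp (by fun_prop)).sub
    ((measurable_truncKernel ε').comp (by fun_prop))
  have hfin : volume (Metric.closedBall x ε') ≠ ⊤ := by
    rw [Real.volume_closedBall]
    exact ENNReal.ofReal_ne_top
  have hκi : Integrable κ := by
    refine Integrable.mono' (g := (Metric.closedBall x ε').indicator fun _ => ε⁻¹ + ε'⁻¹)
      ((integrable_indicator_iff Metric.isClosed_closedBall.measurableSet).2
        (integrableOn_const hfin)) hκm.aestronglyMeasurable (ae_of_all _ fun t => ?_)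
    by_cases ht : t ∈ Metric.closedBall x ε'
    · rw [Set.indicator_of_mem ht]
      exact (abs_sub _ _).trans (add_le_add (abs_truncKernel_le hε _) (abs_truncKernel_le hε' _))
    · rw [Set.indicator_of_notMem ht, hκ0 t ht, norm_zero]
  have hodd : ∫ t, κ t = 0 := by
    have h1 : ∫ t, κ t = ∫ u, (truncKernel ε u - truncKernel ε' u) :=
      integral_sub_left_eq_self (fun u => truncKernel ε u - truncKernel ε' u) volume x
    have h2 := integral_neg_eq_self (fun u => truncKernel ε u - truncKernel ε' u) volume
    simp only [truncKernel_neg] at h2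
    have h3 : ∫ u, (-truncKernel ε u - -truncKernel ε' u)
        = -∫ u, (truncKernel ε u - truncKernel ε' u) := by
      rw [← integral_neg]
      congr 1
      funext u
      ring
    rw [h1]
    linarith
  have hkey : truncHilbert g ε x - truncHilbert g ε' x = ∫ t, (g t - g x) * κ t := by
    have h1 : truncHilbert g ε x - truncHilbert g ε' x = ∫ t, g t * κ t := by
      unfold truncHilbert
      rw [← integral_sub (integrable_mul_truncKernel hg hε x)
        (integrable_mul_truncKernel hg hε' x)]
      simp only [hκ, mul_sub]
    have h2 : Integrable fun t => g t * κ t := by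
      have := (integrable_mul_truncKernel hg hε x).sub (integrable_mul_truncKernel hg hε' x)
      refine this.congr (ae_of_all _ fun t => ?_)
      simp only [hκ, Pi.sub_apply, mul_sub]
    simp only [sub_mul]
    rw [integral_sub h2 (hκi.const_mul _), integral_const_mul, hodd, mul_zero, sub_zero, h1]
  rw [hkey]
  have hsupp : ∫ t, (g t - g x) * κ t = ∫ t in Metric.closedBall x ε', (g t - g x) * κ t := by
    refine (setIntegral_eq_integral_of_forall_compl_eq_zero fun t ht => ?_).symm
    rw [hκ0 t ht, mul_zero]
  rw [hsupp, ← Real.norm_eq_abs]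
  have hb := norm_setIntegral_le_of_norm_le_const (μ := volume) (s := Metric.closedBall x ε')
    (f := fun t => (g t - g x) * κ t) (C := L) hfin.lt_top fun t ht => by
      have hl : |g t - g x| ≤ L * |x - t| := by
        have := hL.dist_le_mul t x
        rwa [Real.dist_eq, Real.dist_eq, abs_sub_comm t x] at this
      have hk : |x - t| * |κ t| ≤ 1 := by
        rw [← abs_mul]
        rw [Metric.mem_closedBall, dist_comm, Real.dist_eq] at ht
        simp only [hκ, truncKernel, if_neg (not_lt.2 ht), sub_zero]
        split_ifs with h
        · have : x - t ≠ 0 := by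
            intro h0
            rw [h0, abs_zero] at h
            linarith
          rw [mul_inv_cancel₀ this, abs_one]
        · simp
      rw [Real.norm_eq_abs, abs_mul]
      calc |g t - g x| * |κ t| ≤ L * |x - t| * |κ t| := by gcongr
        _ = L * (|x - t| * |κ t|) := mul_assoc _ _ _
        _ ≤ L * 1 := by gcongr
        _ = L := mul_one _
  refine hb.trans (le_of_eq ?_)
  rw [measureReal_def, Real.volume_closedBall, ENNReal.toReal_ofReal (by linarith)]

/-- The Cauchy criterion for the convergence of the truncations. -/
theorem exists_tendsto_of_forall_dist_lt {u : ℝ → ℝ}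
    (h : ∀ δ > 0, ∃ η > 0, ∀ ε ε', 0 < ε → ε < η → 0 < ε' → ε' < η → |u ε - u ε'| < δ) :
    ∃ y, Tendsto u (𝓝[>] 0) (𝓝 y) := by
  have hC : Cauchy (map u (𝓝[>] 0)) := by
    rw [Metric.cauchy_iff]
    refine ⟨inferInstance, fun δ hδ => ?_⟩
    obtain ⟨η, hη, H⟩ := h δ hδ
    refine ⟨u '' Set.Ioo 0 η, image_mem_map (Ioo_mem_nhdsGT hη), ?_⟩
    rintro _ ⟨ε, hε, rfl⟩ _ ⟨ε', hε', rfl⟩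
    exact H ε ε' hε.1 hε.2 hε'.1 hε'.2
  exact CompleteSpace.complete hC

theorem truncHilbert_cauchy_of_lipschitz {g : ℝ → ℝ} (hg : Integrable g) {L : NNReal}
    (hL : LipschitzWith L g) (x : ℝ) {δ : ℝ} (hδ : 0 < δ) :
    ∃ η > 0, ∀ ε ε', 0 < ε → ε < η → 0 < ε' → ε' < η →
      |truncHilbert g ε x - truncHilbert g ε' x| < δ := by
  refine ⟨δ / (2 * (L + 1)), by positivity, fun ε ε' h1 h2 h3 h4 => ?_⟩
  have key : ∀ η, 0 < η → η < δ / (2 * (L + 1)) → (L : ℝ) * (2 * η) < δ := by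
    intro η h0 hη
    rw [lt_div_iff₀ (by positivity)] at hη
    nlinarith [L.coe_nonneg]
  rcases le_total ε ε' with h | h
  · exact (abs_truncHilbert_sub_le hg hL h1 h x).trans_lt (key _ h3 h4)
  · rw [abs_sub_comm]
    exact (abs_truncHilbert_sub_le hg hL h3 h x).trans_lt (key _ h1 h2)

/-- The principal value exists almost everywhere. -/
theorem ae_exists_isHilbertValue {f : ℝ → ℝ} (hf : Integrable f) :
    ∀ᵐ x, ∃ y, IsHilbertValue f x y := by
  simp only [isHilbertValue_iff]
  let B : ℝ → Set ℝ := fun δ => {x | ¬ ∃ η > 0, ∀ ε ε', 0 < ε → ε < η → 0 < ε' → ε' < η →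
    |truncHilbert f ε x - truncHilbert f ε' x| < δ}
  have hB : ∀ δ > 0, volume (B δ) = 0 := by
    intro δ hδ
    have hle : ∀ θ > 0, volume (B δ) ≤ 160 * ENNReal.ofReal (θ / (δ / 3)) := by
      intro θ hθ
      -- For a Lipschitz `g` the truncations are Cauchy everywhere, so oscillation at least `δ` for
      -- `f` forces the maximal transform of `f - g` above `δ / 3`. The weak type inequality makes
      -- this set small with `θ`.
      obtain ⟨g, hg1, hg2, hg3⟩ := (memLp_one_iff_integrable.2 hf).exist_eLpNorm_sub_le
        ENNReal.one_ne_top le_rfl hθ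
      have hgi : Integrable g := hg2.continuous.integrable_of_hasCompactSupport hg1
      obtain ⟨L, hL⟩ := hg2.lipschitzWith_of_hasCompactSupport hg1 (by simp)
      have hsub : B δ ⊆ {x | ∃ ε > 0, δ / 3 < |truncHilbert (fun t => f t - g t) ε x|} := by
        intro x hx
        by_contra hcon
        have hcon' : ∀ ε > 0, |truncHilbert (fun t => f t - g t) ε x| ≤ δ / 3 := by
          intro ε hε
          by_contra! h
          exact hcon ⟨ε, hε, h⟩
        obtain ⟨η, hη, H⟩ := truncHilbert_cauchy_of_lipschitz hgi hL x
          (show 0 < δ / 3 by positivity)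
        refine hx ⟨η, hη, fun ε ε' h1 h2 h3 h4 => ?_⟩
        have a1 := hcon' ε h1
        have a2 := hcon' ε' h3
        have a3 := H ε ε' h1 h2 h3 h4
        rw [truncHilbert_sub hf hgi h1] at a1
        rw [truncHilbert_sub hf hgi h3] at a2
        rw [abs_le] at a1 a2
        rw [abs_lt] at a3 ⊢
        constructor <;> linarith [a1.1, a1.2, a2.1, a2.2, a3.1, a3.2]
      refine (measure_mono hsub).trans ((volume_maximal_truncHilbert_le (hf.sub hgi)
        (show 0 < δ / 3 by positivity)).trans ?_)
      gcongr
      have h1 := ofReal_integral_norm_eq_lintegral_enorm (hf.sub hgi)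
      rw [eLpNorm_one_eq_lintegral_enorm, ← h1] at hg3
      exact (ENNReal.ofReal_le_ofReal_iff hθ.le).1 hg3
    have hlim : Tendsto (fun θ : ℝ => 160 * ENNReal.ofReal (θ / (δ / 3))) (𝓝[>] 0) (𝓝 0) := by
      have h1 : Tendsto (fun θ : ℝ => θ / (δ / 3)) (𝓝[>] 0) (𝓝 0) := by
        have : Tendsto (fun θ : ℝ => θ / (δ / 3)) (𝓝 0) (𝓝 (0 / (δ / 3))) :=
          (continuous_id.div_const _).tendsto 0
        rw [zero_div] at this
        exact this.mono_left nhdsWithin_le_nhds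
      have h2 := ENNReal.Tendsto.const_mul (a := (160 : ℝ≥0∞)) (ENNReal.tendsto_ofReal h1)
        (Or.inr (by norm_num))
      simpa using h2
    refine le_antisymm (ge_of_tendsto hlim ?_) zero_le
    filter_upwards [self_mem_nhdsWithin] with θ hθ
    exact hle θ hθ
  have hall : ∀ᵐ x, ∀ n : ℕ, x ∉ B (1 / ((n : ℝ) + 1)) := by
    rw [ae_all_iff]
    intro n
    exact measure_eq_zero_iff_ae_notMem.1 (hB _ (by positivity))
  filter_upwards [hall] with x hx
  refine exists_tendsto_of_forall_dist_lt fun δ hδ => ?_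
  obtain ⟨n, hn⟩ := exists_nat_one_div_lt hδ
  obtain ⟨η, hη, H⟩ := not_not.1 (hx n)
  exact ⟨η, hη, fun ε ε' h1 h2 h3 h4 => (H ε ε' h1 h2 h3 h4).trans hn⟩

/-! ### Tangent planes of the concave `p`-sum. -/

/-- Linear majorants of `t ↦ (∑ t_k ^ p) ^ (1 / p)` on the positive orthant. -/
def linearMajorants (p : ℝ) (n : ℕ) : Set (Fin n → ℝ) :=
  {a | ∀ t : Fin n → ℝ, (∀ k, 0 ≤ t k) → (∑ k, t k ^ p) ^ (1 / p) ≤ ∑ k, a k * t k}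

theorem one_le_of_mem_linearMajorants {p : ℝ} (hp : 0 < p) {n : ℕ} {a : Fin n → ℝ}
    (ha : a ∈ linearMajorants p n) (k : Fin n) : 1 ≤ a k := by
  have h := ha (Pi.single k 1) fun j => by
    by_cases hj : j = k
    · subst hj; simp
    · simp [hj]
  have e : ∀ j, (Pi.single k (1 : ℝ) : Fin n → ℝ) j ^ p = (Pi.single k (1 : ℝ) : Fin n → ℝ) j := by
    intro j
    by_cases hj : j = k
    · subst hj; simp
    · simp [hj, Real.zero_rpow hp.ne']
  simp only [e] at h
  simpa [Pi.single_apply] using h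

/-- These coefficients are the gradient of `(∑ t_k ^ p) ^ (1 / p)` at `u`. The inequality is
Hölder's for the factorisation `w ^ p = (w * u ^ (p - 1)) ^ p * (u ^ p) ^ (1 - p)`, here proved
termwise from the weighted arithmetic-geometric mean inequality. -/
theorem tangent_mem_linearMajorants {p : ℝ} (hp : 0 < p) (hp1 : p ≤ 1) {n : ℕ} {u : Fin n → ℝ}
    (hu : ∀ k, 0 < u k) :
    (fun k => (∑ j, u j ^ p) ^ (1 / p - 1) * u k ^ (p - 1)) ∈ linearMajorants p n := by
  intro w hw
  set S := ∑ j, u j ^ p with hS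
  set B := ∑ k, w k * u k ^ (p - 1) with hB
  have hterm : ∀ k, 0 ≤ w k * u k ^ (p - 1) := fun k =>
    mul_nonneg (hw k) (Real.rpow_nonneg (hu k).le _)
  have hB0 : 0 ≤ B := Finset.sum_nonneg fun k _ => hterm k
  have hS0 : 0 ≤ S := Finset.sum_nonneg fun k _ => Real.rpow_nonneg (hu k).le _
  have hR : ∑ k, S ^ (1 / p - 1) * u k ^ (p - 1) * w k = S ^ (1 / p - 1) * B := by
    rw [hB, Finset.mul_sum]
    exact Finset.sum_congr rfl fun k _ => by ring
  rw [hR]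
  rcases hB0.eq_or_lt with h0 | hBpos
  · have hw0 : ∀ k, w k = 0 := by
      intro k
      have := (Finset.sum_eq_zero_iff_of_nonneg fun k _ => hterm k).1 h0.symm k (Finset.mem_univ k)
      exact (mul_eq_zero.1 this).resolve_right (Real.rpow_pos_of_pos (hu k) _).ne'
    simp [hw0, Real.zero_rpow hp.ne', ← h0, Real.zero_rpow (inv_pos.2 hp).ne']
  have hSpos : 0 < S := by
    refine hS0.lt_of_ne fun h => hBpos.ne' ?_
    have := (Finset.sum_eq_zero_iff_of_nonneg fun k _ => Real.rpow_nonneg (hu k).le p).1 h.symm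
    refine Finset.sum_eq_zero fun k hk => ?_
    exact absurd (this k hk) (Real.rpow_pos_of_pos (hu k) _).ne'
  have h1 : ∀ k, w k ^ p ≤
      B ^ p * S ^ (1 - p) * (p * (w k * u k ^ (p - 1) / B) + (1 - p) * (u k ^ p / S)) := by
    intro k
    have h := Real.geom_mean_le_arith_mean2_weighted hp.le (sub_nonneg.2 hp1)
      (div_nonneg (hterm k) hBpos.le) (div_nonneg (Real.rpow_nonneg (hu k).le p) hSpos.le)
      (by ring)
    have e : B ^ p * S ^ (1 - p) * ((w k * u k ^ (p - 1) / B) ^ p * (u k ^ p / S) ^ (1 - p))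
        = w k ^ p := by
      rw [Real.div_rpow (hterm k) hBpos.le, Real.div_rpow (Real.rpow_nonneg (hu k).le p) hSpos.le,
        Real.mul_rpow (hw k) (Real.rpow_nonneg (hu k).le _), ← Real.rpow_mul (hu k).le,
        ← Real.rpow_mul (hu k).le, mul_comm (p - 1) p]
      have h2 : u k ^ (p * (p - 1)) * u k ^ (p * (1 - p)) = 1 := by
        rw [← Real.rpow_add (hu k)]
        ring_nf
        exact Real.rpow_zero _
      have h3 : B ^ p ≠ 0 := (Real.rpow_pos_of_pos hBpos _).ne'
      have h4 : S ^ (1 - p) ≠ 0 := (Real.rpow_pos_of_pos hSpos _).ne'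
      field_simp
      linear_combination (w k ^ p) * h2
    rw [← e]
    gcongr
  have h2 : ∑ k, w k ^ p ≤ B ^ p * S ^ (1 - p) := by
    refine (Finset.sum_le_sum fun k _ => h1 k).trans (le_of_eq ?_)
    rw [← Finset.mul_sum, Finset.sum_add_distrib, ← Finset.mul_sum, ← Finset.mul_sum,
      ← Finset.sum_div, ← Finset.sum_div, ← hB, ← hS, div_self hBpos.ne', div_self hSpos.ne']
    ring
  calc (∑ k, w k ^ p) ^ (1 / p) ≤ (B ^ p * S ^ (1 - p)) ^ (1 / p) :=
        Real.rpow_le_rpow (Finset.sum_nonneg fun k _ => Real.rpow_nonneg (hw k) _) h2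
          (by positivity)
    _ = S ^ (1 / p - 1) * B := by
        rw [Real.mul_rpow (by positivity) (by positivity), ← Real.rpow_mul hB0,
          ← Real.rpow_mul hS0, mul_one_div_cancel hp.ne', Real.rpow_one, mul_comm]
        congr 2
        field_simp

/-- The function `(∑ t_k ^ p) ^ (1 / p)` is the infimum of its linear majorants. -/
theorem le_of_forall_linearMajorants {p : ℝ} (hp : 0 < p) (hp1 : p ≤ 1) {n : ℕ} {t : Fin n → ℝ}
    (ht : ∀ k, 0 ≤ t k) {y : ℝ} (h : ∀ a ∈ linearMajorants p n, y ≤ ∑ k, a k * t k) :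
    y ≤ (∑ k, t k ^ p) ^ (1 / p) := by
  have hp' : 0 ≤ 1 / p := by positivity
  -- The gradient may blow up where some `t k` vanishes, so the tangent is taken at the shifted
  -- point. By homogeneity its value there is that of the function itself, and then `ε → 0`.
  have key : ∀ ε > 0, y ≤ (∑ k, (t k + ε) ^ p) ^ (1 / p) := by
    intro ε hε
    have hu : ∀ k, 0 < t k + ε := fun k => by linarith [ht k]
    have hm := tangent_mem_linearMajorants hp hp1 hu
    refine (h _ hm).trans ?_
    have hle : ∑ k, (∑ j, (t j + ε) ^ p) ^ (1 / p - 1) * (t k + ε) ^ (p - 1) * t k ≤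
        ∑ k, (∑ j, (t j + ε) ^ p) ^ (1 / p - 1) * (t k + ε) ^ (p - 1) * (t k + ε) := by
      refine Finset.sum_le_sum fun k _ => mul_le_mul_of_nonneg_left (by linarith) ?_
      refine mul_nonneg (Real.rpow_nonneg (Finset.sum_nonneg fun j _ => ?_) _)
        (Real.rpow_nonneg (hu k).le _)
      exact Real.rpow_nonneg (hu j).le _
    refine hle.trans (le_of_eq ?_)
    have e : ∀ k, (∑ j, (t j + ε) ^ p) ^ (1 / p - 1) * (t k + ε) ^ (p - 1) * (t k + ε)
        = (∑ j, (t j + ε) ^ p) ^ (1 / p - 1) * (t k + ε) ^ p := by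
      intro k
      rw [mul_assoc, Real.rpow_sub_one (hu k).ne', div_mul_cancel₀ _ (hu k).ne']
    simp only [e]
    rw [← Finset.mul_sum]
    set S := ∑ j, (t j + ε) ^ p
    have hS : 0 ≤ S := Finset.sum_nonneg fun j _ => Real.rpow_nonneg (hu j).le _
    rcases hS.eq_or_lt with h0 | h0
    · rw [← h0, mul_zero, Real.zero_rpow (by positivity)]
    · rw [Real.rpow_sub_one h0.ne', div_mul_cancel₀ _ h0.ne']
  have hcont : Continuous fun ε : ℝ => (∑ k, (t k + ε) ^ p) ^ (1 / p) := by
    refine Continuous.rpow_const ?_ fun _ => Or.inr hp'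
    exact continuous_finsetSum _ fun k _ =>
      (continuous_const.add continuous_id).rpow_const fun _ => Or.inr hp.le
  have hlim := (hcont.tendsto 0).mono_left (nhdsWithin_le_nhds (s := Set.Ioi 0))
  simp only [add_zero] at hlim
  refine ge_of_tendsto hlim ?_
  filter_upwards [self_mem_nhdsWithin] with ε hε
  exact key ε hε

/-! ### Quasi-Banach lattices and automatic continuity. -/

section QuasiNorm

variable {X : Type} [AddCommGroup X] [Module ℝ X] {N : X → ℝ}

theorem IsQuasiBanach.zero (h : IsQuasiBanach N) : N 0 = 0 := by
  have := h.smul 0 0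
  simpa using this

theorem IsQuasiBanach.neg (h : IsQuasiBanach N) (x : X) : N (-x) = N x := by
  have := h.smul (-1) x
  simpa using this

/-- Peeling off the first term repeatedly costs one more factor `D` for each later term;
geometrically small terms can absorb this growth. -/
theorem IsQuasiBanach.sum_le (h : IsQuasiBanach N) {D : ℝ} (hD : 1 ≤ D)
    (hadd : ∀ x y, N (x + y) ≤ D * (N x + N y)) (y : ℕ → X) (k : ℕ) :
    N (∑ i ∈ Finset.range k, y i) ≤ ∑ i ∈ Finset.range k, D ^ (i + 1) * N (y i) := by
  induction k generalizing y with
  | zero => simp [h.zero]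
  | succ k ih =>
    rw [Finset.sum_range_succ', Finset.sum_range_succ', add_comm]
    refine (hadd _ _).trans ?_
    rw [mul_add, add_comm, zero_add, pow_one]
    gcongr
    refine (mul_le_mul_of_nonneg_left (ih fun i => y (i + 1)) (by linarith)).trans (le_of_eq ?_)
    rw [Finset.mul_sum]
    exact Finset.sum_congr rfl fun i _ => by ring

end QuasiNorm

section Lattices

variable {X Y : Type} [AddCommGroup X] [Module ℝ X] [Lattice X] [AddCommGroup Y] [Module ℝ Y]
  [Lattice Y] {N : X → ℝ} {NY : Y → ℝ}

theorem IsQuasiBanachLattice.isOrderedAddMonoid (h : IsQuasiBanachLattice N) :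
    IsOrderedAddMonoid X where
  add_le_add_left := fun x y hxy z => h.add_mono x y z hxy

theorem IsQuasiBanachLattice.abs (h : IsQuasiBanachLattice N) (x : X) : N |x| = N x := by
  have := h.isOrderedAddMonoid
  exact le_antisymm (h.solid _ _ (abs_abs x).le) (h.solid _ _ (abs_abs x).ge)

theorem IsQuasiBanachLattice.mono (h : IsQuasiBanachLattice N) {x y : X} (hx : 0 ≤ x)
    (hxy : x ≤ y) : N x ≤ N y := by
  have := h.isOrderedAddMonoid
  refine h.solid _ _ ?_
  rwa [abs_of_nonneg hx, abs_of_nonneg (hx.trans hxy)]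

theorem IsPBanachLattice.add_le_of_one (h : IsPBanachLattice 1 N) (x y : X) :
    N (x + y) ≤ N x + N y := by
  simpa using h.p_add_le x y

theorem IsPBanachLattice.sum_le_of_one (h : IsPBanachLattice 1 N) {ι : Type} (s : Finset ι)
    (x : ι → X) : N (∑ i ∈ s, x i) ≤ ∑ i ∈ s, N (x i) := by
  classical
  induction s using Finset.induction_on with
  | empty => simp [h.toIsQuasiBanach.zero]
  | insert a s ha ih =>
    rw [Finset.sum_insert ha, Finset.sum_insert ha]
    exact (h.add_le_of_one _ _).trans (by gcongr)

theorem IsPBanachLattice.of_one (h : IsPBanachLattice 1 N) {p : ℝ} (hp : 0 < p) (hp1 : p ≤ 1) :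
    IsPBanachLattice p N where
  toIsQuasiBanachLattice := h.toIsQuasiBanachLattice
  p_add_le := fun x y => (Real.rpow_le_rpow (h.nonneg _) (h.add_le_of_one x y) hp.le).trans
    (Real.rpow_add_le_add_rpow (h.nonneg x) (h.nonneg y) hp.le hp1)

theorem IsQuasiBanachLattice.sum_smul_abs_nonneg (h : IsQuasiBanachLattice N) {n : ℕ} {a : Fin n → ℝ}
    (ha : ∀ k, 0 ≤ a k) (x : Fin n → X) : 0 ≤ ∑ k, a k • |x k| := by
  have := h.isOrderedAddMonoid
  refine Finset.sum_nonneg fun k _ => ?_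
  have := h.smul_mono (a k) 0 |x k| (ha k) (abs_nonneg _)
  rwa [smul_zero] at this

theorem IsPSum.nonneg (h : IsQuasiBanachLattice N) {p : ℝ} (hp : 0 < p) {n : ℕ} {x : Fin n → X}
    {z : X} (hz : IsPSum p x z) : 0 ≤ z := by
  refine hz.2 ?_
  rintro w ⟨a, ha, rfl⟩
  exact IsQuasiBanachLattice.sum_smul_abs_nonneg h
    (fun k => zero_le_one.trans (one_le_of_mem_linearMajorants hp ha k)) x

/-- A `p`-sum lies below every `∑ a k • |x k|`, so the triangle inequality bounds its norm by `∑ a k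
* N (x k)`. Taking the infimum over the majorants evaluates the scalar `p`-sum at the norms. -/
theorem IsPBanachLattice.pConvexWith_one (h : IsPBanachLattice 1 N) {p : ℝ} (hp : 0 < p)
    (hp1 : p ≤ 1) : PConvexWith p N 1 := by
  refine ⟨one_pos, fun n x z hz => ?_⟩
  rw [one_mul]
  refine le_of_forall_linearMajorants hp hp1 (fun k => h.nonneg _) fun a ha => ?_
  refine (h.mono (hz.nonneg h.toIsQuasiBanachLattice hp) (hz.1 ⟨a, ha, rfl⟩)).trans
    ((h.sum_le_of_one _ _).trans (le_of_eq ?_))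
  refine Finset.sum_congr rfl fun k _ => ?_
  rw [h.smul, h.abs, abs_of_nonneg]
  exact zero_le_one.trans (one_le_of_mem_linearMajorants hp ha k)

theorem isPSum_abs (h : IsQuasiBanachLattice N) {p : ℝ} (hp : 0 < p) (x : X) :
    IsPSum p (fun _ : Fin 1 => x) |x| := by
  have := h.isOrderedAddMonoid
  constructor
  · rintro w ⟨a, ha, rfl⟩
    have h1 := one_le_of_mem_linearMajorants hp ha 0
    have h2 := h.smul_mono (a 0 - 1) 0 |x| (by linarith) (abs_nonneg _)
    rw [smul_zero, sub_smul, one_smul, sub_nonneg] at h2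
    simpa using h2
  · intro w hw
    refine hw ⟨fun _ => 1, fun t ht => ?_, by simp⟩
    simp only [Finset.univ_unique, Fin.default_eq_zero, Fin.isValue, Finset.sum_singleton, one_mul]
    rw [← Real.rpow_mul (ht 0), mul_one_div_cancel hp.ne', Real.rpow_one]

theorem IsPBanachLattice.convexityConst_eq_one (h : IsPBanachLattice 1 N) {p : ℝ} (hp : 0 < p)
    (hp1 : p ≤ 1) {x : X} (hx : N x ≠ 0) : convexityConst p N = 1 := by
  have hx0 : 0 < N x := lt_of_le_of_ne (h.nonneg x) hx.symm
  refine IsLeast.csInf_eq ⟨h.pConvexWith_one hp hp1, fun C hC => ?_⟩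
  have := hC.2 1 (fun _ => x) |x| (isPSum_abs h.toIsQuasiBanachLattice hp x)
  rw [h.abs] at this
  simp only [Finset.univ_unique, Finset.sum_const, Finset.card_singleton, one_smul] at this
  rw [← Real.rpow_mul hx0.le, mul_one_div_cancel hp.ne', Real.rpow_one] at this
  by_contra! hlt
  nlinarith

theorem IsLatticeHom.map_abs {T : X →ₗ[ℝ] Y} (hT : IsLatticeHom T) (x : X) : T |x| = |T x| := by
  rw [abs, hT.1, map_neg]
  rfl

theorem IsLatticeHom.mono {T : X →ₗ[ℝ] Y} (hT : IsLatticeHom T) {x y : X} (hxy : x ≤ y) :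
    T x ≤ T y := by
  rw [← sup_eq_right] at hxy ⊢
  rw [← hT.1, hxy]

/-- Lattice homomorphisms between quasi-Banach lattices are continuous. -/
theorem IsLatticeHom.bounded (hX : IsQuasiBanachLattice N) (hY : IsQuasiBanachLattice NY)
    {T : X →ₗ[ℝ] Y} (hT : IsLatticeHom T) : ∃ C, 0 ≤ C ∧ ∀ x, NY (T x) ≤ C * N x := by
  have := hX.isOrderedAddMonoid
  have := hY.isOrderedAddMonoid
  by_contra! hcon
  obtain ⟨D, hD, hadd⟩ := hX.add_le
  have hD0 : 0 < D := by linarith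
  -- If `T` is unbounded, there are positive `x n` small enough to be summable despite the modulus
  -- of concavity `D`, with images of quasi-norm at least `n`. The sum `z` dominates every `x n`, so
  -- `T z` dominates every `T (x n)`, which is impossible.
  have hstep : ∀ n : ℕ, ∃ x : X, 0 ≤ x ∧ N x ≤ (2 * D)⁻¹ ^ (n + 1) ∧ (n : ℝ) ≤ NY (T x) := by
    intro n
    obtain ⟨x, hx⟩ := hcon (n * (2 * D) ^ (n + 1)) (by positivity)
    have hx0 : 0 < N x := by
      refine lt_of_le_of_ne (hX.nonneg x) fun h0 => ?_
      rw [hX.eq_zero x h0.symm, map_zero, hY.toIsQuasiBanach.zero, hX.toIsQuasiBanach.zero,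
        mul_zero] at hx
      exact lt_irrefl _ hx
    set c : ℝ := (2 * D)⁻¹ ^ (n + 1) / N x with hc
    have hc0 : 0 ≤ c := by positivity
    refine ⟨c • |x|, ?_, ?_, ?_⟩
    · have := hX.smul_mono c 0 |x| hc0 (abs_nonneg _)
      rwa [smul_zero] at this
    · rw [hX.smul, hX.abs, abs_of_nonneg hc0, hc, div_mul_cancel₀ _ hx0.ne']
    · rw [map_smul, hT.map_abs, hY.smul, hY.abs, abs_of_nonneg hc0]
      have e : c * (n * (2 * D) ^ (n + 1) * N x) = n := by
        have h2D : 2 * D ≠ 0 := by positivity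
        rw [hc, inv_pow]
        field_simp
      rw [← e]
      gcongr
  choose x hx0 hxN hxT using hstep
  set u : ℕ → X := fun n => ∑ i ∈ Finset.range n, x i with hu
  have hgeo : ∀ k, ∑ i ∈ Finset.range k, (1 / 2 : ℝ) ^ (i + 1) = 1 - (1 / 2) ^ k := by
    intro k
    induction k with
    | zero => simp
    | succ k ih =>
      rw [Finset.sum_range_succ, ih]
      ring
  have hdiff : ∀ n k, N (u (n + k) - u n) ≤ (1 / 2) ^ n := by
    intro n k
    have e : u (n + k) - u n = ∑ i ∈ Finset.range k, x (n + i) := by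
      rw [hu]
      simp only [Finset.sum_range_add]
      abel
    rw [e]
    refine (hX.toIsQuasiBanach.sum_le hD hadd _ k).trans ?_
    have hb : ∀ i ∈ Finset.range k, D ^ (i + 1) * N (x (n + i)) ≤ (1 / 2) ^ n * (1 / 2) ^ (i + 1) := by
      intro i _
      calc D ^ (i + 1) * N (x (n + i)) ≤ D ^ (n + i + 1) * (2 * D)⁻¹ ^ (n + i + 1) := by
            exact mul_le_mul (pow_le_pow_right₀ hD (by omega)) (hxN _) (hX.nonneg _) (by positivity)
        _ = (1 / 2) ^ n * (1 / 2) ^ (i + 1) := by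
            rw [← mul_pow, ← pow_add, add_assoc]
            congr 1
            field_simp
    refine (Finset.sum_le_sum hb).trans ?_
    rw [← Finset.mul_sum]
    have hg : ∑ i ∈ Finset.range k, (1 / 2 : ℝ) ^ (i + 1) ≤ 1 := by
      have := hgeo k
      rw [this]
      have : (0 : ℝ) ≤ (1 / 2) ^ k := by positivity
      linarith
    calc (1 / 2 : ℝ) ^ n * ∑ i ∈ Finset.range k, (1 / 2 : ℝ) ^ (i + 1) ≤ (1 / 2) ^ n * 1 := by gcongr
      _ = _ := mul_one _
  obtain ⟨z, hz⟩ := hX.complete u fun ε hε => by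
    obtain ⟨n₀, hn₀⟩ := exists_pow_lt_of_lt_one hε (show (1 / 2 : ℝ) < 1 by norm_num)
    have key : ∀ m n, n₀ ≤ n → n ≤ m → N (u m - u n) < ε := by
      intro m n h1 h2
      obtain ⟨k, rfl⟩ := Nat.exists_eq_add_of_le h2
      refine ((hdiff n k).trans ?_).trans_lt hn₀
      exact pow_le_pow_of_le_one (by norm_num) (by norm_num) h1
    refine ⟨n₀, fun m n hm hn => ?_⟩
    rcases le_total n m with h | h
    · exact key m n hn h
    · rw [← neg_sub, hX.toIsQuasiBanach.neg]
      exact key n m hm h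
  have hle : ∀ k, x k ≤ z := by
    -- Partial sums past `k` lie above `x k`, and the positive part of `x k - z` is dominated by `|u
    -- n - z|`, whose quasi-norm tends to zero.
    intro k
    have h1 : ∀ᶠ n in atTop, N ((x k - z) ⊔ 0) ≤ N (u n - z) := by
      filter_upwards [eventually_gt_atTop k] with n hn
      have h2 : x k ≤ u n :=
        Finset.single_le_sum (f := x) (fun i _ => hx0 i) (Finset.mem_range.2 hn)
      refine hX.solid _ _ ?_
      rw [abs_of_nonneg le_sup_right]
      exact sup_le ((sub_le_sub_right h2 z).trans (le_abs_self _)) (abs_nonneg _)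
    have h3 : N ((x k - z) ⊔ 0) ≤ 0 := ge_of_tendsto hz h1
    have h4 := hX.eq_zero _ (le_antisymm h3 (hX.nonneg _))
    have h5 : x k - z ≤ 0 := h4 ▸ le_sup_left
    exact sub_nonpos.1 h5
  obtain ⟨n, hn⟩ := exists_nat_gt (NY (T z))
  have h1 : NY (T (x n)) ≤ NY (T z) := by
    refine hY.mono ?_ (hT.mono (hle n))
    have := hT.mono (hx0 n)
    rwa [map_zero] at this
  linarith [hxT n]

end Lattices

/-! ### `L_{1,∞}(ℝ)` is a `1/2`-Banach lattice. -/

theorem WeakL1.coeFn_add (f g : WeakL1) :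
    ((f + g : WeakL1) : ℝ →ₘ[volume] ℝ) =ᵐ[volume] fun x => f.1 x + g.1 x :=
  AEEqFun.coeFn_add f.1 g.1

theorem WeakL1.coeFn_sub (f g : WeakL1) :
    ((f - g : WeakL1) : ℝ →ₘ[volume] ℝ) =ᵐ[volume] fun x => f.1 x - g.1 x :=
  AEEqFun.coeFn_sub f.1 g.1

theorem WeakL1.coeFn_smul (c : ℝ) (f : WeakL1) :
    ((c • f : WeakL1) : ℝ →ₘ[volume] ℝ) =ᵐ[volume] fun x => c * f.1 x :=
  AEEqFun.coeFn_smul c f.1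

theorem WeakL1.coeFn_zero : ((0 : WeakL1) : ℝ →ₘ[volume] ℝ) =ᵐ[volume] fun _ => 0 :=
  AEEqFun.coeFn_zero

theorem WeakL1.coeFn_abs (f : WeakL1) :
    ((|f| : WeakL1) : ℝ →ₘ[volume] ℝ) =ᵐ[volume] fun x => |f.1 x| := by
  have h1 : ((|f| : WeakL1) : ℝ →ₘ[volume] ℝ) = f.1 ⊔ -f.1 := rfl
  rw [h1]
  filter_upwards [AEEqFun.coeFn_sup f.1 (-f.1), AEEqFun.coeFn_neg f.1] with x h2 h3
  rw [h2, h3]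
  rfl

theorem WeakL1.coeFn_sum {ι : Type} (s : Finset ι) (f : ι → WeakL1) :
    ((∑ i ∈ s, f i : WeakL1) : ℝ →ₘ[volume] ℝ) =ᵐ[volume] fun x => ∑ i ∈ s, (f i).1 x := by
  classical
  induction s using Finset.induction_on with
  | empty => simpa using WeakL1.coeFn_zero
  | insert a s ha ih =>
    rw [Finset.sum_insert ha]
    filter_upwards [WeakL1.coeFn_add (f a) (∑ i ∈ s, f i), ih] with x h1 h2
    rw [h1, h2, Finset.sum_insert ha]

theorem WeakL1.coeFn_le {f g : WeakL1} : f ≤ g ↔ ∀ᵐ x, f.1 x ≤ g.1 x :=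
  (AEEqFun.coeFn_le (f := f.1) (g := g.1)).symm

theorem WeakL1.ext {f g : WeakL1} (h : ∀ᵐ x, f.1 x = g.1 x) : f = g :=
  Subtype.ext (AEEqFun.ext h)

theorem weakNorm_nonneg (f : WeakL1) : 0 ≤ weakNorm f := ENNReal.toReal_nonneg

theorem ofReal_weakNorm (f : WeakL1) : ENNReal.ofReal (weakNorm f) = weakENorm f :=
  ENNReal.ofReal_toReal (ne_of_lt f.2)

theorem volume_lt_abs_le (f : WeakL1) {t : ℝ} (ht : 0 < t) :
    volume {x | t < |f.1 x|} ≤ ENNReal.ofReal (weakNorm f / t) := by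
  rw [ENNReal.ofReal_div_of_pos ht, ENNReal.le_div_iff_mul_le (Or.inl (by simpa using ht))
    (Or.inl ENNReal.ofReal_ne_top), ofReal_weakNorm, mul_comm]
  exact le_iSup₂_of_le (f := fun (s : ℝ) (_ : 0 < s) => ENNReal.ofReal s * volume {x | s < |f.1 x|})
    t ht le_rfl

theorem weakENorm_le_ofReal {f : ℝ →ₘ[volume] ℝ} {W : ℝ}
    (h : ∀ t > 0, volume {x | t < |f x|} ≤ ENNReal.ofReal (W / t)) :
    weakENorm f ≤ ENNReal.ofReal W := by
  refine iSup₂_le fun t ht => ?_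
  have := h t ht
  rwa [ENNReal.ofReal_div_of_pos ht, ENNReal.le_div_iff_mul_le (Or.inl (by simpa using ht))
    (Or.inl ENNReal.ofReal_ne_top), mul_comm] at this

theorem weakNorm_le {f : WeakL1} {W : ℝ} (hW : 0 ≤ W)
    (h : ∀ t > 0, volume {x | t < |f.1 x|} ≤ ENNReal.ofReal (W / t)) : weakNorm f ≤ W :=
  ENNReal.toReal_le_of_le_ofReal hW (weakENorm_le_ofReal h)

theorem weakNorm_eq_zero {f : WeakL1} (h : weakNorm f = 0) : f = 0 := by
  have h1 : ∀ᵐ x, ∀ n : ℕ, ¬ 1 / ((n : ℝ) + 1) < |f.1 x| := by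
    rw [ae_all_iff]
    intro n
    refine measure_eq_zero_iff_ae_notMem.1 (le_antisymm ?_ zero_le)
    have := volume_lt_abs_le f (t := 1 / ((n : ℝ) + 1)) (by positivity)
    rwa [h, zero_div, ENNReal.ofReal_zero] at this
  refine WeakL1.ext ?_
  filter_upwards [h1, WeakL1.coeFn_zero] with x hx h0
  rw [h0]
  by_contra hne
  obtain ⟨n, hn⟩ := exists_nat_one_div_lt (abs_pos.2 hne)
  exact hx n hn

theorem weakNorm_mono {f g : WeakL1} (h : ∀ᵐ x, |f.1 x| ≤ |g.1 x|) : weakNorm f ≤ weakNorm g := by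
  refine weakNorm_le (weakNorm_nonneg g) fun t ht => ?_
  refine le_trans (measure_mono_ae ?_) (volume_lt_abs_le g ht)
  filter_upwards [h] with x hx hxt
  exact lt_of_lt_of_le hxt hx

theorem weakNorm_smul (c : ℝ) (f : WeakL1) : weakNorm (c • f) = |c| * weakNorm f := by
  have key : ∀ (c : ℝ) (f : WeakL1), weakNorm (c • f) ≤ |c| * weakNorm f := by
    intro c f
    refine weakNorm_le (mul_nonneg (abs_nonneg _) (weakNorm_nonneg f)) fun t ht => ?_
    rcases eq_or_ne c 0 with rfl | hc
    · refine le_trans (le_of_eq ?_) zero_le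
      refine measure_eq_zero_iff_ae_notMem.2 ?_
      filter_upwards [WeakL1.coeFn_smul 0 f] with x hx hxt
      have : t < |((0 : ℝ) • f).1 x| := hxt
      rw [hx, zero_mul, abs_zero] at this
      linarith
    · have hc' : 0 < |c| := abs_pos.2 hc
      have h := volume_lt_abs_le f (div_pos ht hc')
      rw [div_div_eq_mul_div, mul_comm (weakNorm f)] at h
      refine le_trans (measure_mono_ae ?_) h
      filter_upwards [WeakL1.coeFn_smul c f] with x hx hxt
      have h1 : t < |(c • f).1 x| := hxt
      change t / |c| < |f.1 x|
      rw [hx, abs_mul] at h1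
      rw [div_lt_iff₀ hc']
      linarith
  refine le_antisymm (key c f) ?_
  rcases eq_or_ne c 0 with rfl | hc
  · simpa using weakNorm_nonneg _
  · have h := key c⁻¹ (c • f)
    rw [smul_smul, inv_mul_cancel₀ hc, one_smul, abs_inv] at h
    have hc' : 0 < |c| := abs_pos.2 hc
    rwa [← div_eq_inv_mul, le_div_iff₀ hc', mul_comm] at h

theorem sqrt_weakNorm_add_le (f g : WeakL1) :
    weakNorm (f + g) ^ (1 / 2 : ℝ) ≤ weakNorm f ^ (1 / 2 : ℝ) + weakNorm g ^ (1 / 2 : ℝ) := by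
  simp only [← Real.sqrt_eq_rpow]
  set a := Real.sqrt (weakNorm f) with ha
  set b := Real.sqrt (weakNorm g) with hb
  have ha2 : a * a = weakNorm f := Real.mul_self_sqrt (weakNorm_nonneg f)
  have hb2 : b * b = weakNorm g := Real.mul_self_sqrt (weakNorm_nonneg g)
  have ha0 : 0 ≤ a := Real.sqrt_nonneg _
  have hb0 : 0 ≤ b := Real.sqrt_nonneg _
  rcases ha0.eq_or_lt with h0 | hapos
  · have : f = 0 := weakNorm_eq_zero (by rw [← ha2, ← h0, zero_mul])
    rw [this, zero_add, ← h0, zero_add]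
  rcases hb0.eq_or_lt with h0 | hbpos
  · have : g = 0 := weakNorm_eq_zero (by rw [← hb2, ← h0, zero_mul])
    rw [this, add_zero, ← h0, add_zero]
  rw [Real.sqrt_le_left (by positivity)]
  refine weakNorm_le (by positivity) fun t ht => ?_
  have hsum : 0 < a + b := by positivity
  -- Splitting the level `t` in the proportion `a : b` of the square roots is optimal: the two
  -- bounds add up to `(a + b) ^ 2 / t`.
  have h1 := volume_lt_abs_le f (t := t * (a / (a + b))) (by positivity)
  have h2 := volume_lt_abs_le g (t := t * (b / (a + b))) (by positivity)
  have hsub : volume {x | t < |(f + g).1 x|} ≤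
      volume ({x | t * (a / (a + b)) < |f.1 x|} ∪ {x | t * (b / (a + b)) < |g.1 x|}) := by
    refine measure_mono_ae ?_
    filter_upwards [WeakL1.coeFn_add f g] with x hx hxt
    have hxt' : t < |(f + g).1 x| := hxt
    rw [hx] at hxt'
    by_contra hcon
    have hcon' : ¬ (t * (a / (a + b)) < |f.1 x| ∨ t * (b / (a + b)) < |g.1 x|) := hcon
    rw [not_or, not_lt, not_lt] at hcon'
    have e : t * (a / (a + b)) + t * (b / (a + b)) = t := by field_simp
    linarith [abs_add_le (f.1 x) (g.1 x), hcon'.1, hcon'.2]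
  refine hsub.trans ((measure_union_le _ _).trans ((add_le_add h1 h2).trans (le_of_eq ?_)))
  rw [← ha2, ← hb2, ← ENNReal.ofReal_add (by positivity) (by positivity)]
  congr 1
  field_simp

/-- The Fatou property: where `|f|` exceeds `t`, eventually so does `|u n|`, because the inequality
is strict. -/
theorem weakNorm_le_of_ae_tendsto {f : WeakL1} {u : ℕ → WeakL1} {W : ℝ} (hW : 0 ≤ W)
    (hu : ∀ᶠ n in atTop, weakNorm (u n) ≤ W)
    (hlim : ∀ᵐ x, Tendsto (fun n => (u n).1 x) atTop (𝓝 (f.1 x))) : weakNorm f ≤ W := by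
  obtain ⟨N, hN⟩ := eventually_atTop.1 hu
  refine weakNorm_le hW fun t ht => ?_
  have h1 : volume {x | t < |f.1 x|} ≤ volume {x | t < |f.1 x| ∧
      Tendsto (fun n => (u n).1 x) atTop (𝓝 (f.1 x))} := by
    refine measure_mono_ae ?_
    filter_upwards [hlim] with x hx hxt
    exact ⟨hxt, hx⟩
  refine h1.trans (volume_le_of_eventually_mem (F := fun n => {x | t < |(u (n + N)).1 x|}) ?_ ?_)
  · rintro x ⟨hxt, hx⟩
    exact ((tendsto_add_atTop_iff_nat N).2 hx).abs.eventually_const_lt hxt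
  · intro n
    refine (volume_lt_abs_le _ ht).trans (ENNReal.ofReal_le_ofReal ?_)
    gcongr
    exact hN _ (by omega)

/-- Along a subsequence with increments at most `4 ^ (-j)`, an increment exceeds `2 ^ (-j)` only on
a set of measure at most `2 ^ (-j)`. Borel-Cantelli gives an almost everywhere limit, and the Fatou
property turns this into convergence in quasi-norm of the full sequence. -/
theorem exists_weakL1_limit (u : ℕ → WeakL1)
    (hu : ∀ ε : ℝ, 0 < ε → ∃ n₀ : ℕ, ∀ m n : ℕ, n₀ ≤ m → n₀ ≤ n → weakNorm (u m - u n) < ε) :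
    ∃ f, Tendsto (fun n => weakNorm (u n - f)) atTop (𝓝 0) := by
  choose! N hN using hu
  let k : ℕ → ℕ := fun j => j + (Finset.range (j + 1)).sup fun i => N ((1 / 4) ^ i)
  have hkmono : Monotone k := fun i j hij =>
    add_le_add hij (Finset.sup_mono (Finset.range_mono (by omega)))
  have hkN : ∀ j, N ((1 / 4) ^ j) ≤ k j := fun j =>
    (Finset.le_sup (f := fun i => N ((1 / 4) ^ i)) (Finset.mem_range.2 (Nat.lt_succ_self j))).trans
      (Nat.le_add_left _ _)
  have hdiff : ∀ j, weakNorm (u (k (j + 1)) - u (k j)) ≤ (1 / 4) ^ j := fun j =>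
    (hN ((1 / 4) ^ j) (by positivity) _ _ ((hkN j).trans (hkmono (Nat.le_succ j))) (hkN j)).le
  have hvol : ∀ j, volume {x | (1 / 2 : ℝ) ^ j < |(u (k (j + 1)) - u (k j)).1 x|} ≤
      ENNReal.ofReal ((1 / 2) ^ j) := by
    intro j
    refine (volume_lt_abs_le _ (by positivity)).trans (ENNReal.ofReal_le_ofReal ?_)
    rw [div_le_iff₀ (by positivity), ← mul_pow]
    have e : (1 / 2 * (1 / 2) : ℝ) = 1 / 4 := by norm_num
    rw [e]
    exact hdiff j
  have hsum : ∑' j, volume {x | (1 / 2 : ℝ) ^ j < |(u (k (j + 1)) - u (k j)).1 x|} ≠ ⊤ := by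
    refine ne_of_lt (lt_of_le_of_lt (ENNReal.tsum_le_tsum hvol) ?_)
    rw [← ENNReal.ofReal_tsum_of_nonneg (fun n => by positivity) summable_geometric_two]
    exact ENNReal.ofReal_lt_top
  have hbc := measure_limsup_atTop_eq_zero hsum
  have hev : ∀ᵐ x, ∀ᶠ j in atTop, |(u (k (j + 1)) - u (k j)).1 x| ≤ (1 / 2 : ℝ) ^ j := by
    have := measure_eq_zero_iff_ae_notMem.1 hbc
    filter_upwards [this] with x hx
    rw [mem_limsup_iff_frequently_mem, not_frequently] at hx
    filter_upwards [hx] with j hj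
    exact not_lt.1 hj
  have hlim : ∀ᵐ x, ∃ l, Tendsto (fun j => (u (k j)).1 x) atTop (𝓝 l) := by
    have hs : ∀ᵐ x, ∀ j, (u (k (j + 1)) - u (k j)).1 x = (u (k (j + 1))).1 x - (u (k j)).1 x :=
      ae_all_iff.2 fun j => WeakL1.coeFn_sub _ _
    filter_upwards [hev, hs] with x hx hsx
    obtain ⟨J, hJ⟩ := eventually_atTop.1 hx
    have hc : CauchySeq fun j => (u (k (j + J))).1 x := by
      refine cauchySeq_of_le_geometric (1 / 2) 1 (by norm_num) fun j => ?_
      have h1 := hJ (j + J) (by omega)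
      rw [hsx] at h1
      rw [dist_comm, Real.dist_eq, one_mul]
      have e : j + 1 + J = j + J + 1 := by omega
      rw [e]
      exact h1.trans (pow_le_pow_of_le_one (by norm_num) (by norm_num) (by omega))
    obtain ⟨l, hl⟩ := cauchySeq_tendsto_of_complete hc
    exact ⟨l, (tendsto_add_atTop_iff_nat (f := fun j => (u (k j)).1 x) J).1 hl⟩
  obtain ⟨g, hgm, hg⟩ := measurable_limit_of_tendsto_metrizable_ae
    (fun j => (AEEqFun.measurable (u (k j)).1).aemeasurable) hlim
  let g' : ℝ →ₘ[volume] ℝ := AEEqFun.mk g hgm.aestronglyMeasurable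
  have hg' : ∀ᵐ x, Tendsto (fun j => (u (k j)).1 x) atTop (𝓝 (g' x)) := by
    filter_upwards [hg, AEEqFun.coeFn_mk g hgm.aestronglyMeasurable] with x hx hx'
    rw [hx']
    exact hx
  have hbd : ∀ j, weakNorm (u (k j)) ≤ 2 * weakNorm (u (k 0)) + 2 := by
    intro j
    have h1 : weakNorm (u (k j) - u (k 0)) ≤ 1 := by
      have := (hN ((1 / 4) ^ 0) (by positivity) (k j) (k 0)
        ((hkN 0).trans (hkmono (Nat.zero_le j))) (hkN 0)).le
      simpa using this
    have h2 := sqrt_weakNorm_add_le (u (k j) - u (k 0)) (u (k 0))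
    rw [sub_add_cancel] at h2
    simp only [← Real.sqrt_eq_rpow] at h2
    have s1 := Real.sq_sqrt (weakNorm_nonneg (u (k j)))
    have s2 := Real.sq_sqrt (weakNorm_nonneg (u (k j) - u (k 0)))
    have s3 := Real.sq_sqrt (weakNorm_nonneg (u (k 0)))
    have p1 := Real.sqrt_nonneg (weakNorm (u (k j)))
    nlinarith [sq_nonneg (Real.sqrt (weakNorm (u (k j) - u (k 0))) - Real.sqrt (weakNorm (u (k 0))))]
  have hgfin : weakENorm g' < ⊤ := by
    refine lt_of_le_of_lt (weakENorm_le_ofReal (W := 2 * weakNorm (u (k 0)) + 2) fun t ht => ?_)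
      ENNReal.ofReal_lt_top
    have h1 : volume {x | t < |g' x|} ≤ volume {x | t < |g' x| ∧
        Tendsto (fun n => (u (k n)).1 x) atTop (𝓝 (g' x))} := by
      refine measure_mono_ae ?_
      filter_upwards [hg'] with x hx hxt
      exact ⟨hxt, hx⟩
    refine h1.trans (volume_le_of_eventually_mem (F := fun n => {x | t < |(u (k n)).1 x|}) ?_ ?_)
    · rintro x ⟨hxt, hx⟩
      exact hx.abs.eventually_const_lt hxt
    · intro n
      refine (volume_lt_abs_le _ ht).trans (ENNReal.ofReal_le_ofReal ?_)
      gcongr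
      exact hbd n
  refine ⟨⟨g', hgfin⟩, ?_⟩
  have hkey : ∀ ε > 0, ∀ m, N ε ≤ m → weakNorm (u m - ⟨g', hgfin⟩) ≤ ε := by
    intro ε hε m hm
    refine weakNorm_le_of_ae_tendsto (u := fun j => u m - u (k j)) hε.le ?_ ?_
    · filter_upwards [eventually_ge_atTop (N ε)] with j hj
      exact (hN ε hε m (k j) hm (hj.trans (Nat.le_add_right _ _))).le
    · have hs : ∀ᵐ x, ∀ j, (u m - u (k j)).1 x = (u m).1 x - (u (k j)).1 x :=
        ae_all_iff.2 fun j => WeakL1.coeFn_sub _ _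
      filter_upwards [hs, hg', WeakL1.coeFn_sub (u m) ⟨g', hgfin⟩] with x h1 h2 h3
      rw [h3]
      simp only [h1]
      exact tendsto_const_nhds.sub h2
  rw [Metric.tendsto_atTop]
  intro ε hε
  refine ⟨N (ε / 2), fun m hm => ?_⟩
  rw [dist_zero_right, Real.norm_eq_abs, abs_of_nonneg (weakNorm_nonneg _)]
  linarith [hkey (ε / 2) (half_pos hε) m hm]

theorem isQuasiBanachLattice_weakNorm : IsQuasiBanachLattice weakNorm where
  nonneg := weakNorm_nonneg
  eq_zero := fun _ => weakNorm_eq_zero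
  smul := weakNorm_smul
  add_le := by
    refine ⟨2, by norm_num, fun f g => ?_⟩
    have h2 := sqrt_weakNorm_add_le f g
    simp only [← Real.sqrt_eq_rpow] at h2
    have s1 := Real.sq_sqrt (weakNorm_nonneg (f + g))
    have s2 := Real.sq_sqrt (weakNorm_nonneg f)
    have s3 := Real.sq_sqrt (weakNorm_nonneg g)
    have p1 := Real.sqrt_nonneg (weakNorm (f + g))
    nlinarith [sq_nonneg (Real.sqrt (weakNorm f) - Real.sqrt (weakNorm g))]
  complete := exists_weakL1_limit
  add_mono := by
    intro f g h hfg
    rw [WeakL1.coeFn_le] at hfg ⊢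
    filter_upwards [hfg, WeakL1.coeFn_add f h, WeakL1.coeFn_add g h] with x h1 h2 h3
    rw [h2, h3]
    linarith
  smul_mono := by
    intro c f g hc hfg
    rw [WeakL1.coeFn_le] at hfg ⊢
    filter_upwards [hfg, WeakL1.coeFn_smul c f, WeakL1.coeFn_smul c g] with x h1 h2 h3
    rw [h2, h3]
    exact mul_le_mul_of_nonneg_left h1 hc
  solid := by
    intro f g hfg
    rw [WeakL1.coeFn_le] at hfg
    refine weakNorm_mono ?_
    filter_upwards [hfg, WeakL1.coeFn_abs f, WeakL1.coeFn_abs g] with x h1 h2 h3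
    rwa [h2, h3] at h1

theorem isPBanachLattice_weakNorm : IsPBanachLattice (1 / 2) weakNorm where
  toIsQuasiBanachLattice := isQuasiBanachLattice_weakNorm
  p_add_le := sqrt_weakNorm_add_le

/-! ### Kolmogorov's inequality and `p`-convexity of `L_{1,∞}(ℝ)`. -/

/-- The supremum over the sets `A` of positive finite measure of `|A| ^ (p - 1) * ∫_A |f| ^ p`. -/
noncomputable def locENorm (p : ℝ) (f : WeakL1) : ℝ≥0∞ :=
  ⨆ (A : Set ℝ) (_ : MeasurableSet A) (_ : volume A ≠ 0) (_ : volume A ≠ ⊤),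
    volume A ^ (p - 1) * ∫⁻ x in A, ENNReal.ofReal (|f.1 x| ^ p)

/-- For `0 < p < 1`, a `p`-norm on `L_{1,∞}(ℝ)` equivalent to the usual quasi-norm. -/
noncomputable def locNorm (p : ℝ) (f : WeakL1) : ℝ := (locENorm p f).toReal ^ (1 / p)

theorem setLIntegral_rpow_le {p : ℝ} (hp : 0 < p) (hp1 : p < 1) (f : WeakL1) {A : Set ℝ}
    (hA0 : volume A ≠ 0) (hA : volume A ≠ ⊤) :
    ∫⁻ x in A, ENNReal.ofReal (|f.1 x| ^ p) ≤
      ENNReal.ofReal ((volume A).toReal ^ (1 - p) * (weakNorm f ^ p / (1 - p))) := by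
  set v := (volume A).toReal with hv
  have hv0 : 0 < v := ENNReal.toReal_pos hA0 hA
  have hvA : volume A = ENNReal.ofReal v := (ENNReal.ofReal_toReal hA).symm
  set W := weakNorm f with hW
  have hq : 0 < 1 - p := by linarith
  obtain h0 | hW0 : 0 = W ∨ 0 < W := (weakNorm_nonneg f).eq_or_lt
  · rw [weakNorm_eq_zero h0.symm]
    have e : ∫⁻ x in A, ENNReal.ofReal (|(0 : WeakL1).1 x| ^ p) = ∫⁻ x in A, 0 := by
      refine lintegral_congr_ae (ae_restrict_of_ae ?_)
      filter_upwards [WeakL1.coeFn_zero] with x hx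
      rw [hx, abs_zero, Real.zero_rpow hp.ne', ENNReal.ofReal_zero]
    rw [e, lintegral_zero]
    exact zero_le
  rw [lintegral_rpow_eq_lintegral_meas_lt_mul _ (ae_of_all _ fun x => abs_nonneg _)
    ((AEEqFun.measurable f.1).abs.aemeasurable) hp]
  -- The distribution function on `A` is at most both `v` and `W / t`; the layer-cake integral is
  -- split at the level where these bounds agree.
  set t₀ := W / v with ht₀
  have ht₀0 : 0 < t₀ := div_pos hW0 hv0
  have hsplit : Set.Ioi (0 : ℝ) = Set.Ioc 0 t₀ ∪ Set.Ioi t₀ := (Set.Ioc_union_Ioi_eq_Ioi ht₀0.le).symm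
  have i1 : ∫⁻ t in Set.Ioc 0 t₀, (volume.restrict A) {x | t < |f.1 x|} * ENNReal.ofReal (t ^ (p - 1))
      ≤ ENNReal.ofReal (v * (t₀ ^ p / p)) := by
    calc _ ≤ ∫⁻ t in Set.Ioc 0 t₀, ENNReal.ofReal (v * t ^ (p - 1)) := by
          refine setLIntegral_mono' measurableSet_Ioc fun t ht => ?_
          rw [ENNReal.ofReal_mul hv0.le, ← hvA]
          refine mul_le_mul' ?_ le_rfl
          calc (volume.restrict A) {x | t < |f.1 x|} ≤ (volume.restrict A) Set.univ :=
                measure_mono (Set.subset_univ _)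
            _ = volume A := Measure.restrict_apply_univ A
      _ = ENNReal.ofReal (∫ t in Set.Ioc 0 t₀, v * t ^ (p - 1)) := by
          rw [ofReal_integral_eq_lintegral_ofReal]
          · refine Integrable.const_mul ?_ _
            exact (intervalIntegrable_iff_integrableOn_Ioc_of_le ht₀0.le).1
              (intervalIntegral.intervalIntegrable_rpow' (by linarith))
          · refine (ae_restrict_iff' measurableSet_Ioc).2 (ae_of_all _ fun t ht => ?_)
            exact mul_nonneg hv0.le (Real.rpow_nonneg ht.1.le _)
      _ = _ := by
          rw [integral_const_mul, ← intervalIntegral.integral_of_le ht₀0.le,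
            integral_rpow (Or.inl (by linarith))]
          rw [sub_add_cancel, Real.zero_rpow hp.ne', sub_zero]
  have i2 : ∫⁻ t in Set.Ioi t₀, (volume.restrict A) {x | t < |f.1 x|} * ENNReal.ofReal (t ^ (p - 1))
      ≤ ENNReal.ofReal (W * (t₀ ^ (p - 1) / (1 - p))) := by
    calc _ ≤ ∫⁻ t in Set.Ioi t₀, ENNReal.ofReal (W * t ^ (p - 2)) := by
          refine setLIntegral_mono' measurableSet_Ioi fun t ht => ?_
          have ht0 : 0 < t := ht₀0.trans ht
          have e : W * t ^ (p - 2) = W / t * t ^ (p - 1) := by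
            have : p - 2 = p - 1 - 1 := by ring
            rw [this, Real.rpow_sub_one ht0.ne']
            field_simp
          rw [e, ENNReal.ofReal_mul (by positivity)]
          gcongr
          exact (Measure.restrict_apply_le A _).trans (volume_lt_abs_le f ht0)
      _ = ENNReal.ofReal (∫ t in Set.Ioi t₀, W * t ^ (p - 2)) := by
          rw [ofReal_integral_eq_lintegral_ofReal]
          · exact (integrableOn_Ioi_rpow_of_lt (by linarith) ht₀0).const_mul _
          · refine (ae_restrict_iff' measurableSet_Ioi).2 (ae_of_all _ fun t ht => ?_)
            exact mul_nonneg hW0.le (Real.rpow_nonneg (ht₀0.trans ht).le _)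
      _ = _ := by
          rw [integral_const_mul, integral_Ioi_rpow_of_lt (by linarith) ht₀0]
          have e : p - 2 + 1 = -(1 - p) := by ring
          rw [e, neg_div_neg_eq]
          congr 4
          ring
  rw [hsplit, lintegral_union measurableSet_Ioi (Set.Ioc_disjoint_Ioi le_rfl)]
  refine (mul_le_mul_right (add_le_add i1 i2) _).trans (le_of_eq ?_)
  rw [← ENNReal.ofReal_add (by positivity) (by positivity), ← ENNReal.ofReal_mul hp.le]
  congr 1
  rw [ht₀, Real.div_rpow hW0.le hv0.le, Real.rpow_sub_one (by positivity), Real.rpow_sub hv0,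
    Real.rpow_one, Real.div_rpow hW0.le hv0.le]
  have h1 : v ^ p ≠ 0 := (Real.rpow_pos_of_pos hv0 p).ne'
  field_simp
  ring

theorem locENorm_le {p : ℝ} (hp : 0 < p) (hp1 : p < 1) (f : WeakL1) :
    locENorm p f ≤ ENNReal.ofReal (weakNorm f ^ p / (1 - p)) := by
  refine iSup_le fun A => iSup_le fun _ => iSup_le fun hA0 => iSup_le fun hA => ?_
  have hv0 : 0 < (volume A).toReal := ENNReal.toReal_pos hA0 hA
  have hq : 0 < 1 - p := by linarith
  refine (mul_le_mul_right (setLIntegral_rpow_le hp hp1 f hA0 hA) _).trans (le_of_eq ?_)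
  have e : volume A ^ (p - 1) = ENNReal.ofReal ((volume A).toReal ^ (p - 1)) := by
    rw [← ENNReal.ofReal_rpow_of_pos hv0, ENNReal.ofReal_toReal hA]
  rw [e, ← ENNReal.ofReal_mul (by positivity), ← mul_assoc, ← Real.rpow_add hv0]
  congr 1
  ring_nf
  rw [Real.rpow_zero]
  ring

theorem locENorm_ne_top {p : ℝ} (hp : 0 < p) (hp1 : p < 1) (f : WeakL1) : locENorm p f ≠ ⊤ :=
  ne_top_of_le_ne_top ENNReal.ofReal_ne_top (locENorm_le hp hp1 f)

theorem locNorm_nonneg (p : ℝ) (f : WeakL1) : 0 ≤ locNorm p f :=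
  Real.rpow_nonneg ENNReal.toReal_nonneg _

theorem locNorm_rpow {p : ℝ} (hp : 0 < p) (f : WeakL1) :
    locNorm p f ^ p = (locENorm p f).toReal := by
  rw [locNorm, ← Real.rpow_mul ENNReal.toReal_nonneg, one_div_mul_cancel hp.ne', Real.rpow_one]

theorem locNorm_le {p : ℝ} (hp : 0 < p) (hp1 : p < 1) (f : WeakL1) :
    locNorm p f ≤ (1 / (1 - p)) ^ (1 / p) * weakNorm f := by
  have hq : 0 < 1 - p := by linarith
  have hW := weakNorm_nonneg f
  have h1 : (locENorm p f).toReal ≤ 1 / (1 - p) * weakNorm f ^ p := by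
    refine (ENNReal.toReal_le_of_le_ofReal (by positivity) (locENorm_le hp hp1 f)).trans
      (le_of_eq (by ring))
  refine (Real.rpow_le_rpow ENNReal.toReal_nonneg h1 (by positivity)).trans (le_of_eq ?_)
  rw [Real.mul_rpow (by positivity) (by positivity), ← Real.rpow_mul hW,
    mul_one_div_cancel hp.ne', Real.rpow_one]

/-- Testing the supremum on `A = {|f| > t}` gives at least `(t * |A|) ^ p`. -/
theorem weakNorm_le_locNorm {p : ℝ} (hp : 0 < p) (hp1 : p < 1) (f : WeakL1) :
    weakNorm f ≤ locNorm p f := by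
  refine weakNorm_le (locNorm_nonneg p f) fun t ht => ?_
  set A := {x | t < |f.1 x|} with hAdef
  have hAm : MeasurableSet A := measurableSet_lt measurable_const (AEEqFun.measurable f.1).abs
  have hA : volume A ≠ ⊤ := ne_top_of_le_ne_top ENNReal.ofReal_ne_top (volume_lt_abs_le f ht)
  by_cases hA0 : volume A = 0
  · rw [hA0]
    exact zero_le
  set v := (volume A).toReal with hv
  have hv0 : 0 < v := ENNReal.toReal_pos hA0 hA
  have hvA : volume A = ENNReal.ofReal v := (ENNReal.ofReal_toReal hA).symm
  have h1 : ENNReal.ofReal ((t * v) ^ p) ≤ locENorm p f := by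
    have h2 : volume A ^ (p - 1) * ∫⁻ x in A, ENNReal.ofReal (|f.1 x| ^ p) ≤ locENorm p f :=
      le_iSup_of_le A (le_iSup_of_le hAm (le_iSup_of_le hA0 (le_iSup_of_le hA le_rfl)))
    refine le_trans ?_ h2
    have h3 : ∫⁻ _ in A, ENNReal.ofReal (t ^ p) ≤ ∫⁻ x in A, ENNReal.ofReal (|f.1 x| ^ p) := by
      refine setLIntegral_mono' hAm fun x hx => ENNReal.ofReal_le_ofReal ?_
      exact Real.rpow_le_rpow ht.le (le_of_lt hx) hp.le
    rw [setLIntegral_const] at h3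
    refine le_trans (le_of_eq ?_) (mul_le_mul_right h3 _)
    rw [hvA, ENNReal.ofReal_rpow_of_pos hv0, ← ENNReal.ofReal_mul (by positivity),
      ← ENNReal.ofReal_mul (by positivity), Real.rpow_sub_one hv0.ne',
      Real.mul_rpow ht.le hv0.le]
    congr 1
    field_simp
  have h4 := ENNReal.toReal_mono (locENorm_ne_top hp hp1 f) h1
  rw [ENNReal.toReal_ofReal (by positivity)] at h4
  have h5 : t * v ≤ locNorm p f := by
    have := Real.rpow_le_rpow (by positivity) h4 (show 0 ≤ 1 / p by positivity)
    rwa [← Real.rpow_mul (by positivity), mul_one_div_cancel hp.ne', Real.rpow_one] at this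
  rw [hvA]
  refine ENNReal.ofReal_le_ofReal ?_
  rw [le_div_iff₀ ht]
  linarith

theorem locENorm_le_sum {p : ℝ} {ι : Type} (s : Finset ι) (x : ι → WeakL1) {z : WeakL1}
    (h : ∀ᵐ t, |z.1 t| ^ p ≤ ∑ k ∈ s, |(x k).1 t| ^ p) :
    locENorm p z ≤ ∑ k ∈ s, locENorm p (x k) := by
  refine iSup_le fun A => iSup_le fun hAm => iSup_le fun hA0 => iSup_le fun hA => ?_
  have h1 : ∫⁻ t in A, ENNReal.ofReal (|z.1 t| ^ p) ≤
      ∑ k ∈ s, ∫⁻ t in A, ENNReal.ofReal (|(x k).1 t| ^ p) := by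
    rw [← lintegral_finsetSum]
    · refine lintegral_mono_ae (ae_restrict_of_ae ?_)
      filter_upwards [h] with t ht
      rw [← ENNReal.ofReal_sum_of_nonneg fun k _ => Real.rpow_nonneg (abs_nonneg _) _]
      exact ENNReal.ofReal_le_ofReal ht
    · intro k _
      exact ((AEEqFun.measurable (x k).1).abs.pow_const p).ennreal_ofReal
  refine (mul_le_mul_right h1 _).trans ?_
  rw [Finset.mul_sum]
  refine Finset.sum_le_sum fun k _ => ?_
  exact le_iSup_of_le A (le_iSup_of_le hAm (le_iSup_of_le hA0 (le_iSup_of_le hA le_rfl)))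

theorem locNorm_rpow_le_sum {p : ℝ} (hp : 0 < p) (hp1 : p < 1) {ι : Type} (s : Finset ι)
    (x : ι → WeakL1) {z : WeakL1} (h : ∀ᵐ t, |z.1 t| ^ p ≤ ∑ k ∈ s, |(x k).1 t| ^ p) :
    locNorm p z ^ p ≤ ∑ k ∈ s, locNorm p (x k) ^ p := by
  simp only [locNorm_rpow hp]
  rw [← ENNReal.toReal_sum fun k _ => locENorm_ne_top hp hp1 _]
  exact ENNReal.toReal_mono (ENNReal.sum_ne_top.2 fun k _ => locENorm_ne_top hp hp1 _)
    (locENorm_le_sum s x h)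

theorem locNorm_smul {p : ℝ} (hp : 0 < p) (c : ℝ) (f : WeakL1) :
    locNorm p (c • f) = |c| * locNorm p f := by
  have h1 : locENorm p (c • f) = ENNReal.ofReal (|c| ^ p) * locENorm p f := by
    unfold locENorm
    simp only [ENNReal.mul_iSup]
    refine iSup_congr fun A => iSup_congr fun _ => iSup_congr fun _ => iSup_congr fun _ => ?_
    have e : ∫⁻ x in A, ENNReal.ofReal (|(c • f).1 x| ^ p)
        = ENNReal.ofReal (|c| ^ p) * ∫⁻ x in A, ENNReal.ofReal (|f.1 x| ^ p) := by
      rw [← lintegral_const_mul' _ _ ENNReal.ofReal_ne_top]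
      refine lintegral_congr_ae (ae_restrict_of_ae ?_)
      filter_upwards [WeakL1.coeFn_smul c f] with x hx
      rw [hx, abs_mul, Real.mul_rpow (abs_nonneg _) (abs_nonneg _),
        ENNReal.ofReal_mul (Real.rpow_nonneg (abs_nonneg _) _)]
    rw [e]
    ring
  rw [locNorm, h1, ENNReal.toReal_mul, ENNReal.toReal_ofReal (Real.rpow_nonneg (abs_nonneg _) _),
    Real.mul_rpow (Real.rpow_nonneg (abs_nonneg _) _) ENNReal.toReal_nonneg,
    ← Real.rpow_mul (abs_nonneg _), mul_one_div_cancel hp.ne', Real.rpow_one, locNorm]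

theorem isPBanachLattice_locNorm {p : ℝ} (hp : 0 < p) (hp1 : p < 1) :
    IsPBanachLattice p (locNorm p) where
  nonneg := locNorm_nonneg p
  eq_zero := fun f hf => weakNorm_eq_zero
    (le_antisymm ((weakNorm_le_locNorm hp hp1 f).trans hf.le) (weakNorm_nonneg f))
  smul := locNorm_smul hp
  add_le := by
    obtain ⟨D, hD, hadd⟩ := isQuasiBanachLattice_weakNorm.add_le
    set K := (1 / (1 - p)) ^ (1 / p) with hK
    have hq : 0 < 1 - p := by linarith
    have hK1 : 1 ≤ K := Real.one_le_rpow (by rw [le_div_iff₀ hq]; linarith) (by positivity)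
    refine ⟨K * D, by nlinarith, fun f g => ?_⟩
    calc locNorm p (f + g) ≤ K * weakNorm (f + g) := locNorm_le hp hp1 _
      _ ≤ K * (D * (weakNorm f + weakNorm g)) := by
          gcongr
          exact hadd f g
      _ ≤ K * (D * (locNorm p f + locNorm p g)) := by
          gcongr
          · exact weakNorm_le_locNorm hp hp1 f
          · exact weakNorm_le_locNorm hp hp1 g
      _ = _ := by ring
  complete := by
    intro u hu
    obtain ⟨f, hf⟩ := exists_weakL1_limit u fun ε hε => by
      obtain ⟨n₀, h⟩ := hu ε hε
      exact ⟨n₀, fun m n hm hn => (weakNorm_le_locNorm hp hp1 _).trans_lt (h m n hm hn)⟩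
    refine ⟨f, ?_⟩
    have h := hf.const_mul ((1 / (1 - p)) ^ (1 / p))
    rw [mul_zero] at h
    exact squeeze_zero (fun n => locNorm_nonneg p _) (fun n => locNorm_le hp hp1 _) h
  add_mono := isQuasiBanachLattice_weakNorm.add_mono
  smul_mono := isQuasiBanachLattice_weakNorm.smul_mono
  solid := by
    intro f g hfg
    rw [WeakL1.coeFn_le] at hfg
    have h := locNorm_rpow_le_sum hp hp1 {()} (fun _ : Unit => g) (z := f) (by
      filter_upwards [hfg, WeakL1.coeFn_abs f, WeakL1.coeFn_abs g] with x h1 h2 h3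
      rw [h2, h3] at h1
      simpa using Real.rpow_le_rpow (abs_nonneg _) h1 hp.le)
    rw [Finset.sum_singleton] at h
    exact (Real.rpow_le_rpow_iff (locNorm_nonneg p f) (locNorm_nonneg p g) hp).1 h
  p_add_le := by
    intro f g
    have h := locNorm_rpow_le_sum hp hp1 Finset.univ (fun b : Bool => if b then f else g)
      (z := f + g) (by
        filter_upwards [WeakL1.coeFn_add f g] with x hx
        rw [hx]
        simp only [Fintype.sum_bool, if_true, Bool.false_eq_true, if_false]
        exact (Real.rpow_le_rpow (abs_nonneg _) (abs_add_le _ _) hp.le).trans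
          (Real.rpow_add_le_add_rpow (abs_nonneg _) (abs_nonneg _) hp.le hp1.le))
    simpa using h

/-- Each linear majorant gives an inequality off its own null set. A countable dense set of
majorants leaves one common null set, and continuity in the coefficients recovers all majorants
pointwise, whose infimum is the scalar `p`-sum. -/
theorem IsPSum.ae_rpow_le {p : ℝ} (hp : 0 < p) (hp1 : p ≤ 1) {n : ℕ} {x : Fin n → WeakL1}
    {z : WeakL1} (hz : IsPSum p x z) : ∀ᵐ t, |z.1 t| ^ p ≤ ∑ k, |(x k).1 t| ^ p := by
  obtain ⟨D, hDc, hDd⟩ := TopologicalSpace.exists_countable_dense (linearMajorants p n)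
  have := hDc.to_subtype
  have h1 : ∀ᵐ t, ∀ a : D, z.1 t ≤ ∑ k, a.1.1 k * |(x k).1 t| := by
    rw [ae_all_iff]
    intro a
    have h2 := hz.1 ⟨a.1.1, a.1.2, rfl⟩
    rw [WeakL1.coeFn_le] at h2
    have h3 : ∀ᵐ t, ∀ k, (a.1.1 k • |x k|).1 t = a.1.1 k * |(x k).1 t| := by
      rw [ae_all_iff]
      intro k
      filter_upwards [WeakL1.coeFn_smul (a.1.1 k) |x k|, WeakL1.coeFn_abs (x k)] with t h4 h5
      rw [h4, h5]
    filter_upwards [h2, WeakL1.coeFn_sum Finset.univ fun k => a.1.1 k • |x k|, h3]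
      with t h4 h5 h6
    rw [h5] at h4
    simpa only [h6] using h4
  have h0 := hz.nonneg isQuasiBanachLattice_weakNorm hp
  rw [WeakL1.coeFn_le] at h0
  filter_upwards [h1, h0, WeakL1.coeFn_zero] with t ht h0t hzt
  rw [hzt] at h0t
  have hclosed : IsClosed {a : linearMajorants p n | z.1 t ≤ ∑ k, a.1 k * |(x k).1 t|} := by
    refine isClosed_le continuous_const (continuous_finsetSum _ fun k _ => ?_)
    exact ((continuous_apply k).comp continuous_subtype_val).mul continuous_const
  have hall : ∀ a ∈ linearMajorants p n, z.1 t ≤ ∑ k, a k * |(x k).1 t| := by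
    intro a ha
    have : closure D ⊆ {a : linearMajorants p n | z.1 t ≤ ∑ k, a.1 k * |(x k).1 t|} :=
      closure_minimal (fun b hb => ht ⟨b, hb⟩) hclosed
    exact this (hDd ⟨a, ha⟩)
  have h7 := le_of_forall_linearMajorants hp hp1 (fun k => abs_nonneg ((x k).1 t)) hall
  have hS : 0 ≤ ∑ k, |(x k).1 t| ^ p :=
    Finset.sum_nonneg fun k _ => Real.rpow_nonneg (abs_nonneg _) _
  rw [abs_of_nonneg h0t]
  refine (Real.rpow_le_rpow h0t h7 hp.le).trans (le_of_eq ?_)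
  rw [← Real.rpow_mul hS, one_div_mul_cancel hp.ne', Real.rpow_one]

theorem pConvexWith_locNorm {p : ℝ} (hp : 0 < p) (hp1 : p < 1) : PConvexWith p (locNorm p) 1 := by
  refine ⟨one_pos, fun n x z hz => ?_⟩
  have h := locNorm_rpow_le_sum hp hp1 Finset.univ x (hz.ae_rpow_le hp hp1.le)
  have h1 := Real.rpow_le_rpow (Real.rpow_nonneg (locNorm_nonneg p z) p) h
    (show 0 ≤ 1 / p by positivity)
  rwa [← Real.rpow_mul (locNorm_nonneg p z), mul_one_div_cancel hp.ne', Real.rpow_one,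
    ← one_mul ((∑ k, locNorm p (x k) ^ p) ^ (1 / p))] at h1

/-- Convexity constant one for the equivalent `p`-norm transfers to the weak quasi-norm at the cost
of the equivalence constant. -/
theorem isPConvex_weakNorm {p : ℝ} (hp : 0 < p) (hp1 : p < 1) : IsPConvex p weakNorm := by
  have hq : 0 < 1 - p := by linarith
  set K := (1 / (1 - p)) ^ (1 / p) with hK
  have hK0 : 0 < K := by positivity
  refine ⟨K, hK0, fun n x z hz => ?_⟩
  have h := (pConvexWith_locNorm hp hp1).2 n x z hz
  rw [one_mul] at h
  refine (weakNorm_le_locNorm hp hp1 z).trans (h.trans ?_)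
  have h1 : ∑ k, locNorm p (x k) ^ p ≤ K ^ p * ∑ k, weakNorm (x k) ^ p := by
    rw [Finset.mul_sum]
    refine Finset.sum_le_sum fun k _ => ?_
    rw [← Real.mul_rpow hK0.le (weakNorm_nonneg _)]
    exact Real.rpow_le_rpow (locNorm_nonneg p _) (locNorm_le hp hp1 _) hp.le
  have hS : 0 ≤ ∑ k, weakNorm (x k) ^ p :=
    Finset.sum_nonneg fun k _ => Real.rpow_nonneg (weakNorm_nonneg _) _
  refine (Real.rpow_le_rpow (Finset.sum_nonneg fun k _ => Real.rpow_nonneg (locNorm_nonneg p _) _)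
    h1 (by positivity)).trans (le_of_eq ?_)
  rw [Real.mul_rpow (by positivity) hS, ← Real.rpow_mul hK0.le, mul_one_div_cancel hp.ne',
    Real.rpow_one]

/-! ### The Hilbert transform and its logarithmic growth on indicators. -/

theorem IsHilbertValue.unique {f : ℝ → ℝ} {x y z : ℝ} (hy : IsHilbertValue f x y)
    (hz : IsHilbertValue f x z) : y = z :=
  tendsto_nhds_unique hy hz

theorem integrable_L1 (f : L1) : Integrable (f : ℝ → ℝ) := L1.integrable_coeFn f

theorem exists_hilbertTransform (f : L1) :
    ∃ h : WeakL1, (∀ᵐ x, IsHilbertValue f x (h.1 x)) ∧ weakNorm h ≤ 160 * ‖f‖ := by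
  have hf := integrable_L1 f
  let ε : ℕ → ℝ := fun n => 1 / ((n : ℝ) + 1)
  have hε0 : ∀ n, 0 < ε n := fun n => by positivity
  have hε : Tendsto ε atTop (𝓝[>] 0) :=
    tendsto_nhdsWithin_iff.2 ⟨tendsto_one_div_add_atTop_nhds_zero_nat, Eventually.of_forall hε0⟩
  have hex := ae_exists_isHilbertValue hf
  -- The radii `1 / (n + 1)` give a sequence of measurable functions, hence a measurable limit; it
  -- equals the principal value wherever the latter exists.
  obtain ⟨g, hgm, hg⟩ := measurable_limit_of_tendsto_metrizable_ae
    (f := fun n x => truncHilbert f (ε n) x) (μ := volume)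
    (fun n => (stronglyMeasurable_truncHilbert (Lp.stronglyMeasurable f) (ε n)).measurable.aemeasurable)
    (L := atTop) (by
      filter_upwards [hex] with x ⟨y, hy⟩
      exact ⟨y, (isHilbertValue_iff.1 hy).comp hε⟩)
  let h : ℝ →ₘ[volume] ℝ := AEEqFun.mk g hgm.aestronglyMeasurable
  have hval : ∀ᵐ x, IsHilbertValue f x (h x) := by
    filter_upwards [hex, hg, AEEqFun.coeFn_mk g hgm.aestronglyMeasurable] with x ⟨y, hy⟩ h1 h2
    have h3 := tendsto_nhds_unique h1 ((isHilbertValue_iff.1 hy).comp hε)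
    rw [h2, h3]
    exact hy
  have hbound : ∀ t > 0, volume {x | t < |h x|} ≤ ENNReal.ofReal (160 * ‖f‖ / t) := by
    intro t ht
    have h1 : volume {x | t < |h x|} ≤ volume {x | ∃ ε > 0, t < |truncHilbert f ε x|} := by
      refine measure_mono_ae ?_
      filter_upwards [hval] with x hx hxt
      have h2 := (isHilbertValue_iff.1 hx).abs.eventually_const_lt hxt
      obtain ⟨ε, h3, h4⟩ := (h2.and self_mem_nhdsWithin).exists
      exact ⟨ε, h4, h3⟩
    refine h1.trans ((volume_maximal_truncHilbert_le hf ht).trans (le_of_eq ?_))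
    have h2 : ∫ t, |(f : ℝ → ℝ) t| = ‖f‖ := (L1.norm_eq_integral_norm f).symm
    rw [h2, mul_div_assoc, ENNReal.ofReal_mul (by norm_num), ENNReal.ofReal_ofNat]
  have hfin : weakENorm h < ⊤ := (weakENorm_le_ofReal hbound).trans_lt ENNReal.ofReal_lt_top
  exact ⟨⟨h, hfin⟩, hval, weakNorm_le (by positivity) hbound⟩

/-- The Hilbert transform from `L_1(ℝ)` to `L_{1,∞}(ℝ)`. -/
noncomputable def hilbertTransform : L1 →ₗ[ℝ] WeakL1 where
  toFun f := (exists_hilbertTransform f).choose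
  map_add' f g := by
    refine WeakL1.ext ?_
    filter_upwards [(exists_hilbertTransform f).choose_spec.1,
      (exists_hilbertTransform g).choose_spec.1, (exists_hilbertTransform (f + g)).choose_spec.1,
      WeakL1.coeFn_add (exists_hilbertTransform f).choose (exists_hilbertTransform g).choose]
      with x h1 h2 h3 h4
    rw [h4]
    refine h3.unique ?_
    rw [isHilbertValue_iff] at *
    refine (h1.add h2).congr' ?_
    filter_upwards [self_mem_nhdsWithin] with ε hε
    rw [← truncHilbert_add (integrable_L1 f) (integrable_L1 g) hε]
    exact truncHilbert_congr (Lp.coeFn_add f g).symm ε x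
  map_smul' c f := by
    refine WeakL1.ext ?_
    filter_upwards [(exists_hilbertTransform f).choose_spec.1,
      (exists_hilbertTransform (c • f)).choose_spec.1,
      WeakL1.coeFn_smul c (exists_hilbertTransform f).choose] with x h1 h2 h3
    rw [RingHom.id_apply, h3]
    refine h2.unique ?_
    rw [isHilbertValue_iff] at *
    refine (h1.const_mul c).congr' ?_
    filter_upwards [self_mem_nhdsWithin] with ε hε
    rw [← truncHilbert_const_mul]
    exact truncHilbert_congr (Lp.coeFn_smul c f).symm ε x

theorem hilbertTransform_spec (f : L1) :
    ∀ᵐ x, IsHilbertValue f x ((hilbertTransform f).1 x) :=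
  (exists_hilbertTransform f).choose_spec.1

theorem weakNorm_hilbertTransform_le (f : L1) : weakNorm (hilbertTransform f) ≤ 160 * ‖f‖ :=
  (exists_hilbertTransform f).choose_spec.2

theorem isHilbertValue_indicatorL1 {a b x : ℝ} (hab : a ≤ b) (hx : b < x) :
    IsHilbertValue (indicatorL1 a b) x (Real.log (x - a) - Real.log (x - b)) := by
  rw [isHilbertValue_iff]
  refine tendsto_const_nhds.congr' ?_
  filter_upwards [Ioo_mem_nhdsGT (show 0 < x - b by linarith)] with ε hε
  have hco : (indicatorL1 a b : ℝ → ℝ) =ᵐ[volume] (Set.Icc a b).indicator fun _ => 1 :=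
    indicatorConstLp_coeFn
  rw [truncHilbert_congr hco]
  have e : ∀ t, (Set.Icc a b).indicator (fun _ => (1 : ℝ)) t * truncKernel ε (x - t)
      = (Set.Icc a b).indicator (fun t => (x - t)⁻¹) t := by
    intro t
    by_cases ht : t ∈ Set.Icc a b
    · rw [Set.indicator_of_mem ht, Set.indicator_of_mem ht, one_mul, truncKernel, if_pos]
      rw [abs_of_pos (by linarith [ht.2])]
      linarith [ht.2, hε.2]
    · rw [Set.indicator_of_notMem ht, Set.indicator_of_notMem ht, zero_mul]
  unfold truncHilbert
  simp only [e]
  rw [integral_indicator measurableSet_Icc, integral_Icc_eq_integral_Ioc,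
    ← intervalIntegral.integral_of_le hab, intervalIntegral.integral_comp_sub_left (fun u => u⁻¹),
    integral_inv_of_pos (by linarith) (by linarith), Real.log_div (by linarith) (by linarith)]

theorem log_le_sum_abs_hilbertTransform {n : ℕ} (hn : 0 < n) :
    ∀ᵐ x : ℝ, x ∈ Set.Ioo (1 / 2 : ℝ) 1 → Real.log (n / 2) ≤
      ∑ k ∈ Finset.range n, |(hilbertTransform (indicatorL1 ((k : ℝ) / n) (((k : ℝ) + 1) / n))).1 x| := by
  have hn0 : (0 : ℝ) < n := by exact_mod_cast hn
  have hall : ∀ᵐ x : ℝ, ∀ k : ℕ, IsHilbertValue (indicatorL1 ((k : ℝ) / n) (((k : ℝ) + 1) / n)) x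
      ((hilbertTransform (indicatorL1 ((k : ℝ) / n) (((k : ℝ) + 1) / n))).1 x) :=
    ae_all_iff.2 fun k => hilbertTransform_spec _
  filter_upwards [hall] with x hx hxI
  have hx0 : 0 < x := by linarith [hxI.1]
  have hnx : 0 < n * x := by positivity
  -- With `m = ⌈n x⌉ - 1` one has `m / n < x ≤ (m + 1) / n`, so the intervals with `k < m` end
  -- strictly to the left of `x`. Their values telescope to `log x - log (x - m / n)`, where `x - m
  -- / n ≤ 1 / n`.
  obtain ⟨m, hm⟩ : ∃ m, ⌈n * x⌉₊ = m + 1 :=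
    Nat.exists_eq_succ_of_ne_zero (Nat.ceil_pos.2 hnx).ne'
  have h1 : (m : ℝ) < n * x := by
    have := Nat.ceil_lt_add_one hnx.le
    rw [hm] at this
    push_cast at this
    linarith
  have h2 : n * x ≤ m + 1 := by
    have := Nat.le_ceil (n * x)
    rw [hm] at this
    exact_mod_cast this
  have h3 : m < n := by
    have : (m : ℝ) < n := h1.trans_le (by nlinarith [hxI.2])
    exact_mod_cast this
  have hlt : ∀ k : ℕ, k ≤ m → (k : ℝ) / n < x := by
    intro k hk
    rw [div_lt_iff₀ hn0]
    have : (k : ℝ) ≤ m := by exact_mod_cast hk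
    linarith
  have hval : ∀ k ∈ Finset.range m,
      (hilbertTransform (indicatorL1 ((k : ℝ) / n) (((k : ℝ) + 1) / n))).1 x
        = Real.log (x - (k : ℝ) / n) - Real.log (x - ((k + 1 : ℕ) : ℝ) / n) := by
    intro k hk
    have h4 := hlt (k + 1) (Finset.mem_range.1 hk)
    push_cast at h4 ⊢
    refine (hx k).unique (isHilbertValue_indicatorL1 ?_ h4)
    gcongr
    linarith
  have h5 : 0 < x - (m : ℝ) / n := by linarith [hlt m le_rfl]
  have h6 : x - (m : ℝ) / n ≤ 1 / n := by
    rw [le_div_iff₀ hn0, sub_mul, div_mul_cancel₀ _ hn0.ne']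
    linarith
  calc Real.log (n / 2) ≤ Real.log (n * x) :=
        Real.log_le_log (by positivity) (by nlinarith [hxI.1])
    _ = Real.log x - Real.log (1 / n) := by
        rw [Real.log_mul hn0.ne' hx0.ne', one_div, Real.log_inv]
        ring
    _ ≤ Real.log x - Real.log (x - (m : ℝ) / n) := by
        have := Real.log_le_log h5 h6
        linarith
    _ = ∑ k ∈ Finset.range m, (hilbertTransform (indicatorL1 ((k : ℝ) / n) (((k : ℝ) + 1) / n))).1 x := by
        rw [Finset.sum_congr rfl hval,
          Finset.sum_range_sub' (fun k : ℕ => Real.log (x - (k : ℝ) / n)) m]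
        simp
    _ ≤ ∑ k ∈ Finset.range m, |(hilbertTransform (indicatorL1 ((k : ℝ) / n) (((k : ℝ) + 1) / n))).1 x| :=
        Finset.sum_le_sum fun k _ => le_abs_self _
    _ ≤ _ := Finset.sum_le_sum_of_subset_of_nonneg (Finset.range_mono h3.le)
        fun k _ _ => abs_nonneg _

theorem tendsto_weakNorm_sum_abs_hilbertTransform :
    Tendsto (fun n : ℕ => weakNorm (∑ k ∈ Finset.range n,
      |hilbertTransform (indicatorL1 ((k : ℝ) / n) (((k : ℝ) + 1) / n))|)) atTop atTop := by
  have hlog : Tendsto (fun n : ℕ => Real.log ((n : ℝ) / 2)) atTop atTop :=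
    Real.tendsto_log_atTop.comp (tendsto_natCast_atTop_atTop.atTop_div_const (by norm_num))
  have hlim : Tendsto (fun n : ℕ => (Real.log ((n : ℝ) / 2) - 1) / 2) atTop atTop :=
    (tendsto_atTop_add_const_right _ (-1) hlog).atTop_div_const (by norm_num)
  refine tendsto_atTop_mono' _ ?_ hlim
  filter_upwards [hlog.eventually_gt_atTop 1, eventually_gt_atTop 0] with n hn hn0
  set F := ∑ k ∈ Finset.range n,
    |hilbertTransform (indicatorL1 ((k : ℝ) / n) (((k : ℝ) + 1) / n))| with hF
  have hF' : ∀ᵐ x, F.1 x = ∑ k ∈ Finset.range n,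
      |(hilbertTransform (indicatorL1 ((k : ℝ) / n) (((k : ℝ) + 1) / n))).1 x| := by
    have h1 : ∀ᵐ x, ∀ k : ℕ, (|hilbertTransform (indicatorL1 ((k : ℝ) / n) (((k : ℝ) + 1) / n))|).1 x
        = |(hilbertTransform (indicatorL1 ((k : ℝ) / n) (((k : ℝ) + 1) / n))).1 x| :=
      ae_all_iff.2 fun k => WeakL1.coeFn_abs _
    filter_upwards [h1, WeakL1.coeFn_sum (Finset.range n) fun k : ℕ =>
      |hilbertTransform (indicatorL1 ((k : ℝ) / n) (((k : ℝ) + 1) / n))|] with x h2 h3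
    rw [hF, h3]
    exact Finset.sum_congr rfl fun k _ => h2 k
  -- Subtracting one makes the level strictly exceeded on all of `(1/2, 1)`, up to a null set; this
  -- interval has length `1/2`.
  set t := Real.log ((n : ℝ) / 2) - 1 with ht
  have ht0 : 0 < t := by linarith
  have h1 : volume (Set.Ioo (1 / 2 : ℝ) 1) ≤ volume {x | t < |F.1 x|} := by
    refine measure_mono_ae ?_
    filter_upwards [hF', log_le_sum_abs_hilbertTransform hn0] with x h2 h3 hxI
    have h4 := h3 hxI
    change t < |F.1 x|
    rw [← h2] at h4
    linarith [le_abs_self (F.1 x)]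
  have h2 := h1.trans (volume_lt_abs_le F ht0)
  rw [Real.volume_Ioo, ENNReal.ofReal_le_ofReal_iff (div_nonneg (weakNorm_nonneg F) ht0.le),
    le_div_iff₀ ht0] at h2
  linarith

/-! ### `FBL[E]` is a Banach lattice. -/

section FreeBanachLattice

variable {E : Type} [NormedAddCommGroup E] [NormedSpace ℝ E]

theorem sum_abs_apply_le_norm {n : ℕ} {φ : Fin n → StrongDual ℝ E}
    (hφ : ∀ x : E, ‖x‖ ≤ 1 → ∑ i, |φ i x| ≤ 1) (x : E) : ∑ i, |φ i x| ≤ ‖x‖ := by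
  rcases eq_or_ne x 0 with rfl | hx
  · simp
  have hx0 : 0 < ‖x‖ := norm_pos_iff.2 hx
  have h := hφ (‖x‖⁻¹ • x) (by rw [norm_smul, norm_inv, norm_norm, inv_mul_cancel₀ hx0.ne'])
  simp only [map_smul, smul_eq_mul, abs_mul, abs_inv, abs_norm] at h
  rw [← Finset.mul_sum, inv_mul_le_iff₀ hx0, mul_one] at h
  exact h

theorem fblENorm_delta_le (x : E) : fblENorm E (fun φ => φ x) ≤ ENNReal.ofReal ‖x‖ := by
  refine iSup_le fun n => iSup_le fun φ => iSup_le fun hφ => ?_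
  rw [← ENNReal.ofReal_sum_of_nonneg fun i _ => abs_nonneg _]
  exact ENNReal.ofReal_le_ofReal (sum_abs_apply_le_norm hφ x)

theorem InLat.fblENorm_ne_top {f : StrongDual ℝ E → ℝ} (hf : InLat E f) : fblENorm E f ≠ ⊤ := by
  induction hf with
  | delta x => exact ne_top_of_le_ne_top ENNReal.ofReal_ne_top (fblENorm_delta_le x)
  | add _ _ h1 h2 =>
    exact ne_top_of_le_ne_top (ENNReal.add_ne_top.2 ⟨h1, h2⟩)
      (fblENorm_le_add fun φ => abs_add_le _ _)
  | smul c _ h =>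
    exact ne_top_of_le_ne_top (ENNReal.mul_ne_top ENNReal.ofReal_ne_top h) (fblENorm_smul_le c _)
  | sup _ _ h1 h2 =>
    exact ne_top_of_le_ne_top (ENNReal.add_ne_top.2 ⟨h1, h2⟩) (fblENorm_le_add fun φ =>
      abs_max_le_max_abs_abs.trans (max_le_add_of_nonneg (abs_nonneg _) (abs_nonneg _)))

theorem InFBL.fblENorm_ne_top {f : StrongDual ℝ E → ℝ} (hf : InFBL E f) : fblENorm E f ≠ ⊤ := by
  obtain ⟨g, hg, h⟩ := hf.2 1 one_pos
  refine ne_top_of_le_ne_top (ENNReal.add_ne_top.2 ⟨ne_top_of_lt h, hg.fblENorm_ne_top⟩)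
    (fblENorm_le_add (g := f - g) (h := g) fun φ => ?_)
  have : f φ = (f - g) φ + g φ := by simp
  rw [this]
  exact abs_add_le _ _

theorem ofReal_fblNorm (f : FBL E) : ENNReal.ofReal (fblNorm E f) = fblENorm E f :=
  ENNReal.ofReal_toReal f.2.fblENorm_ne_top

theorem fblNorm_nonneg (f : FBL E) : 0 ≤ fblNorm E f := ENNReal.toReal_nonneg

theorem fblNorm_delta_le (x : E) : fblNorm E (fblDelta E x) ≤ ‖x‖ :=
  ENNReal.toReal_le_of_le_ofReal (norm_nonneg _) (fblENorm_delta_le x)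

theorem sum_abs_apply_le_fblNorm (f : FBL E) {n : ℕ} {φ : Fin n → StrongDual ℝ E}
    (hφ : ∀ x : E, ‖x‖ ≤ 1 → ∑ i, |φ i x| ≤ 1) : ∑ i, |f.1 (φ i)| ≤ fblNorm E f := by
  rw [← ENNReal.ofReal_le_ofReal_iff (fblNorm_nonneg f), ofReal_fblNorm,
    ENNReal.ofReal_sum_of_nonneg fun i _ => abs_nonneg _]
  exact le_iSup_of_le n (le_iSup_of_le φ (le_iSup_of_le hφ le_rfl))

theorem FBL.apply_smul (f : FBL E) {c : ℝ} (hc : 0 ≤ c) (φ : StrongDual ℝ E) :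
    f.1 (c • φ) = c * f.1 φ :=
  f.2.1 c φ hc

/-- The single functional `φ / ‖φ‖` is admissible in the norm. Evaluations are therefore continuous,
which gives definiteness of the norm and pointwise limits of Cauchy sequences. -/
theorem FBL.abs_apply_le (f : FBL E) (φ : StrongDual ℝ E) :
    |f.1 φ| ≤ ‖φ‖ * fblNorm E f := by
  rcases eq_or_ne φ 0 with rfl | hφ
  · have := FBL.apply_smul f le_rfl (0 : StrongDual ℝ E)
    rw [zero_smul, zero_mul] at this
    simp [this]
  have hφ0 : 0 < ‖φ‖ := norm_pos_iff.2 hφ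
  have h := sum_abs_apply_le_fblNorm f (φ := fun _ : Fin 1 => ‖φ‖⁻¹ • φ) fun x hx => by
    simp only [Finset.univ_unique, Finset.sum_singleton]
    have h1 : |(‖φ‖⁻¹ • φ) x| = ‖φ‖⁻¹ * ‖φ x‖ := by
      rw [_root_.smul_apply, smul_eq_mul, abs_mul, abs_inv, abs_norm, Real.norm_eq_abs]
    rw [h1, inv_mul_le_iff₀ hφ0, mul_one]
    exact (φ.le_opNorm x).trans (mul_le_of_le_one_right hφ0.le hx)
  simp only [Finset.univ_unique, Finset.sum_singleton] at h
  rw [FBL.apply_smul f (inv_nonneg.2 hφ0.le), abs_mul, abs_inv, abs_norm, inv_mul_le_iff₀ hφ0] at h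
  exact h

theorem FBL.le_iff {f g : FBL E} : f ≤ g ↔ ∀ φ, f.1 φ ≤ g.1 φ := Iff.rfl

theorem FBL.abs_apply (f : FBL E) (φ : StrongDual ℝ E) : (|f|).1 φ = |f.1 φ| := rfl

theorem fblNorm_add_le (f g : FBL E) : fblNorm E (f + g) ≤ fblNorm E f + fblNorm E g := by
  refine ENNReal.toReal_le_of_le_ofReal (add_nonneg (fblNorm_nonneg f) (fblNorm_nonneg g)) ?_
  rw [ENNReal.ofReal_add (fblNorm_nonneg f) (fblNorm_nonneg g), ofReal_fblNorm, ofReal_fblNorm]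
  exact fblENorm_le_add fun φ => abs_add_le _ _

theorem fblNorm_smul (c : ℝ) (f : FBL E) : fblNorm E (c • f) = |c| * fblNorm E f := by
  have key : ∀ (c : ℝ) (f : FBL E), fblNorm E (c • f) ≤ |c| * fblNorm E f := by
    intro c f
    refine ENNReal.toReal_le_of_le_ofReal (mul_nonneg (abs_nonneg _) (fblNorm_nonneg f)) ?_
    rw [ENNReal.ofReal_mul (abs_nonneg _), ofReal_fblNorm]
    exact fblENorm_smul_le c _
  refine le_antisymm (key c f) ?_
  rcases eq_or_ne c 0 with rfl | hc
  · simpa using fblNorm_nonneg _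
  · have h := key c⁻¹ (c • f)
    rw [smul_smul, inv_mul_cancel₀ hc, one_smul, abs_inv] at h
    have hc' : 0 < |c| := abs_pos.2 hc
    rwa [← div_eq_inv_mul, le_div_iff₀ hc', mul_comm] at h

theorem fblNorm_eq_zero {f : FBL E} (h : fblNorm E f = 0) : f = 0 := by
  refine Subtype.ext (funext fun φ => ?_)
  have := FBL.abs_apply_le f φ
  rw [h, mul_zero] at this
  exact abs_eq_zero.1 (le_antisymm this (abs_nonneg _))

theorem exists_fbl_limit (u : ℕ → FBL E)
    (hu : ∀ ε : ℝ, 0 < ε → ∃ n₀ : ℕ, ∀ m n : ℕ, n₀ ≤ m → n₀ ≤ n → fblNorm E (u m - u n) < ε) :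
    ∃ f, Tendsto (fun n => fblNorm E (u n - f)) atTop (𝓝 0) := by
  have hlim : ∀ φ : StrongDual ℝ E, ∃ l, Tendsto (fun n => (u n).1 φ) atTop (𝓝 l) := by
    intro φ
    refine cauchySeq_tendsto_of_complete (Metric.cauchySeq_iff.2 fun ε hε => ?_)
    obtain ⟨n₀, h⟩ := hu (ε / (‖φ‖ + 1)) (by positivity)
    refine ⟨n₀, fun m hm n hn => ?_⟩
    have h1 := h m n hm hn
    rw [lt_div_iff₀ (by positivity)] at h1
    have h2 : |(u m).1 φ - (u n).1 φ| ≤ ‖φ‖ * fblNorm E (u m - u n) :=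
      FBL.abs_apply_le (u m - u n) φ
    rw [Real.dist_eq]
    nlinarith [fblNorm_nonneg (u m - u n)]
  choose l hl using hlim
  -- For each finite admissible family the Cauchy estimate passes to the pointwise limit, so it
  -- survives the supremum.
  have hclose : ∀ ε > 0, ∃ n₀, ∀ n, n₀ ≤ n → fblENorm E ((u n).1 - l) ≤ ENNReal.ofReal ε := by
    intro ε hε
    obtain ⟨n₀, h⟩ := hu ε hε
    refine ⟨n₀, fun n hn => iSup_le fun N => iSup_le fun φ => iSup_le fun hφ => ?_⟩
    rw [← ENNReal.ofReal_sum_of_nonneg fun i _ => abs_nonneg _]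
    refine ENNReal.ofReal_le_ofReal ?_
    have ht : Tendsto (fun m => ∑ i, |(u n).1 (φ i) - (u m).1 (φ i)|) atTop
        (𝓝 (∑ i, |((u n).1 - l) (φ i)|)) :=
      tendsto_finsetSum _ fun i _ => (tendsto_const_nhds.sub (hl (φ i))).abs
    refine le_of_tendsto ht ?_
    filter_upwards [eventually_ge_atTop n₀] with m hm
    exact (sum_abs_apply_le_fblNorm (u n - u m) hφ).trans (h n m hn hm).le
  have hmem : InFBL E l := by
    refine ⟨fun c φ hc => ?_, fun ε hε => ?_⟩
    · refine tendsto_nhds_unique (hl (c • φ)) ?_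
      simp only [FBL.apply_smul _ hc]
      exact (hl φ).const_mul c
    · obtain ⟨δ, hδ0, hδ⟩ : ∃ δ : ℝ, 0 < δ ∧ ENNReal.ofReal δ < ε / 2 := by
        obtain ⟨q, hq0, hq⟩ := ENNReal.lt_iff_exists_nnreal_btwn.1 (ENNReal.half_pos hε.ne')
        refine ⟨q, by exact_mod_cast hq0, ?_⟩
        rwa [ENNReal.ofReal_coe_nnreal]
      obtain ⟨n₀, h⟩ := hclose δ hδ0
      obtain ⟨g, hg, hgl⟩ := (u n₀).2.2 (ε / 2) (ENNReal.half_pos hε.ne')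
      refine ⟨g, hg, ?_⟩
      calc fblENorm E (l - g) ≤ fblENorm E ((u n₀).1 - l) + fblENorm E ((u n₀).1 - g) := by
            refine fblENorm_le_add fun φ => ?_
            have e : (l - g) φ = -((u n₀).1 - l) φ + ((u n₀).1 - g) φ := by
              simp only [Pi.sub_apply]
              ring
            rw [e]
            exact (abs_add_le _ _).trans (by rw [abs_neg])
        _ < ε / 2 + ε / 2 := ENNReal.add_lt_add ((h n₀ le_rfl).trans_lt hδ) hgl
        _ = ε := ENNReal.add_halves ε
  refine ⟨⟨l, hmem⟩, Metric.tendsto_atTop.2 fun ε hε => ?_⟩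
  obtain ⟨n₀, h⟩ := hclose (ε / 2) (half_pos hε)
  refine ⟨n₀, fun n hn => ?_⟩
  rw [dist_zero_right, Real.norm_eq_abs, abs_of_nonneg (fblNorm_nonneg _)]
  have : fblNorm E (u n - ⟨l, hmem⟩) ≤ ε / 2 :=
    ENNReal.toReal_le_of_le_ofReal (half_pos hε).le (h n hn)
  linarith

variable (E) in
theorem isPBanachLattice_fblNorm : IsPBanachLattice 1 (fblNorm E) where
  nonneg := fblNorm_nonneg
  eq_zero := fun _ => fblNorm_eq_zero
  smul := fblNorm_smul
  add_le := ⟨1, le_rfl, fun f g => by rw [one_mul]; exact fblNorm_add_le f g⟩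
  complete := exists_fbl_limit
  add_mono := fun f g h hfg => FBL.le_iff.2 fun φ =>
    add_le_add_left (FBL.le_iff.1 hfg φ) (h.1 φ)
  smul_mono := fun c f g hc hfg => FBL.le_iff.2 fun φ =>
    mul_le_mul_of_nonneg_left (FBL.le_iff.1 hfg φ) hc
  solid := by
    intro f g hfg
    refine ENNReal.toReal_le_of_le_ofReal (fblNorm_nonneg g) ?_
    rw [ofReal_fblNorm]
    refine iSup_le fun n => iSup_le fun φ => iSup_le fun hφ => ?_
    refine le_trans (Finset.sum_le_sum fun i _ => ENNReal.ofReal_le_ofReal ?_)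
      (le_iSup_of_le n (le_iSup_of_le φ (le_iSup_of_le hφ le_rfl)))
    have := FBL.le_iff.1 hfg (φ i)
    rwa [FBL.abs_apply, FBL.abs_apply] at this
  p_add_le := by simpa using fblNorm_add_le

end FreeBanachLattice

/-! ### Failure of the lattice homomorphic extension. -/

/-- A lattice homomorphism from a Banach lattice to a quasi-Banach lattice controls the sums
`∑ |S (δ x_k)|`. -/
theorem exists_sum_abs_le {E F X : Type} [NormedAddCommGroup E] [NormedSpace ℝ E] [AddCommGroup F]
    [Module ℝ F] [Lattice F] [AddCommGroup X] [Module ℝ X] [Lattice X] {NF : F → ℝ} {NX : X → ℝ}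
    (hF : IsPBanachLattice 1 NF) (hX : IsQuasiBanachLattice NX) {δ : E →ₗ[ℝ] F} {K : ℝ}
    (hδ : ∀ x, NF (δ x) ≤ K * ‖x‖) {S : F →ₗ[ℝ] X} (hS : IsLatticeHom S) :
    ∃ C, ∀ (s : Finset ℕ) (x : ℕ → E), NX (∑ k ∈ s, |S (δ (x k))|) ≤ C * ∑ k ∈ s, ‖x k‖ := by
  obtain ⟨C, hC0, hC⟩ := hS.bounded hF.toIsQuasiBanachLattice hX
  refine ⟨C * K, fun s x => ?_⟩
  calc NX (∑ k ∈ s, |S (δ (x k))|) = NX (S (∑ k ∈ s, |δ (x k)|)) := by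
        rw [map_sum]
        simp only [hS.map_abs]
    _ ≤ C * NF (∑ k ∈ s, |δ (x k)|) := hC _
    _ ≤ C * ∑ k ∈ s, NF |δ (x k)| := by
        gcongr
        exact hF.sum_le_of_one s _
    _ ≤ C * ∑ k ∈ s, K * ‖x k‖ := by
        gcongr with k _
        rw [hF.abs]
        exact hδ _
    _ = C * K * ∑ k ∈ s, ‖x k‖ := by rw [← Finset.mul_sum, mul_assoc]

theorem norm_indicatorL1 {a b : ℝ} (hab : a ≤ b) : ‖indicatorL1 a b‖ = b - a := by
  rw [indicatorL1, norm_indicatorConstLp one_ne_zero ENNReal.one_ne_top]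
  simp [hab]

/-- The Hilbert transform does not factor as a lattice homomorphism after an operator into a Banach
lattice. -/
theorem not_factor_hilbertTransform {F : Type} [AddCommGroup F] [Module ℝ F] [Lattice F]
    {NF : F → ℝ} (hF : IsPBanachLattice 1 NF) {δ : L1 →ₗ[ℝ] F} {K : ℝ}
    (hδ : ∀ f, NF (δ f) ≤ K * ‖f‖) {S : F →ₗ[ℝ] WeakL1} (hS : IsLatticeHom S)
    (hST : ∀ f, S (δ f) = hilbertTransform f) : False := by
  obtain ⟨C, hC⟩ := exists_sum_abs_le hF isQuasiBanachLattice_weakNorm hδ hS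
  have h1 := tendsto_weakNorm_sum_abs_hilbertTransform
  obtain ⟨n, hn, hn0⟩ := ((h1.eventually_gt_atTop C).and (eventually_gt_atTop 0)).exists
  have h2 := hC (Finset.range n) fun k => indicatorL1 ((k : ℝ) / n) (((k : ℝ) + 1) / n)
  simp only [hST] at h2
  have hn0' : (0 : ℝ) < n := by exact_mod_cast hn0
  have h3 : ∑ k ∈ Finset.range n, ‖indicatorL1 ((k : ℝ) / n) (((k : ℝ) + 1) / n)‖ = 1 := by
    have e : ∀ k : ℕ, ‖indicatorL1 ((k : ℝ) / n) (((k : ℝ) + 1) / n)‖ = 1 / n := by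
      intro k
      rw [norm_indicatorL1 (by gcongr; linarith)]
      ring
    simp only [e, Finset.sum_const, Finset.card_range, nsmul_eq_mul]
    exact mul_one_div_cancel hn0'.ne'
  rw [h3, mul_one] at h2
  linarith

theorem not_exists_latticeHom_fbl : ¬ ∃ S : FBL L1 →ₗ[ℝ] WeakL1, IsLatticeHom S ∧
    ∀ f : L1, S (fblDelta L1 f) = hilbertTransform f := fun ⟨_, hS, hST⟩ =>
  not_factor_hilbertTransform (isPBanachLattice_fblNorm L1) (K := 1)
    (fun f => by rw [one_mul]; exact fblNorm_delta_le f) hS hST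

theorem isOperator_hilbertTransform : IsOperator (fun f : L1 => ‖f‖) weakNorm hilbertTransform :=
  ⟨160, weakNorm_hilbertTransform_le⟩

theorem not_autoExtension_L1 : ¬ AutoExtension L1 := by
  rintro ⟨C, _, hC⟩
  -- The index `1/2` is admissible for the weak quasi-norm itself: it is a `1/2`-norm and is
  -- `1/2`-convex.
  obtain ⟨S, ⟨hS, hST, _⟩, _⟩ := hC (1 / 2) (by norm_num) (by norm_num) WeakL1 weakNorm
    isPBanachLattice_weakNorm (isPConvex_weakNorm (by norm_num) (by norm_num)) hilbertTransform
    isOperator_hilbertTransform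
  exact not_exists_latticeHom_fbl ⟨S, hS, hST⟩

theorem not_autoExtensionAt_L1 {q : ℝ} (hq : 0 < q) (hq1 : q < 1) : ¬ AutoExtensionAt L1 q := by
  rintro ⟨C, _, hC⟩
  obtain ⟨S, ⟨hS, hST, _⟩, _⟩ := hC WeakL1 weakNorm isQuasiBanachLattice_weakNorm
    (isPConvex_weakNorm hq hq1) hilbertTransform isOperator_hilbertTransform
  exact not_exists_latticeHom_fbl ⟨S, hS, hST⟩

/-! ### Naturality and trivial type of `L_1(ℝ)`. -/

theorem isPBanachLattice_L1 : IsPBanachLattice 1 fun f : L1 => ‖f‖ where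
  nonneg := norm_nonneg
  eq_zero := fun _ => norm_eq_zero.1
  smul := fun c f => norm_smul c f
  add_le := ⟨1, le_rfl, fun f g => by rw [one_mul]; exact norm_add_le f g⟩
  complete := by
    intro u hu
    have hc : CauchySeq u := Metric.cauchySeq_iff.2 fun ε hε => by
      obtain ⟨n₀, h⟩ := hu ε hε
      exact ⟨n₀, fun m hm n hn => by rw [dist_eq_norm]; exact h m n hm hn⟩
    obtain ⟨f, hf⟩ := cauchySeq_tendsto_of_complete hc
    exact ⟨f, tendsto_iff_norm_sub_tendsto_zero.1 hf⟩
  add_mono := fun f g h hfg => add_le_add_left hfg h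
  smul_mono := by
    intro c f g hc hfg
    rw [← Lp.coeFn_le] at hfg ⊢
    filter_upwards [hfg, Lp.coeFn_smul c f, Lp.coeFn_smul c g] with x h1 h2 h3
    rw [h2, h3]
    exact mul_le_mul_of_nonneg_left h1 hc
  solid := fun f g hfg => norm_le_norm_of_abs_le_abs hfg
  p_add_le := by simpa using fun f g : L1 => norm_add_le f g

theorem isPNatural_L1 {p : ℝ} (hp : 0 < p) (hp1 : p ≤ 1) : IsPNatural p fun f : L1 => ‖f‖ := by
  refine ⟨L1, inferInstance, inferInstance, inferInstance, fun f => ‖f‖, LinearMap.id,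
    isPBanachLattice_L1.of_one hp hp1, ⟨1, isPBanachLattice_L1.pConvexWith_one hp hp1⟩,
    isPBanachLattice_L1.convexityConst_eq_one hp hp1 (x := indicatorL1 0 1) ?_, fun f => rfl⟩
  rw [norm_indicatorL1 zero_le_one]
  norm_num

theorem naturalIndex_L1 : naturalIndex (fun f : L1 => ‖f‖) = 1 := by
  have e : {p : ℝ | 0 < p ∧ p < 1 ∧ IsPNatural p fun f : L1 => ‖f‖} = Set.Ioo 0 1 := by
    ext p
    exact ⟨fun h => ⟨h.1, h.2.1⟩, fun h => ⟨h.1, h.2, isPNatural_L1 h.1 h.2.le⟩⟩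
  rw [naturalIndex, e, csSup_Ioo zero_lt_one]

/-- The intervals meet only at integers, so the absolute value is almost everywhere the sum of the
indicators, whatever the signs. Thus type `p` would give `n ≤ C * n ^ (1 / p)` for all `n > 0`,
which fails for `p > 1`. -/
theorem norm_sum_smul_indicatorL1 (n : ℕ) (c : Fin n → ℝ) (hc : ∀ i, |c i| = 1) :
    ‖∑ i : Fin n, c i • indicatorL1 (i : ℝ) ((i : ℝ) + 1)‖ = n := by
  rw [L1.norm_eq_integral_norm]
  have hnull : ∀ᵐ t : ℝ, t ∉ Set.range ((↑) : ℕ → ℝ) :=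
    measure_eq_zero_iff_ae_notMem.1 ((Set.countable_range _).measure_zero _)
  have hsm : ∀ᵐ t : ℝ, ∀ i : Fin n, (c i • indicatorL1 (i : ℝ) ((i : ℝ) + 1) : L1) t
      = c i * (Set.Icc (i : ℝ) ((i : ℝ) + 1)).indicator (fun _ => (1 : ℝ)) t := by
    rw [ae_all_iff]
    intro i
    have hco : (indicatorL1 (i : ℝ) ((i : ℝ) + 1) : ℝ → ℝ) =ᵐ[volume]
      (Set.Icc (i : ℝ) ((i : ℝ) + 1)).indicator fun _ => 1 := indicatorConstLp_coeFn
    filter_upwards [Lp.coeFn_smul (c i) (indicatorL1 (i : ℝ) ((i : ℝ) + 1)), hco] with t h1 h2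
    rw [h1, Pi.smul_apply, h2, smul_eq_mul]
  have hae : ∀ᵐ t : ℝ, ‖(∑ i : Fin n, c i • indicatorL1 (i : ℝ) ((i : ℝ) + 1) : L1) t‖
      = ∑ i : Fin n, (Set.Icc (i : ℝ) ((i : ℝ) + 1)).indicator (fun _ => (1 : ℝ)) t := by
    filter_upwards [hnull, hsm, Lp.coeFn_finsetSum Finset.univ
      fun i : Fin n => c i • indicatorL1 (i : ℝ) ((i : ℝ) + 1)] with t ht h1 h2
    rw [h2, Finset.sum_apply]
    simp only [h1]
    have huniq : ∀ i j : Fin n, t ∈ Set.Icc (i : ℝ) ((i : ℝ) + 1) →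
        t ∈ Set.Icc (j : ℝ) ((j : ℝ) + 1) → i ≤ j := by
      intro i j hi hj
      have h3 : (j : ℝ) + 1 ≠ t := fun h => ht ⟨j + 1, by push_cast; exact h⟩
      have h4 : ((i : ℕ) : ℝ) < ((j + 1 : ℕ) : ℝ) := by
        push_cast
        exact hi.1.trans_lt (lt_of_le_of_ne hj.2 h3.symm)
      have h5 : (i : ℕ) < j + 1 := by exact_mod_cast h4
      exact Fin.le_def.2 (by omega)
    by_cases hex : ∃ i : Fin n, t ∈ Set.Icc (i : ℝ) ((i : ℝ) + 1)
    · obtain ⟨i, hi⟩ := hex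
      have hz : ∀ j : Fin n, j ≠ i →
          (Set.Icc (j : ℝ) ((j : ℝ) + 1)).indicator (fun _ => (1 : ℝ)) t = 0 := fun j hj =>
        Set.indicator_of_notMem
          (fun h => hj (le_antisymm (huniq j i h hi) (huniq i j hi h))) _
      rw [Finset.sum_eq_single i (fun j _ hj => by rw [hz j hj, mul_zero]) (by simp),
        Finset.sum_eq_single i (fun j _ hj => hz j hj) (by simp), Set.indicator_of_mem hi,
        mul_one, Real.norm_eq_abs, hc]
    · have hz : ∀ j : Fin n,
          (Set.Icc (j : ℝ) ((j : ℝ) + 1)).indicator (fun _ => (1 : ℝ)) t = 0 := fun j =>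
        Set.indicator_of_notMem (fun h => hex ⟨j, h⟩) _
      simp [hz]
  rw [integral_congr_ae hae, integral_finsetSum]
  · simp [integral_indicator measurableSet_Icc]
  · intro i _
    exact (integrable_indicator_iff measurableSet_Icc).2
      (integrableOn_const measure_Icc_lt_top.ne)

theorem not_hasNontrivialType_L1 : ¬ HasNontrivialType L1 := by
  rintro ⟨p, hp1, _, C, hC, h⟩
  have hp0 : 0 < p := by linarith
  have hle : ∀ n : ℕ, 0 < n → (n : ℝ) ^ (1 - 1 / p) ≤ C := by
    intro n hn
    have hn0 : (0 : ℝ) < n := by exact_mod_cast hn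
    have h1 := h n fun i => indicatorL1 (i : ℝ) ((i : ℝ) + 1)
    have h2 : ∀ ε : Fin n → Bool,
        ‖∑ i : Fin n, (if ε i then (1 : ℝ) else -1) • indicatorL1 (i : ℝ) ((i : ℝ) + 1)‖ = n :=
      fun ε => norm_sum_smul_indicatorL1 n _ fun i => by split_ifs <;> simp
    have h3 : ∀ i : Fin n, ‖indicatorL1 (i : ℝ) ((i : ℝ) + 1)‖ = 1 := fun i => by
      rw [norm_indicatorL1 (by linarith)]
      ring
    simp only [h2, h3, Finset.sum_const, Finset.card_univ, Fintype.card_fun, Fintype.card_bool,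
      Fintype.card_fin, nsmul_eq_mul, Real.one_rpow, mul_one] at h1
    push_cast at h1
    rw [mul_div_cancel_left₀ _ (by positivity), ← Real.rpow_mul hn0.le,
      mul_one_div_cancel hp0.ne', Real.rpow_one] at h1
    rw [Real.rpow_sub hn0, Real.rpow_one, div_le_iff₀ (by positivity)]
    exact h1
  have hpos : 0 < 1 - 1 / p := by
    rw [sub_pos, div_lt_one hp0]
    exact hp1
  have hlim := (tendsto_rpow_atTop hpos).comp tendsto_natCast_atTop_atTop
  obtain ⟨n, hn, hn0⟩ := ((hlim.eventually_gt_atTop C).and (eventually_gt_atTop 0)).exists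
  exact absurd (hle n hn0) (not_le.2 hn)

/-! ### Free `p`-convex lattices for `p < 1` against Banach lattices. -/

/-- The free `p`-convex `p`-Banach lattice generated by `L_1(ℝ)` is not lattice isomorphic to a
Banach lattice. -/
theorem IsFreePConvex.not_latticeIso {p : ℝ} (hp : 0 < p) (hp1 : p < 1) {Z W : Type}
    [AddCommGroup Z] [Module ℝ Z] [Lattice Z] [AddCommGroup W] [Module ℝ W] [Lattice W]
    {NZ : Z → ℝ} {ι : L1 →ₗ[ℝ] Z} {NW : W → ℝ} (hZ : IsFreePConvex p (fun f : L1 => ‖f‖) NZ ι)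
    (hW : IsPBanachLattice 1 NW) : ¬ ∃ Φ : Z ≃ₗ[ℝ] W, IsLatticeHom Φ.toLinearMap := by
  rintro ⟨Φ, hΦ⟩
  -- The universal property asks for a `p`-norm on the target, so `L_{1,∞}(ℝ)` is renormed by
  -- `locNorm p`; an extension is still a lattice homomorphism into the same lattice.
  have hop : IsOperator (fun f : L1 => ‖f‖) (locNorm p) hilbertTransform := by
    refine ⟨(1 / (1 - p)) ^ (1 / p) * 160, fun f => (locNorm_le hp hp1 _).trans ?_⟩
    have hq : 0 < 1 - p := by linarith
    rw [mul_assoc]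
    gcongr
    exact weakNorm_hilbertTransform_le f
  obtain ⟨S, ⟨hS, hST, _⟩, _⟩ := hZ.universal WeakL1 (locNorm p) (isPBanachLattice_locNorm hp hp1)
    ⟨1, pConvexWith_locNorm hp hp1⟩ hilbertTransform hop
  obtain ⟨K, hK0, hK⟩ := hΦ.bounded hZ.lattice.toIsQuasiBanachLattice hW.toIsQuasiBanachLattice
  have hsymm : IsLatticeHom (S ∘ₗ Φ.symm.toLinearMap) := by
    have h1 : ∀ x y, Φ.symm (x ⊔ y) = Φ.symm x ⊔ Φ.symm y := fun x y => by
      have := hΦ.1 (Φ.symm x) (Φ.symm y)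
      simp only [LinearEquiv.coe_coe, LinearEquiv.apply_symm_apply] at this
      rw [← this, LinearEquiv.symm_apply_apply]
    have h2 : ∀ x y, Φ.symm (x ⊓ y) = Φ.symm x ⊓ Φ.symm y := fun x y => by
      have := hΦ.2 (Φ.symm x) (Φ.symm y)
      simp only [LinearEquiv.coe_coe, LinearEquiv.apply_symm_apply] at this
      rw [← this, LinearEquiv.symm_apply_apply]
    refine ⟨fun x y => ?_, fun x y => ?_⟩
    · simp only [LinearMap.comp_apply, LinearEquiv.coe_coe, h1, hS.1]
    · simp only [LinearMap.comp_apply, LinearEquiv.coe_coe, h2, hS.2]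
  -- Through `Φ` the Hilbert transform would factor over the Banach lattice `W`, with the embedding
  -- `Φ ∘ ι` bounded by automatic continuity of `Φ`.
  refine not_factor_hilbertTransform hW (δ := Φ.toLinearMap ∘ₗ ι) (K := K) (fun f => ?_) hsymm
    fun f => ?_
  · have := hK (ι f)
    rwa [hZ.isometry] at this
  · simp [hST]

end QBL

theorem mainTheorem11 :
    ∃ H : QBL.L1 →ₗ[ℝ] QBL.WeakL1,
      -- `H` is the Hilbert transform, a well-defined operator from `L_1` to `L_{1,∞}`
      (∀ f : QBL.L1, ∀ᵐ x : ℝ, QBL.IsHilbertValue f x ((H f : ℝ →ₘ[volume] ℝ) x)) ∧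
      QBL.IsOperator (fun f : QBL.L1 => ‖f‖) QBL.weakNorm H ∧
      -- the target is a quasi-Banach lattice covered by the extension results
      QBL.IsPBanachLattice (1 / 2) QBL.weakNorm ∧
      (∀ p : ℝ, 0 < p → p < 1 → QBL.IsPConvex p QBL.weakNorm) ∧
      -- `H` has no lattice homomorphic extension to `FBL[L_1]`
      (¬ ∃ S : QBL.FBL QBL.L1 →ₗ[ℝ] QBL.WeakL1, QBL.IsLatticeHom S ∧
        ∀ f : QBL.L1, S (QBL.fblDelta QBL.L1 f) = H f) ∧
      -- the quasi-norms of `∑ |H 1_{[k/n,(k+1)/n]}|` tend to infinity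
      Tendsto (fun n : ℕ => QBL.weakNorm
        (∑ k ∈ Finset.range n, |H (QBL.indicatorL1 ((k : ℝ) / n) (((k : ℝ) + 1) / n))|))
        atTop atTop ∧
      -- `L_1` has trivial type, and the automatic extension property fails for it
      ¬ QBL.HasNontrivialType QBL.L1 ∧
      ¬ QBL.AutoExtension QBL.L1 ∧
      -- `L_1` is `p_E`-natural with `p_E = 1`, and the index `p_E` is not admissible
      QBL.naturalIndex (fun f : QBL.L1 => ‖f‖) = 1 ∧
      QBL.IsPNatural 1 (fun f : QBL.L1 => ‖f‖) ∧
      (∀ q : ℝ, 0 < q → q < 1 → ¬ QBL.AutoExtensionAt QBL.L1 q) ∧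
      (∀ p : ℝ, 0 < p → p < 1 →
        ∀ (Z : Type) [AddCommGroup Z] [Module ℝ Z] [Lattice Z] (NZ : Z → ℝ) (ι : QBL.L1 →ₗ[ℝ] Z)
          (W : Type) [AddCommGroup W] [Module ℝ W] [Lattice W] (NW : W → ℝ) (δ : QBL.L1 →ₗ[ℝ] W),
          QBL.IsFreePConvex p (fun f : QBL.L1 => ‖f‖) NZ ι →
          QBL.IsFreePConvex 1 (fun f : QBL.L1 => ‖f‖) NW δ →
          ¬ ∃ Φ : Z ≃ₗ[ℝ] W, QBL.IsLatticeHom Φ.toLinearMap) :=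
  ⟨QBL.hilbertTransform, QBL.hilbertTransform_spec, QBL.isOperator_hilbertTransform,
    QBL.isPBanachLattice_weakNorm, fun _ => QBL.isPConvex_weakNorm, QBL.not_exists_latticeHom_fbl,
    QBL.tendsto_weakNorm_sum_abs_hilbertTransform, QBL.not_hasNontrivialType_L1,
    QBL.not_autoExtension_L1, QBL.naturalIndex_L1, QBL.isPNatural_L1 one_pos le_rfl,
    fun _ => QBL.not_autoExtensionAt_L1,
    fun _ hp hp1 _ _ _ _ _ _ _ _ _ _ _ _ hZ hW => hZ.not_latticeIso hp hp1 hW.lattice⟩
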